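/- Let $k$ be a field and let $\Lambda$ be a DG algebra over $k$ with zero differential whose underlying graded algebra is an exterior $k$-algebra on alternating indeterminates $\xi_1,\dots,\xi_c$ ($c\ge 0$) of positive odd (homological) degrees. DG modules are left DG $\Lambda$-modules, and $k$ is a DG $\Lambda$-module, concentrated in degree $0$, through the augmentation $\Lambda\to k$, $\xi_i\mapsto 0$. For DG $\Lambda$-modules $U,V$ put $\operatorname{Ext}^n_\Lambda(U,V)=H^n(\operatorname{Hom}_\Lambda(F,V))$, where $F\to U$ is a semifree resolution. The complexity of a sequence $(b_n)_{n\in\mathbb Z}$ with values in $\mathbb N\cup\{\infty\}$ is $$\operatorname{cx}(b_n)=\inf\{d\in\mathbb N \mid \text{there is } a\in\mathbb R \text{ with } b_n\le a\,n^{d-1} \text{ for all } n\gg 0\}\in\mathbb N\cup\{\infty\}.$$ Set $\operatorname{cx}_\Lambda(U,V)=\operatorname{cx}\big(\operatorname{rank}_k\operatorname{Ext}^n_\Lambda(U,V)\big)$, $\operatorname{cx}_\Lambda U=\operatorname{cx}_\Lambda(U,k)$ and $\operatorname{inj\,cx}_\Lambda U=\operatorname{cx}_\Lambda(k,U)$.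 Theorem. For all DG $\Lambda$-modules $U,V$ whose homology $H(U)=\bigoplus_n H_n(U)$ and $H(V)=\bigoplus_n H_n(V)$ is finite over $k$, $$\operatorname{cx}_\Lambda(V,U)=\operatorname{cx}_\Lambda(U,V)\le\operatorname{cx}_\Lambda(U,U)=\operatorname{inj\,cx}_\Lambda U=\operatorname{cx}_\Lambda U\le\operatorname{cx}_\Lambda k=c .$$ -/

import Mathlib

open scoped DirectSum

universe u

noncomputable section

/-! ### DG modules

Gradings are homological: differentials have degree `-1`.  A graded algebra `A` over a field `k`,
with homogeneous components `𝒜 n`, is regarded as a DG algebra with zero differential. -/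

section Basic

variable {k A : Type u} [Field k] [Ring A] [Algebra k A]

/-- A (left) DG module over the graded `k`-algebra `A` with zero differential: an `A`-module which
is the internal direct sum of its components `U_n` (`n ∈ ℤ`), with `A_i U_j ⊆ U_{i+j}`, and with a
`k`-linear differential `d` of degree `-1` such that `d² = 0` and `d (a u) = (-1)^{|a|} a (d u)`
(the Leibniz rule, the differential of `A` being zero). -/
structure DGModule (𝒜 : ℤ → Submodule k A) : Type (u + 1) where
  carrier : Type u
  [addCommGroup : AddCommGroup carrier]
  [moduleBase : Module k carrier]
  [module : Module A carrier]
  [isScalarTower : IsScalarTower k A carrier]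
  /-- the homogeneous components -/
  gr : ℤ → Submodule k carrier
  isInternal : DirectSum.IsInternal gr
  smul_mem : ∀ {i j : ℤ} {a : A} {u : carrier}, a ∈ 𝒜 i → u ∈ gr j → a • u ∈ gr (i + j)
  /-- the differential -/
  d : carrier →ₗ[k] carrier
  d_mem : ∀ {n : ℤ} {u : carrier}, u ∈ gr n → d u ∈ gr (n - 1)
  d_d : ∀ u : carrier, d (d u) = 0
  d_smul : ∀ {i : ℤ} {a : A}, a ∈ 𝒜 i → ∀ u : carrier, d (a • u) = i.negOnePow • (a • d u)

namespace DGModule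

attribute [instance] addCommGroup moduleBase module isScalarTower

variable {𝒜 : ℤ → Submodule k A}

instance : CoeSort (DGModule 𝒜) (Type u) := ⟨carrier⟩

/-- The cycles of degree `n`. -/
def cycles (U : DGModule 𝒜) (n : ℤ) : Submodule k U := U.gr n ⊓ LinearMap.ker U.d

/-- The boundaries of degree `n`. -/
def boundaries (U : DGModule 𝒜) (n : ℤ) : Submodule k U := (U.gr (n + 1)).map U.d

/-- The homology `H_n(U)`. -/
abbrev homology (U : DGModule 𝒜) (n : ℤ) : Type u :=
  U.cycles n ⧸ (U.boundaries n).submoduleOf (U.cycles n)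

/-- The homology `H(U) = ⨁ H_n(U)` is finite over `k`. -/
def HasFiniteHomology (U : DGModule 𝒜) : Prop := Module.Finite k (⨁ n : ℤ, U.homology n)

/-- A morphism of DG modules: an `A`-linear map of degree `0` commuting with the differentials. -/
structure Hom (U V : DGModule 𝒜) where
  toFun : U →ₗ[A] V
  map_mem : ∀ {n : ℤ} {u : U}, u ∈ U.gr n → toFun u ∈ V.gr n
  map_d : ∀ u : U, toFun (U.d u) = V.d (toFun u)

/-- The map induced by a morphism on the cycles of degree `n`. -/
def Hom.cyclesMap {U V : DGModule 𝒜} (f : Hom U V) (n : ℤ) : U.cycles n →ₗ[k] V.cycles n :=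
  (f.toFun.restrictScalars k).restrict (by
    rintro u ⟨h, hd⟩
    refine ⟨f.map_mem h, ?_⟩
    have hd' : U.d u = 0 := hd
    change V.d (f.toFun u) = 0
    rw [← f.map_d, hd', map_zero])

/-- The map induced by a morphism on homology in degree `n`. -/
def Hom.homologyMap {U V : DGModule 𝒜} (f : Hom U V) (n : ℤ) : U.homology n →ₗ[k] V.homology n :=
  Submodule.mapQ _ _ (f.cyclesMap n) (by
    rintro ⟨u, hu⟩ h
    obtain ⟨w, hw, hwu⟩ : ∃ w ∈ U.gr (n + 1), U.d w = u := h
    refine ⟨f.toFun w, f.map_mem hw, ?_⟩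
    rw [← f.map_d, hwu]
    rfl)

/-- A quasi-isomorphism: a morphism that is bijective in homology. -/
def Hom.IsQuasiIso {U V : DGModule 𝒜} (f : Hom U V) : Prop :=
  ∀ n : ℤ, Function.Bijective (f.homologyMap n)

/-- A semifree DG module: it has a semibasis, that is, a basis over `A` of homogeneous
elements `e_i`, with a level `lvl i ∈ ℕ` assigned to each, such that `d (e_i)` lies in the
`A`-span of the `e_j` of smaller level.  Equivalently, the DG submodules `F^n` spanned by the
`e_i` of level `< n` form an exhaustive filtration starting at `F^0 = 0`, and each `F^{n+1}/F^n`
is free on homogeneous cycles, that is, a direct sum of suspensions of `A`. -/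
def IsSemifree (F : DGModule 𝒜) : Prop :=
  ∃ (ι : Type u) (e : Module.Basis ι A F) (deg : ι → ℤ) (lvl : ι → ℕ), ∀ i : ι,
    e i ∈ F.gr (deg i) ∧ F.d (e i) ∈ Submodule.span A (e '' {j | lvl j < lvl i})

/-- A semifree resolution of `U`: a quasi-isomorphism `F → U` with `F` semifree. -/
structure SemifreeResolution (U : DGModule 𝒜) where
  F : DGModule 𝒜
  isSemifree : F.IsSemifree
  π : Hom F U
  isQuasiIso : π.IsQuasiIso

end DGModule

/-! ### Existence of semifree resolutions

The resolution is free on a set of `cells`.  A cell records a formal combination `∑ a_i e_{t_i}` of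
earlier cells `t_i`, an element `v` of `U`, and a degree `m`.  If the combination is a cycle of
degree `m - 1` that maps to `d v`, the new generator has it as its boundary, and maps to `v`. -/

namespace DGModule

/-- The linear map `a ↦ (-1)^{|a|} a` of a graded algebra. -/
def signMap (𝒜 : ℤ → Submodule k A) [GradedAlgebra 𝒜] : A →ₗ[k] A :=
  (DirectSum.toModule k ℤ A (fun i => i.negOnePow • (𝒜 i).subtype)) ∘ₗ
    (DirectSum.decomposeLinearEquiv 𝒜).toLinearMap

/-- Formal cells. -/
inductive Cell (A U : Type u) : Type u
  | mk (n : ℕ) (a : Fin n → A) (t : Fin n → Cell A U) (v : U) (m : ℤ) : Cell A U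

namespace Cell

def deg {A U : Type u} : Cell A U → ℤ
  | mk _ _ _ _ m => m

def lvl {A U : Type u} : Cell A U → ℕ
  | mk _ _ t _ _ => Finset.univ.sup (fun i => (t i).lvl + 1)

/-- The component of degree `n` of the free module on all cells. -/
def freeGr (𝒜 : ℤ → Submodule k A) (X : Type u) (n : ℤ) : Submodule k (Cell A X →₀ A) where
  carrier := {p | ∀ t, p t ∈ 𝒜 (n - t.deg)}
  add_mem' hp hq t := (𝒜 _).add_mem (hp t) (hq t)
  zero_mem' _ := (𝒜 _).zero_mem
  smul_mem' c _ hp t := (𝒜 _).smul_mem c (hp t)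

open Classical in
/-- The boundary of a cell, and its image in `U`. -/
def data {𝒜 : ℤ → Submodule k A} [GradedAlgebra 𝒜] (U : DGModule 𝒜) :
    Cell A U → (Cell A U →₀ A) × U
  | mk n a t v m =>
    if (∑ i : Fin n, Finsupp.single (t i) (a i)) ∈ freeGr 𝒜 U (m - 1) ∧
        (∑ i : Fin n, signMap 𝒜 (a i) • (data U (t i)).1) = 0 ∧
        (∑ i : Fin n, a i • (data U (t i)).2) = U.d v ∧ v ∈ U.gr m
    then (∑ i : Fin n, Finsupp.single (t i) (a i), v) else 0

end Cell

section Existence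

variable {𝒜 : ℤ → Submodule k A} [GradedAlgebra 𝒜]

lemma signMap_of_mem {i : ℤ} {a : A} (ha : a ∈ 𝒜 i) : signMap 𝒜 a = i.negOnePow • a := by
  rw [signMap, LinearMap.comp_apply, LinearEquiv.coe_coe, DirectSum.decomposeLinearEquiv_apply,
    DirectSum.decompose_of_mem 𝒜 ha]
  exact DirectSum.toModule_lof k (M := fun j => 𝒜 j) i (⟨a, ha⟩ : 𝒜 i)

lemma signMap_mem {i : ℤ} {a : A} (ha : a ∈ 𝒜 i) : signMap 𝒜 a ∈ 𝒜 i := by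
  rw [signMap_of_mem ha, Units.smul_def]
  exact zsmul_mem ha _

lemma signMap_mul {i : ℤ} {b : A} (hb : b ∈ 𝒜 i) (a : A) :
    signMap 𝒜 (b * a) = i.negOnePow • (b * signMap 𝒜 a) := by
  induction a using DirectSum.Decomposition.inductionOn 𝒜 with
  | zero => simp
  | @homogeneous j m =>
    rw [signMap_of_mem m.2, signMap_of_mem (SetLike.mul_mem_graded hb m.2), Int.negOnePow_add,
      mul_smul, mul_smul_comm]
  | add x y hx hy => rw [mul_add, map_add, hx, hy, map_add, mul_add, smul_add]

variable (U : DGModule 𝒜)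

/-- The differential of the free module on all cells. -/
def freeD : (Cell A U →₀ A) →ₗ[k] (Cell A U →₀ A) :=
  Finsupp.lsum k (fun t =>
    ((LinearMap.toSpanSingleton A (Cell A U →₀ A) (Cell.data U t).1).restrictScalars k) ∘ₗ
      signMap 𝒜)

/-- The map from the free module on all cells to `U`. -/
def freePi : (Cell A U →₀ A) →ₗ[A] U := Finsupp.linearCombination A (fun t => (Cell.data U t).2)

lemma freeD_single (t : Cell A U) (a : A) :
    freeD U (Finsupp.single t a) = signMap 𝒜 a • (Cell.data U t).1 := by
  simp [freeD]

lemma freePi_single (t : Cell A U) (a : A) :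
    freePi U (Finsupp.single t a) = a • (Cell.data U t).2 := by
  simp [freePi]

lemma freeD_smul {i : ℤ} {b : A} (hb : b ∈ 𝒜 i) (p : Cell A U →₀ A) :
    freeD U (b • p) = i.negOnePow • (b • freeD U p) := by
  induction p using Finsupp.induction_linear with
  | zero => simp
  | add p q hp hq => simp only [smul_add, map_add, hp, hq]
  | single t a =>
    rw [Finsupp.smul_single, smul_eq_mul, freeD_single, freeD_single, signMap_mul hb, smul_assoc,
      mul_smul]

open Classical in
lemma data_mk (n : ℕ) (a : Fin n → A) (t : Fin n → Cell A U) (v : U) (m : ℤ) :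
    Cell.data U (Cell.mk n a t v m) =
      if (∑ i : Fin n, Finsupp.single (t i) (a i)) ∈ Cell.freeGr 𝒜 U (m - 1) ∧
          freeD U (∑ i : Fin n, Finsupp.single (t i) (a i)) = 0 ∧
          freePi U (∑ i : Fin n, Finsupp.single (t i) (a i)) = U.d v ∧ v ∈ U.gr m
      then (∑ i : Fin n, Finsupp.single (t i) (a i), v) else 0 := by
  rw [Cell.data]
  simp only [map_sum, freeD_single, freePi_single]

lemma data_spec (t : Cell A U) :
    (Cell.data U t).1 ∈ Cell.freeGr 𝒜 U (t.deg - 1) ∧ freeD U (Cell.data U t).1 = 0 ∧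
      freePi U (Cell.data U t).1 = U.d (Cell.data U t).2 ∧ (Cell.data U t).2 ∈ U.gr t.deg ∧
      (Cell.data U t).1 ∈ Submodule.span A
        ((fun s => Finsupp.single s (1 : A)) '' {s | s.lvl < t.lvl}) := by
  cases t with
  | mk n a t v m =>
    rw [data_mk]
    split_ifs with h
    · refine ⟨h.1, h.2.1, h.2.2.1, h.2.2.2, ?_⟩
      change (∑ i : Fin n, Finsupp.single (t i) (a i)) ∈ _
      refine Submodule.sum_mem _ fun i _ => ?_
      rw [show Finsupp.single (t i) (a i) = a i • Finsupp.single (t i) (1 : A) by simp]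
      refine Submodule.smul_mem _ _ (Submodule.subset_span ⟨t i, ?_, rfl⟩)
      change (t i).lvl < Finset.univ.sup (fun i => (t i).lvl + 1)
      exact Nat.lt_of_succ_le (Finset.le_sup (f := fun i => (t i).lvl + 1) (Finset.mem_univ i))
    · simp

lemma freeGr_single {t : Cell A U} {i : ℤ} {a : A} (ha : a ∈ 𝒜 i) :
    Finsupp.single t a ∈ Cell.freeGr 𝒜 U (i + t.deg) := by
  classical
  intro s
  by_cases h : t = s
  · subst h; simpa using ha
  · simp [h]

lemma freeGr_smul {i j : ℤ} {a : A} {p : Cell A U →₀ A} (ha : a ∈ 𝒜 i)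
    (hp : p ∈ Cell.freeGr 𝒜 U j) : a • p ∈ Cell.freeGr 𝒜 U (i + j) := by
  intro t
  have h := SetLike.mul_mem_graded ha (hp t)
  rwa [← add_sub_assoc] at h

lemma freeGr_isInternal : DirectSum.IsInternal (Cell.freeGr 𝒜 (U : Type u)) := by
  classical
  rw [DirectSum.isInternal_submodule_iff_iSupIndep_and_iSup_eq_top]
  constructor
  · rw [iSupIndep_def]
    intro n
    rw [Submodule.disjoint_def]
    intro p hp hq
    ext t
    have hi := (DirectSum.Decomposition.isInternal 𝒜).submodule_iSupIndep (n - t.deg)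
    refine (Submodule.disjoint_def.mp hi) (p t) (hp t) ?_
    have hle : (⨆ j, ⨆ (_ : j ≠ n), Cell.freeGr 𝒜 (U : Type u) j) ≤
        (⨆ j, ⨆ (_ : j ≠ n - t.deg), 𝒜 j).comap (Finsupp.lapply (R := k) t) := by
      refine iSup₂_le fun j hj q hq => ?_
      have h1 : j - t.deg ≠ n - t.deg := by omega
      exact (le_iSup₂ (f := fun j (_ : j ≠ n - t.deg) => 𝒜 j) (j - t.deg) h1) (hq t)
    exact hle hq
  · rw [eq_top_iff]
    rintro p -
    induction p using Finsupp.induction_linear with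
    | zero => exact Submodule.zero_mem _
    | add p q hp hq => exact Submodule.add_mem _ hp hq
    | single t a =>
      induction a using DirectSum.Decomposition.inductionOn 𝒜 with
      | zero => simp
      | @homogeneous j m => exact Submodule.mem_iSup_of_mem _ (freeGr_single U m.2)
      | add x y hx hy => rw [Finsupp.single_add]; exact Submodule.add_mem _ hx hy

lemma freeGr_freeD {n : ℤ} {p : Cell A U →₀ A} (hp : p ∈ Cell.freeGr 𝒜 U n) :
    freeD U p ∈ Cell.freeGr 𝒜 U (n - 1) := by
  rw [← Finsupp.sum_single p, Finsupp.sum, map_sum]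
  refine Submodule.sum_mem _ fun t _ => ?_
  rw [freeD_single]
  have h := freeGr_smul U (signMap_mem (hp t)) (data_spec U t).1
  rwa [sub_add_sub_cancel] at h

lemma freeD_freeD (p : Cell A U →₀ A) : freeD U (freeD U p) = 0 := by
  induction p using Finsupp.induction_linear with
  | zero => simp
  | add p q hp hq => simp only [map_add, hp, hq, add_zero]
  | single t a =>
    induction a using DirectSum.Decomposition.inductionOn 𝒜 with
    | zero => simp
    | @homogeneous j m =>
      rw [freeD_single, freeD_smul U (signMap_mem m.2), (data_spec U t).2.1, smul_zero, smul_zero]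
    | add x y hx hy => rw [Finsupp.single_add, map_add, map_add, hx, hy, add_zero]

/-- The free module on all cells, as a DG module. -/
def freeDG : DGModule 𝒜 where
  carrier := Cell A U →₀ A
  gr := Cell.freeGr 𝒜 U
  isInternal := freeGr_isInternal U
  smul_mem := freeGr_smul U
  d := freeD U
  d_mem := freeGr_freeD U
  d_d := freeD_freeD U
  d_smul := freeD_smul U

lemma freePi_mem {n : ℤ} {p : Cell A U →₀ A} (hp : p ∈ Cell.freeGr 𝒜 U n) :
    freePi U p ∈ U.gr n := by
  rw [← Finsupp.sum_single p, Finsupp.sum, map_sum]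
  refine Submodule.sum_mem _ fun t _ => ?_
  rw [freePi_single]
  have h := U.smul_mem (hp t) (data_spec U t).2.2.2.1
  rwa [sub_add_cancel] at h

lemma freePi_freeD (p : Cell A U →₀ A) : freePi U (freeD U p) = U.d (freePi U p) := by
  induction p using Finsupp.induction_linear with
  | zero => simp
  | add p q hp hq => simp only [map_add, hp, hq]
  | single t a =>
    induction a using DirectSum.Decomposition.inductionOn 𝒜 with
    | zero => simp
    | @homogeneous j m =>
      rw [freeD_single, freePi_single, map_smul, U.d_smul m.2, (data_spec U t).2.2.1,
        signMap_of_mem m.2, smul_assoc]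
    | add x y hx hy => simp only [Finsupp.single_add, map_add, hx, hy]

/-- The morphism from the free DG module on all cells to `U`. -/
def freeHom : Hom (freeDG U) U where
  toFun := freePi U
  map_mem := freePi_mem U
  map_d := freePi_freeD U

lemma exists_cell (z : Cell A U →₀ A) (v : U) (m : ℤ) (hz : z ∈ Cell.freeGr 𝒜 U (m - 1))
    (hdz : freeD U z = 0) (hv : freePi U z = U.d v) (hvm : v ∈ U.gr m) :
    ∃ t : Cell A U, t.deg = m ∧ Cell.data U t = (z, v) := by
  have hsum : ∑ i : Fin z.support.card,
      Finsupp.single (z.support.equivFin.symm i : Cell A U)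
        (z (z.support.equivFin.symm i : Cell A U)) = z := by
    rw [Equiv.sum_comp z.support.equivFin.symm
      (fun s : z.support => Finsupp.single (s : Cell A U) (z s))]
    conv_rhs => rw [← Finsupp.sum_single z]
    exact Finset.sum_coe_sort z.support (fun s => Finsupp.single s (z s))
  refine ⟨Cell.mk z.support.card (fun i => z (z.support.equivFin.symm i : Cell A U))
    (fun i => z.support.equivFin.symm i) v m, rfl, ?_⟩
  rw [data_mk, hsum, if_pos ⟨hz, hdz, hv, hvm⟩]

lemma freeGr_single_one (t : Cell A U) :
    Finsupp.single t (1 : A) ∈ Cell.freeGr 𝒜 U t.deg := by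
  have h := freeGr_single U (t := t) (SetLike.GradedOne.one_mem (A := 𝒜))
  rwa [zero_add] at h

lemma signMap_one : signMap 𝒜 (1 : A) = 1 := by
  rw [signMap_of_mem (SetLike.GradedOne.one_mem (A := 𝒜)), Int.negOnePow_zero, one_smul]

lemma freeHom_isQuasiIso : (freeHom U).IsQuasiIso := by
  intro n
  constructor
  · rw [← LinearMap.ker_eq_bot, LinearMap.ker_eq_bot']
    intro x hx
    obtain ⟨⟨z, hz, hdz⟩, rfl⟩ := Submodule.Quotient.mk_surjective _ x
    have hx' := (Submodule.Quotient.mk_eq_zero _).mp hx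
    obtain ⟨v, hv, hvz⟩ : ∃ v ∈ U.gr (n + 1), U.d v = freePi U z := hx'
    obtain ⟨t, ht, htd⟩ := exists_cell U z v (n + 1)
      (by rw [add_sub_cancel_right]; exact hz) hdz hvz.symm hv
    refine (Submodule.Quotient.mk_eq_zero _).mpr ?_
    refine ⟨Finsupp.single t (1 : A), ?_, ?_⟩
    · change Finsupp.single t (1 : A) ∈ Cell.freeGr 𝒜 U (n + 1)
      rw [← ht]
      exact freeGr_single_one U t
    · change freeD U (Finsupp.single t (1 : A)) = z
      rw [freeD_single, htd, signMap_one, one_smul]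
  · intro y
    obtain ⟨⟨v, hv, hdv⟩, rfl⟩ := Submodule.Quotient.mk_surjective _ y
    have hdv' : U.d v = 0 := hdv
    obtain ⟨t, ht, htd⟩ := exists_cell U 0 v n (Submodule.zero_mem _) (map_zero _)
      (by rw [map_zero, hdv']) hv
    have h1 : Finsupp.single t (1 : A) ∈ Cell.freeGr 𝒜 U n := ht ▸ freeGr_single_one U t
    have h2 : freeD U (Finsupp.single t (1 : A)) = 0 := by
      rw [freeD_single, htd, smul_zero]
    refine ⟨Submodule.Quotient.mk ⟨Finsupp.single t (1 : A), h1, h2⟩, ?_⟩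
    refine congrArg Submodule.Quotient.mk (Subtype.ext ?_)
    change freePi U (Finsupp.single t (1 : A)) = v
    rw [freePi_single, htd, one_smul]

lemma freeDG_isSemifree : (freeDG U).IsSemifree := by
  refine ⟨Cell A U, Finsupp.basisSingleOne, Cell.deg, Cell.lvl, fun t => ?_⟩
  have he : ((Finsupp.basisSingleOne : Module.Basis (Cell A U) A (Cell A U →₀ A)) :
      Cell A U → (Cell A U →₀ A)) = fun s => Finsupp.single s 1 := by
    funext s; exact congrFun Finsupp.coe_basisSingleOne s
  change (Finsupp.basisSingleOne : Module.Basis (Cell A U) A (Cell A U →₀ A)) t ∈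
      Cell.freeGr 𝒜 U t.deg ∧
    freeD U ((Finsupp.basisSingleOne : Module.Basis (Cell A U) A (Cell A U →₀ A)) t) ∈
      Submodule.span A ((Finsupp.basisSingleOne : Module.Basis (Cell A U) A (Cell A U →₀ A)) '' _)
  rw [he]
  refine ⟨freeGr_single_one U t, ?_⟩
  rw [freeD_single, signMap_one, one_smul]
  exact (data_spec U t).2.2.2.2

/-- Every DG module has a semifree resolution. -/
theorem nonempty_semifreeResolution : Nonempty (SemifreeResolution U) :=
  ⟨⟨freeDG U, freeDG_isSemifree U, freeHom U, freeHom_isQuasiIso U⟩⟩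

end Existence

/-! ### Ext and complexity -/

/-- `Hom_A(F, V)^n`: the `k`-linear maps `f` of (homological) degree `-n` with
`f (a x) = (-1)^{n |a|} a (f x)`. -/
def homDeg {𝒜 : ℤ → Submodule k A} (F V : DGModule 𝒜) (n : ℤ) : Submodule k (F →ₗ[k] V) where
  carrier := {f | (∀ i : ℤ, ∀ x ∈ F.gr i, f x ∈ V.gr (i - n)) ∧
    ∀ i : ℤ, ∀ a ∈ 𝒜 i, ∀ x : F, f (a • x) = (n * i).negOnePow • (a • f x)}
  add_mem' := by
    rintro f g ⟨hf, hf'⟩ ⟨hg, hg'⟩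
    refine ⟨fun i x hx => (V.gr _).add_mem (hf i x hx) (hg i x hx), fun i a ha x => ?_⟩
    simp only [LinearMap.add_apply, hf' i a ha, hg' i a ha, smul_add]
  zero_mem' := ⟨fun _ _ _ => (V.gr _).zero_mem, fun _ _ _ _ => by simp⟩
  smul_mem' := by
    rintro r f ⟨hf, hf'⟩
    refine ⟨fun i x hx => (V.gr _).smul_mem r (hf i x hx), fun i a ha x => ?_⟩
    have h : r • a • f x = a • r • f x := by
      rw [← algebraMap_smul A r (a • f x), ← algebraMap_smul A r (f x), smul_smul, smul_smul,
        Algebra.commutes]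
    rw [LinearMap.smul_apply, LinearMap.smul_apply, hf' i a ha, smul_comm r, h]

/-- The differential `f ↦ d f - (-1)^n f d` on `Hom_A(F, V)^n`. -/
def homD {𝒜 : ℤ → Submodule k A} (F V : DGModule 𝒜) (n : ℤ) :
    (F →ₗ[k] V) →ₗ[k] (F →ₗ[k] V) where
  toFun f := V.d ∘ₗ f - n.negOnePow • (f ∘ₗ F.d)
  map_add' f g := by
    ext x
    simp only [LinearMap.sub_apply, LinearMap.add_apply, LinearMap.comp_apply, map_add,
      LinearMap.smul_apply, smul_add]
    abel
  map_smul' r f := by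
    ext x
    simp only [LinearMap.sub_apply, LinearMap.comp_apply, map_smul, LinearMap.smul_apply, smul_sub,
      RingHom.id_apply, smul_comm r]

/-- The cocycles of degree `n` of the complex `Hom_A(F, V)`. -/
def homCocycles {𝒜 : ℤ → Submodule k A} (F V : DGModule 𝒜) (n : ℤ) : Submodule k (F →ₗ[k] V) :=
  homDeg F V n ⊓ LinearMap.ker (homD F V n)

/-- The coboundaries of degree `n` of the complex `Hom_A(F, V)`. -/
def homCoboundaries {𝒜 : ℤ → Submodule k A} (F V : DGModule 𝒜) (n : ℤ) :
    Submodule k (F →ₗ[k] V) :=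
  (homDeg F V (n - 1)).map (homD F V (n - 1))

/-- `H^n(Hom_A(F, V))`. -/
abbrev homCohomology {𝒜 : ℤ → Submodule k A} (F V : DGModule 𝒜) (n : ℤ) : Type u :=
  homCocycles F V n ⧸ (homCoboundaries F V n).submoduleOf (homCocycles F V n)

variable {𝒜 : ℤ → Submodule k A} [GradedAlgebra 𝒜]

/-- A chosen semifree resolution of `U`. -/
def resolution (U : DGModule 𝒜) : SemifreeResolution U :=
  Classical.choice (nonempty_semifreeResolution U)

/-- `Ext_A^n(U, V) = H^n(Hom_A(F, V))` for a semifree resolution `F` of `U`. -/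
abbrev Ext (U V : DGModule 𝒜) (n : ℤ) : Type u := homCohomology (resolution U).F V n

end DGModule

/-- The complexity of a sequence `(b_n)` of elements of `ℕ ∪ {∞}`: the infimum of the `d ∈ ℕ` for
which there is a real `a` with `b_n ≤ a n^{d-1}` for all `n ≫ 0` (it is `∞` if there is no `d`). -/
def seqComplexity (b : ℤ → ℕ∞) : ℕ∞ :=
  sInf {e : ℕ∞ | ∃ d : ℕ, e = d ∧ ∃ a : ℝ, ∀ᶠ n : ℤ in Filter.atTop,
    (b n : ENNReal) ≤ ENNReal.ofReal (a * (n : ℝ) ^ ((d : ℤ) - 1))}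

variable {𝒜 : ℤ → Submodule k A} [GradedAlgebra 𝒜]

/-- The complexity of a pair of DG modules over a non-negative `A` with `A_0 = k` (so that
`Ext ⊗_{A_0} k` is `Ext`): the complexity of the sequence `rank_k Ext_A^n(U, V)`. -/
def cxPair (U V : DGModule 𝒜) : ℕ∞ :=
  seqComplexity (fun n => Cardinal.toENat (Module.rank k (DGModule.Ext U V n)))

/-! ### Exterior algebras and the residue field -/

/-- The graded algebra `A` is an exterior `k`-algebra on alternating indeterminates `ξ_i` of
degrees `deg i`: the `ξ_i` are homogeneous of these degrees, and the linear map from `k^c` to `A`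
with `e_i ↦ ξ_i` extends to an isomorphism of algebras from the exterior algebra of `k^c` to `A`. -/
structure IsExteriorOn (𝒜 : ℤ → Submodule k A) {c : ℕ} (deg : Fin c → ℤ) (ξ : Fin c → A) :
    Prop where
  mem : ∀ i, ξ i ∈ 𝒜 (deg i)
  sq_zero : ∀ v : Fin c → k,
    Fintype.linearCombination k ξ v * Fintype.linearCombination k ξ v = 0
  bijective : Function.Bijective
    (ExteriorAlgebra.lift k ⟨Fintype.linearCombination k ξ, sq_zero⟩ :
      ExteriorAlgebra k (Fin c → k) →ₐ[k] A)

namespace IsExteriorOn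

variable {c : ℕ} {deg : Fin c → ℤ} {ξ : Fin c → A}

/-- The isomorphism from the exterior algebra of `k^c`. -/
def equiv (h : IsExteriorOn 𝒜 deg ξ) : ExteriorAlgebra k (Fin c → k) ≃ₐ[k] A :=
  AlgEquiv.ofBijective _ h.bijective

/-- The augmentation `A → k`, which sends every `ξ_i` to `0`. -/
def augmentation (h : IsExteriorOn 𝒜 deg ξ) : A →ₐ[k] k :=
  ExteriorAlgebra.algebraMapInv.comp h.equiv.symm.toAlgHom

lemma augmentation_gen (h : IsExteriorOn 𝒜 deg ξ) (v : Fin c → k) :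
    h.augmentation (Fintype.linearCombination k ξ v) = 0 := by
  have hv : h.equiv (ExteriorAlgebra.ι k v) = Fintype.linearCombination k ξ v := by
    simp [equiv]
  have h2 : h.equiv.symm (Fintype.linearCombination k ξ v) = ExteriorAlgebra.ι k v := by
    rw [← hv, AlgEquiv.symm_apply_apply]
  change ExteriorAlgebra.algebraMapInv (h.equiv.symm (Fintype.linearCombination k ξ v)) = 0
  rw [h2]
  simp [ExteriorAlgebra.algebraMapInv]

lemma augmentation_proj (h : IsExteriorOn 𝒜 deg ξ) (a : A) :
    ∀ n : ℤ, n ≠ 0 → h.augmentation (DirectSum.decompose 𝒜 a n) = 0 := by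
  obtain ⟨x, rfl⟩ := h.equiv.surjective a
  induction x using ExteriorAlgebra.induction with
  | algebraMap r =>
    intro n hn
    rw [AlgEquiv.commutes, DirectSum.decompose_of_mem_ne 𝒜
      (SetLike.algebraMap_mem_graded 𝒜 r) hn.symm, map_zero]
  | ι v =>
    intro n hn
    have hv : h.equiv (ExteriorAlgebra.ι k v) = ∑ i, v i • ξ i := by
      simp [equiv, Fintype.linearCombination_apply]
    have hξ : ∀ i, h.augmentation (ξ i) = 0 := fun i => by
      have := h.augmentation_gen (Pi.single i 1)
      simpa using this
    rw [hv, DirectSum.decompose_sum, DFinsupp.finsetSum_apply, AddSubmonoidClass.coe_finsetSum,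
      map_sum]
    refine Finset.sum_eq_zero fun i _ => ?_
    rw [DirectSum.decompose_smul]
    change h.augmentation (v i • ((DirectSum.decompose 𝒜 (ξ i) n : 𝒜 n) : A)) = 0
    rw [map_smul]
    by_cases hi : deg i = n
    · subst hi
      rw [DirectSum.decompose_of_mem_same 𝒜 (h.mem i), hξ, smul_zero]
    · rw [DirectSum.decompose_of_mem_ne 𝒜 (h.mem i) hi, map_zero, smul_zero]
  | mul x y hx hy =>
    intro n hn
    classical
    rw [map_mul, DirectSum.decompose_mul, DirectSum.coe_mul_apply, map_sum]
    refine Finset.sum_eq_zero fun ij hij => ?_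
    have hij' : ij.1 + ij.2 = n := (Finset.mem_filter.mp hij).2
    rw [map_mul]
    by_cases h1 : ij.1 = 0
    · rw [hy _ (by omega), mul_zero]
    · rw [hx _ h1, zero_mul]
  | add x y hx hy =>
    intro n hn
    rw [map_add, DirectSum.decompose_add, DirectSum.add_apply, Submodule.coe_add, map_add,
      hx n hn, hy n hn, add_zero]

lemma augmentation_of_mem (h : IsExteriorOn 𝒜 deg ξ) {n : ℤ} (hn : n ≠ 0) {a : A}
    (ha : a ∈ 𝒜 n) : h.augmentation a = 0 := by
  have := h.augmentation_proj a n hn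
  rwa [DirectSum.decompose_of_mem_same 𝒜 ha] at this

/-- The field `k` as a DG module, concentrated in degree `0`, on which `A` acts through the
augmentation. -/
def residue (h : IsExteriorOn 𝒜 deg ξ) : DGModule 𝒜 :=
  letI : Module A k := Module.compHom k h.augmentation.toRingHom
  have hsmul : ∀ (a : A) (x : k), a • x = h.augmentation a * x := fun _ _ => rfl
  { carrier := k
    isScalarTower := ⟨fun r a x => by
      rw [hsmul, hsmul, map_smul, smul_eq_mul, smul_eq_mul, mul_assoc]⟩
    gr := fun n => if n = 0 then ⊤ else ⊥
    isInternal := by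
      rw [DirectSum.isInternal_submodule_iff_iSupIndep_and_iSup_eq_top]
      constructor
      · rw [iSupIndep_def]
        intro i
        by_cases hi : i = 0
        · subst hi
          have : (⨆ j : ℤ, ⨆ (_ : j ≠ 0), (if j = 0 then (⊤ : Submodule k k) else ⊥)) = ⊥ := by
            refine iSup₂_eq_bot.mpr fun j hj => if_neg hj
          rw [this]
          exact disjoint_bot_right
        · rw [if_neg hi]
          exact disjoint_bot_left
      · rw [eq_top_iff]
        exact le_iSup_of_le 0 (by simp)
    smul_mem := by
      intro i j a x ha hx
      by_cases hj : j = 0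
      · by_cases hi : i = 0
        · subst hi; subst hj; simp
        · rw [hsmul, h.augmentation_of_mem hi ha, zero_mul]
          exact Submodule.zero_mem _
      · rw [if_neg hj, Submodule.mem_bot] at hx
        rw [hx, hsmul, mul_zero]
        exact Submodule.zero_mem _
    d := 0
    d_mem := fun _ => Submodule.zero_mem _
    d_d := fun _ => rfl
    d_smul := fun _ _ => by
      rw [LinearMap.zero_apply, LinearMap.zero_apply, hsmul, mul_zero, smul_zero] }

/-- The complexity `cx U = cx(U, k)` of `U`. -/
def cx (h : IsExteriorOn 𝒜 deg ξ) (U : DGModule 𝒜) : ℕ∞ := cxPair U h.residue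

/-- The injective complexity `inj cx U = cx(k, U)` of `U`. -/
def injcx (h : IsExteriorOn 𝒜 deg ξ) (U : DGModule 𝒜) : ℕ∞ := cxPair h.residue U

end IsExteriorOn

end Basic

end

/-!
Let `S = k[X_1, …, X_c]`, where `X_i` has homological degree `-(deg ξ_i + 1)`, an even number. The
proof moves the theorem from the exterior algebra `Λ` to `S`, along the correspondence of Bernstein,
Gelfand and Gelfand, and then compares annihilators of homology modules over `S`.

*Reduction to finite-dimensional modules.* The sequences `rank Ext^n(U, V)` do not change when `U`
or `V` is replaced by a quasi-isomorphic DG module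
(`SemifreeResolution.nonempty_equiv`, `nonempty_ext_equiv_left`, `nonempty_ext_equiv_right`), and a
DG module with finite homology is linked by quasi-isomorphisms to a finite-dimensional one
(`exists_finite_model`): truncate it, and take the span of all words in the `ξ_i` and a contracting
homotopy applied to representatives of the homology.

*Passage to `S`.* A finite-dimensional `U` has the Koszul resolution `Λ ⊗ Γ ⊗ U`, with `Γ` the
divided power coalgebra dual to `S` (`koszulResolution`). A homomorphism from it to `V` is a family
of linear maps `U → V` indexed by the monomials of `S`, that is, a matrix with entries in `S`. So
`Ext(U, V)` is the homology of the complex of `S`-linear maps `S ⊗ U → S ⊗ V`, where `S ⊗ U` has the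
differential `d - ∑ X_i ξ_i` (`rank_ext`). This is a finite free `S`-module with an `S`-linear
differential.

*Growth and annihilators.* Let `I(U, V) ⊆ S` be the annihilator of this homology. Finitely many
homogeneous cycles embed `S / I(U, V)` into a finite sum of shifts of `Ext(U, V)`; conversely a
finite module annihilated by a power of `I(U, V)` is filtered by quotients of shifts of
`S / I(U, V)`. Hence `I(U, V)^l ≤ I(U', V')` for some `l` implies `cx(U', V') ≤ cx(U, V)`
(`shiftDominated_homology`, `ShiftDominated.seqComplexity_le`), and the theorem follows from
inclusions between annihilators.

* Some power of `I(U, V)` acts on the whole complex by null-homotopic maps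
  (`FreeModel.exists_homotopy`). The trace pairing carries such homotopies over to the complex for
  `(V, U)`, so a power of `I(U, V)` lies in `I(V, U)` (`FreeModel.exists_ann_pow_le`).
* If `s` annihilates `Ext(U, U)`, then `s = D h` for an endomorphism `h`, and composition with `h`
  shows that `s` annihilates `Ext(U, V)` (`FreeModel.ann_self_le_left`).
* A null-homotopy of multiplication by `s` on `S ⊗ U`, the complex for `(k, U)`, is itself an
  endomorphism of `S ⊗ U`, and its component of odd degree has the boundary `s`. So a power of
  `I(k, U)` lies in `I(U, U)` (`FreeModel.exists_ann_unit_pow_le`).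

Finally `Ext(k, k) = S`, and the number of monomials of weight `n` grows like `n^(c - 1)` along
the multiples of a fixed number (`cxPair_residue`).
-/

noncomputable section

/-! ### Components of DG modules and quasi-isomorphisms -/

namespace DGModule

/-- A linear map that sends cycles to cycles, reflects and preserves boundaries among cycles, and
hits every cycle up to boundaries, induces an isomorphism of the quotients. -/
lemma nonempty_quotient_equiv {k M M' : Type*} [Field k] [AddCommGroup M] [Module k M]
    [AddCommGroup M'] [Module k M'] {Z B : Submodule k M} {Z' B' : Submodule k M'} (T : M →ₗ[k] M')
    (h1 : ∀ z ∈ Z, T z ∈ Z') (h2 : ∀ z ∈ Z, T z ∈ B' ↔ z ∈ B)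
    (h3 : ∀ z' ∈ Z', ∃ z ∈ Z, T z - z' ∈ B') :
    Nonempty ((Z ⧸ B.submoduleOf Z) ≃ₗ[k] (Z' ⧸ B'.submoduleOf Z')) := by
  have hle : B.submoduleOf Z ≤ (B'.submoduleOf Z').comap (T.restrict h1) :=
    fun z hz => (h2 z z.2).mpr hz
  refine ⟨LinearEquiv.ofBijective (Submodule.mapQ _ _ (T.restrict h1) hle) ⟨?_, ?_⟩⟩
  · rw [← LinearMap.ker_eq_bot, LinearMap.ker_eq_bot']
    intro x hx
    obtain ⟨z, rfl⟩ := Submodule.Quotient.mk_surjective _ x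
    exact (Submodule.Quotient.mk_eq_zero _).mpr
      ((h2 z z.2).mp ((Submodule.Quotient.mk_eq_zero (B'.submoduleOf Z')).mp hx))
  · intro y
    obtain ⟨z', rfl⟩ := Submodule.Quotient.mk_surjective _ y
    obtain ⟨z, hz, h⟩ := h3 z' z'.2
    exact ⟨Submodule.Quotient.mk ⟨z, hz⟩, (Submodule.Quotient.eq _).mpr h⟩

section Basics

variable {k A : Type u} [Field k] [Ring A] [Algebra k A] {𝒜 : ℤ → Submodule k A}

/-- A DG module as the external direct sum of its components. -/
def grEquiv (U : DGModule 𝒜) : (⨁ n, U.gr n) ≃ₗ[k] U :=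
  LinearEquiv.ofBijective (DirectSum.coeLinearMap U.gr) U.isInternal

lemma grEquiv_apply (U : DGModule 𝒜) (y : ⨁ n, U.gr n) :
    U.grEquiv y = DirectSum.coeLinearMap U.gr y := rfl

/-- The projection of a DG module onto its component of degree `n`. -/
def proj (U : DGModule 𝒜) (n : ℤ) : U →ₗ[k] U :=
  (U.gr n).subtype ∘ₗ DirectSum.component k ℤ (fun i => U.gr i) n ∘ₗ U.grEquiv.symm.toLinearMap

variable (U : DGModule 𝒜)

lemma proj_mem (n : ℤ) (x : U) : U.proj n x ∈ U.gr n := Subtype.coe_prop _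

lemma proj_of_mem_aux {m : ℤ} {x : U} (hx : x ∈ U.gr m) (n : ℤ) :
    U.proj n x = DirectSum.component k ℤ (fun i => U.gr i) n
      (DirectSum.lof k ℤ (fun i => U.gr i) m ⟨x, hx⟩) := by
  have : U.grEquiv.symm x = DirectSum.lof k ℤ (fun i => U.gr i) m ⟨x, hx⟩ := by
    rw [LinearEquiv.symm_apply_eq, grEquiv_apply, DirectSum.coeLinearMap_lof]
  simp only [proj, LinearMap.comp_apply, LinearEquiv.coe_coe, this, Submodule.subtype_apply]

variable {U}

lemma proj_of_mem {n : ℤ} {x : U} (hx : x ∈ U.gr n) : U.proj n x = x := by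
  rw [proj_of_mem_aux U hx, DirectSum.component.lof_self]

lemma proj_of_mem_ne {m n : ℤ} {x : U} (hx : x ∈ U.gr m) (h : m ≠ n) : U.proj n x = 0 := by
  rw [proj_of_mem_aux U hx, DirectSum.component.of, dif_neg h]
  rfl

@[elab_as_elim]
lemma gr_induction {P : U → Prop} (x : U) (zero : P 0)
    (homogeneous : ∀ n, ∀ x ∈ U.gr n, P x) (add : ∀ x y, P x → P y → P (x + y)) : P x := by
  have hx : x ∈ (⨆ n, U.gr n) := by
    rw [U.isInternal.submodule_iSup_eq_top]; trivial
  exact Submodule.iSup_induction _ (motive := P) hx homogeneous zero add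

lemma ext_proj {x y : U} (h : ∀ n, U.proj n x = U.proj n y) : x = y := by
  apply U.grEquiv.symm.injective
  refine DirectSum.ext_component k fun n => Subtype.ext (h n)

lemma exists_finset_sum_proj (x : U) : ∃ s : Finset ℤ, x = ∑ n ∈ s, U.proj n x ∧
    ∀ n ∉ s, U.proj n x = 0 := by
  classical
  set y := U.grEquiv.symm x with hy
  have hc : ∀ n, U.proj n x = (y n : U) := fun n => rfl
  refine ⟨y.support, ?_, fun n hn => ?_⟩
  · have h1 : x = DirectSum.coeLinearMap U.gr y := (U.grEquiv.apply_symm_apply x).symm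
    rw [DirectSum.coeLinearMap_eq_dfinsuppSum, DFinsupp.sum] at h1
    refine h1.trans (Finset.sum_congr rfl fun n _ => (hc n).symm)
  · rw [hc, DFinsupp.notMem_support_iff.mp hn]; rfl

/-- A linear map of degree `e` commutes with the projections. -/
lemma proj_map {V : DGModule 𝒜} (f : U →ₗ[k] V) (e : ℤ)
    (hf : ∀ n, ∀ x ∈ U.gr n, f x ∈ V.gr (n + e)) (n : ℤ) (x : U) :
    V.proj (n + e) (f x) = f (U.proj n x) := by
  induction x using gr_induction with
  | zero => simp
  | homogeneous m x hx =>
    by_cases h : m = n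
    · subst h; rw [proj_of_mem hx, proj_of_mem (hf _ _ hx)]
    · rw [proj_of_mem_ne hx h, proj_of_mem_ne (hf _ _ hx) (by omega), map_zero]
  | add x y hx hy => simp only [map_add, hx, hy]

lemma proj_d (n : ℤ) (x : U) : U.proj n (U.d x) = U.d (U.proj (n + 1) x) := by
  have := proj_map U.d (-1) (fun n x hx => U.d_mem hx) (n + 1) x
  rwa [add_neg_cancel_right] at this

lemma Hom.proj_apply {V : DGModule 𝒜} (f : Hom U V) (n : ℤ) (x : U) :
    V.proj n (f.toFun x) = f.toFun (U.proj n x) := by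
  have := proj_map (f.toFun.restrictScalars k) 0 (fun n x hx => by
    rw [add_zero]; exact f.map_mem hx) n x
  rwa [add_zero] at this

/-- Quasi-isomorphisms can be recognized without reference to the grading. -/
lemma Hom.isQuasiIso_of {V : DGModule 𝒜} (f : Hom U V)
    (inj : ∀ z, U.d z = 0 → (∃ v, V.d v = f.toFun z) → ∃ u, U.d u = z)
    (surj : ∀ v, V.d v = 0 → ∃ z, U.d z = 0 ∧ ∃ y, V.d y = f.toFun z - v) : f.IsQuasiIso := by
  intro n
  constructor
  · rw [← LinearMap.ker_eq_bot, LinearMap.ker_eq_bot']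
    intro x hx
    obtain ⟨⟨z, hz, hdz⟩, rfl⟩ := Submodule.Quotient.mk_surjective _ x
    obtain ⟨v, -, hvz⟩ : ∃ v ∈ V.gr (n + 1), V.d v = f.toFun z :=
      (Submodule.Quotient.mk_eq_zero _).mp hx
    obtain ⟨u, hu⟩ := inj z hdz ⟨v, hvz⟩
    refine (Submodule.Quotient.mk_eq_zero _).mpr ⟨U.proj (n + 1) u, U.proj_mem _ _, ?_⟩
    rw [← proj_d, hu, proj_of_mem hz]
    rfl
  · intro y
    obtain ⟨⟨v, hv, hdv⟩, rfl⟩ := Submodule.Quotient.mk_surjective _ y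
    obtain ⟨z, hz, y, hy⟩ := surj v hdv
    refine ⟨Submodule.Quotient.mk ⟨U.proj n z, U.proj_mem _ _, ?_⟩, ?_⟩
    · have := proj_d (n - 1) z
      rw [hz, map_zero, sub_add_cancel] at this
      exact this.symm
    · refine (Submodule.Quotient.eq _).mpr ⟨V.proj (n + 1) y, V.proj_mem _ _, ?_⟩
      rw [← proj_d, hy, map_sub, proj_of_mem hv, f.proj_apply]
      rfl

lemma Hom.IsQuasiIso.exists_of_boundary {V : DGModule 𝒜} {f : Hom U V} (hf : f.IsQuasiIso)
    {n : ℤ} {z : U} (hz : z ∈ U.gr n) (hdz : U.d z = 0) {v : V} (hv : v ∈ V.gr (n + 1))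
    (hvz : V.d v = f.toFun z) : ∃ u ∈ U.gr (n + 1), U.d u = z := by
  have hinj := (hf n).1
  rw [← LinearMap.ker_eq_bot, LinearMap.ker_eq_bot'] at hinj
  have := hinj (Submodule.Quotient.mk ⟨z, hz, hdz⟩)
    ((Submodule.Quotient.mk_eq_zero _).mpr ⟨v, hv, hvz⟩)
  exact (Submodule.Quotient.mk_eq_zero _).mp this

lemma Hom.IsQuasiIso.exists_cycle {V : DGModule 𝒜} {f : Hom U V} (hf : f.IsQuasiIso)
    {n : ℤ} {v : V} (hv : v ∈ V.gr n) (hdv : V.d v = 0) :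
    ∃ z ∈ U.gr n, U.d z = 0 ∧ ∃ y ∈ V.gr (n + 1), V.d y = f.toFun z - v := by
  obtain ⟨x, hx⟩ := (hf n).2 (Submodule.Quotient.mk ⟨v, hv, hdv⟩)
  obtain ⟨⟨z, hz, hdz⟩, rfl⟩ := Submodule.Quotient.mk_surjective _ x
  exact ⟨z, hz, hdz, (Submodule.Quotient.eq _).mp hx⟩

/-- A relative form of quasi-isomorphism: the cone of `f` is acyclic. -/
lemma Hom.IsQuasiIso.exists_lift {V : DGModule 𝒜} {f : Hom U V} (hf : f.IsQuasiIso)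
    {n : ℤ} {u : U} (hu : u ∈ U.gr n) (hdu : U.d u = 0) {v : V} (hv : v ∈ V.gr (n + 1))
    (hvu : V.d v = f.toFun u) :
    ∃ w ∈ U.gr (n + 1), U.d w = u ∧ ∃ y ∈ V.gr (n + 1 + 1), V.d y = f.toFun w - v := by
  obtain ⟨w, hw, hdw⟩ := hf.exists_of_boundary hu hdu hv hvu
  obtain ⟨z, hz, hdz, y, hy, hdy⟩ := hf.exists_cycle (v := v - f.toFun w) (n := n + 1)
    ((V.gr _).sub_mem hv (f.map_mem hw)) (by rw [map_sub, ← f.map_d, hdw, hvu, sub_self])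
  refine ⟨w + z, (U.gr _).add_mem hw hz, by rw [map_add, hdw, hdz, add_zero], y, hy, ?_⟩
  rw [hdy, map_add]
  abel

/-- Composition of morphisms of DG modules. -/
def Hom.comp {V W : DGModule 𝒜} (g : Hom V W) (f : Hom U V) : Hom U W where
  toFun := g.toFun ∘ₗ f.toFun
  map_mem h := g.map_mem (f.map_mem h)
  map_d u := by simp only [LinearMap.comp_apply, f.map_d, g.map_d]

lemma Hom.IsQuasiIso.comp {V W : DGModule 𝒜} {g : Hom V W} {f : Hom U V} (hg : g.IsQuasiIso)
    (hf : f.IsQuasiIso) : (g.comp f).IsQuasiIso := by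
  intro n
  have : ((g.comp f).homologyMap n : U.homology n → W.homology n) =
      g.homologyMap n ∘ f.homologyMap n := by
    funext x
    obtain ⟨z, rfl⟩ := Submodule.Quotient.mk_surjective _ x
    rfl
  rw [this]
  exact (hg n).comp (hf n)

end Basics

/-! ### Homs out of semifree DG modules -/

section HomComplex

variable {k A : Type u} [Field k] [Ring A] [Algebra k A] {𝒜 : ℤ → Submodule k A}
  {F V : DGModule 𝒜}

lemma homD_mem {n : ℤ} {f : F →ₗ[k] V} (hf : f ∈ homDeg F V n) :
    homD F V n f ∈ homDeg F V (n + 1) := by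
  refine ⟨fun i x hx => ?_, fun i a ha x => ?_⟩
  · change V.d (f x) - n.negOnePow • f (F.d x) ∈ _
    refine (V.gr _).sub_mem ?_ ?_
    · have := V.d_mem (hf.1 i x hx)
      rwa [sub_sub] at this
    · have := hf.1 _ _ (F.d_mem hx)
      rw [Units.smul_def]
      refine zsmul_mem ?_ _
      convert this using 2
      ring
  · change V.d (f (a • x)) - n.negOnePow • f (F.d (a • x)) =
      _ • (a • (V.d (f x) - n.negOnePow • f (F.d x)))
    rw [F.d_smul ha, hf.2 i a ha, add_mul, one_mul, Int.negOnePow_add]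
    simp only [Units.smul_def, map_zsmul, hf.2 i a ha, V.d_smul ha, smul_sub,
      mul_smul]
    simp only [smul_comm a]
    rw [smul_comm (n.negOnePow : ℤ) (i.negOnePow : ℤ),
      smul_comm (n.negOnePow : ℤ) ((n * i).negOnePow : ℤ),
      smul_comm (i.negOnePow : ℤ) ((n * i).negOnePow : ℤ)]

lemma homD_apply (n : ℤ) (f : F →ₗ[k] V) (x : F) :
    homD F V n f x = V.d (f x) - n.negOnePow • f (F.d x) := rfl

end HomComplex

section Semifree

variable {k A : Type u} [Field k] [Ring A] [Algebra k A] {𝒜 : ℤ → Submodule k A}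
  [GradedAlgebra 𝒜]

/-- The linear map `a ↦ (-1)^{n|a|} a` of a graded algebra. -/
def twist (𝒜 : ℤ → Submodule k A) [GradedAlgebra 𝒜] (n : ℤ) : A →ₗ[k] A :=
  if Even n then LinearMap.id else signMap 𝒜

lemma twist_of_mem {n i : ℤ} {a : A} (ha : a ∈ 𝒜 i) :
    twist 𝒜 n a = (n * i).negOnePow • a := by
  unfold twist
  split_ifs with h
  · rw [Int.negOnePow_even _ (h.mul_right i), one_smul, LinearMap.id_apply]
  · rw [signMap_of_mem ha]
    congr 1
    rw [Int.not_even_iff_odd] at h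
    rcases Int.even_or_odd i with hi | hi
    · rw [Int.negOnePow_even _ hi, Int.negOnePow_even _ (hi.mul_left n)]
    · rw [Int.negOnePow_odd _ hi, Int.negOnePow_odd _ (h.mul hi)]

lemma twist_one (n : ℤ) : twist 𝒜 n 1 = 1 := by
  unfold twist
  split_ifs
  · rfl
  · exact signMap_one

variable {F V : DGModule 𝒜}

lemma homDeg_smul {n : ℤ} {f : F →ₗ[k] V} (hf : f ∈ homDeg F V n) (a : A) (x : F) :
    f (a • x) = twist 𝒜 n a • f x := by
  induction a using DirectSum.Decomposition.inductionOn 𝒜 with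
  | zero => simp
  | @homogeneous j m => rw [hf.2 j m m.2, twist_of_mem m.2, smul_assoc]
  | add a b ha hb => simp only [add_smul, map_add, ha, hb]

lemma homDeg_eq_zero_of_mem_span {n : ℤ} {f : F →ₗ[k] V} (hf : f ∈ homDeg F V n) {s : Set F}
    (hs : ∀ x ∈ s, f x = 0) {x : F} (hx : x ∈ Submodule.span A s) : f x = 0 := by
  induction hx using Submodule.span_induction with
  | mem x hx => exact hs x hx
  | zero => exact map_zero f
  | add x y _ _ hx hy => rw [map_add, hx, hy, add_zero]
  | smul a x _ hx => rw [homDeg_smul hf, hx, smul_zero]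

/-- Elements of `Hom_A(F, V)^n` are determined by their values on a basis of `F`. -/
lemma homDeg_ext {n : ℤ} {f g : F →ₗ[k] V} (hf : f ∈ homDeg F V n) (hg : g ∈ homDeg F V n)
    {ι : Type*} (e : Module.Basis ι A F) (h : ∀ i, f (e i) = g (e i)) : f = g := by
  ext x
  rw [← sub_eq_zero, ← LinearMap.sub_apply]
  refine homDeg_eq_zero_of_mem_span ((homDeg F V n).sub_mem hf hg) (s := Set.range e) ?_
    (by rw [e.span_eq]; trivial)
  rintro _ ⟨i, rfl⟩
  rw [LinearMap.sub_apply, h, sub_self]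

lemma exists_homDeg (n : ℤ) {ι : Type*} (e : Module.Basis ι A F) (deg : ι → ℤ)
    (he : ∀ i, e i ∈ F.gr (deg i)) (y : ι → V) (hy : ∀ i, y i ∈ V.gr (deg i - n)) :
    ∃ f ∈ homDeg F V n, ∀ i, f (e i) = y i := by
  set f : F →ₗ[k] V := (Finsupp.lsum k (fun i =>
    ((LinearMap.toSpanSingleton A V (y i)).restrictScalars k) ∘ₗ twist 𝒜 n)) ∘ₗ
      (e.repr.toLinearMap.restrictScalars k) with hf
  have key : ∀ a i, f (a • e i) = twist 𝒜 n a • y i := by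
    intro a i
    simp [hf]
  have ind : ∀ {P : F → Prop}, P 0 → (∀ x y, P x → P y → P (x + y)) →
      (∀ j, ∀ a ∈ 𝒜 j, ∀ i, P (a • e i)) → ∀ x, P x := by
    intro P h0 hadd hsm x
    have hx : x ∈ Submodule.span A (Set.range e) := by rw [e.span_eq]; trivial
    refine Submodule.span_induction (p := fun x _ => ∀ a : A, P (a • x)) ?_ (fun a => ?_)
      (fun x y _ _ hx hy a => ?_) (fun b x _ hx a => ?_) hx 1 |> fun h => by rwa [one_smul] at h
    · rintro _ ⟨i, rfl⟩ a
      induction a using DirectSum.Decomposition.inductionOn 𝒜 with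
      | zero => rwa [zero_smul]
      | @homogeneous j m => exact hsm j m m.2 i
      | add a b ha hb => rw [add_smul]; exact hadd _ _ ha hb
    · rwa [smul_zero]
    · rw [smul_add]; exact hadd _ _ (hx a) (hy a)
    · rw [smul_smul]; exact hx _
  have hproj : ∀ x m, V.proj (m - n) (f x) = f (F.proj m x) := by
    intro x
    refine ind (P := fun x => ∀ m, V.proj (m - n) (f x) = f (F.proj m x)) (by simp)
      (fun x y hx hy m => by simp only [map_add, hx, hy]) ?_ x
    intro j a ha i m
    have h1 : a • e i ∈ F.gr (j + deg i) := F.smul_mem ha (he i)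
    have h2 : f (a • e i) ∈ V.gr (j + deg i - n) := by
      rw [key, twist_of_mem ha, Units.smul_def, smul_assoc, add_sub_assoc]
      exact zsmul_mem (V.smul_mem ha (hy i)) _
    by_cases hm : j + deg i = m
    · subst hm; rw [proj_of_mem h1, proj_of_mem h2]
    · rw [proj_of_mem_ne h1 hm, proj_of_mem_ne h2 (by omega), map_zero]
  refine ⟨f, ⟨fun m x hx => ?_, fun j a ha x => ?_⟩, fun i => ?_⟩
  · rw [← proj_of_mem hx, ← hproj]; exact V.proj_mem _ _
  · refine ind (P := fun x => f (a • x) = (n * j).negOnePow • (a • f x)) (by simp)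
      (fun x y hx hy => by simp only [smul_add, map_add, hx, hy]) ?_ x
    intro l b hb i
    rw [smul_smul, key, key, twist_of_mem (SetLike.mul_mem_graded ha hb), twist_of_mem hb, mul_add,
      Int.negOnePow_add]
    simp only [Units.smul_def, smul_assoc, mul_smul]
    rw [smul_comm a ((n * l).negOnePow : ℤ)]
  · have := key 1 i
    rwa [one_smul, twist_one, one_smul] at this

end Semifree

end DGModule

namespace DGModule

section HomFunctor

variable {k A : Type u} [Field k] [Ring A] [Algebra k A] {𝒜 : ℤ → Submodule k A}
  {F V W : DGModule 𝒜}

/-- Post-composition with a morphism of DG modules. -/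
def Hom.post (g : Hom V W) : (F →ₗ[k] V) →ₗ[k] (F →ₗ[k] W) where
  toFun f := g.toFun.restrictScalars k ∘ₗ f
  map_add' f f' := by ext x; simp
  map_smul' r f := by
    ext x
    exact (g.toFun.restrictScalars k).map_smul r (f x)

lemma Hom.post_apply (g : Hom V W) (f : F →ₗ[k] V) (x : F) : g.post f x = g.toFun (f x) := rfl

lemma Hom.post_mem (g : Hom V W) {n : ℤ} {f : F →ₗ[k] V} (hf : f ∈ homDeg F V n) :
    g.post f ∈ homDeg F W n := by
  refine ⟨fun i x hx => g.map_mem (hf.1 i x hx), fun i a ha x => ?_⟩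
  rw [g.post_apply, g.post_apply, hf.2 i a ha, Units.smul_def, map_zsmul, map_smul]
  rfl

lemma Hom.homD_post (g : Hom V W) (n : ℤ) (f : F →ₗ[k] V) :
    homD F W n (g.post f) = g.post (homD F V n f) := by
  ext x
  simp only [homD_apply, g.post_apply, map_sub, g.map_d, Units.smul_def, map_zsmul]

/-- Pre-composition with a morphism of DG modules. -/
def Hom.pre (g : Hom V W) : (W →ₗ[k] F) →ₗ[k] (V →ₗ[k] F) :=
  LinearMap.lcomp k F (g.toFun.restrictScalars k)

lemma Hom.pre_apply (g : Hom V W) (f : W →ₗ[k] F) (x : V) : g.pre f x = f (g.toFun x) := rfl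

lemma Hom.pre_mem (g : Hom V W) {n : ℤ} {f : W →ₗ[k] F} (hf : f ∈ homDeg W F n) :
    g.pre f ∈ homDeg V F n := by
  refine ⟨fun i x hx => hf.1 i _ (g.map_mem hx), fun i a ha x => ?_⟩
  rw [g.pre_apply, g.pre_apply, map_smul, hf.2 i a ha]

lemma Hom.homD_pre (g : Hom V W) (n : ℤ) (f : W →ₗ[k] F) :
    homD V F n (g.pre f) = g.pre (homD W F n f) := by
  ext x
  simp only [homD_apply, g.pre_apply, g.map_d]

lemma Hom.mem_homCocycles (f : Hom F V) : f.toFun.restrictScalars k ∈ homCocycles F V 0 := by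
  refine ⟨⟨fun i x hx => ?_, fun i a _ x => ?_⟩, ?_⟩
  · rw [sub_zero]; exact f.map_mem hx
  · rw [zero_mul, Int.negOnePow_zero, one_smul]; exact f.toFun.map_smul a x
  · change homD F V 0 _ = 0
    ext x
    rw [homD_apply, Int.negOnePow_zero, one_smul]
    change V.d (f.toFun x) - f.toFun (F.d x) = 0
    rw [f.map_d, sub_self]

/-- Homotopic morphisms induce the same maps on cohomology. -/
lemma pre_sub_pre_mem {f g : Hom F V} {s : F →ₗ[k] V} (hs : s ∈ homDeg F V (-1))
    (h : homD F V (-1) s = f.toFun.restrictScalars k - g.toFun.restrictScalars k) {n : ℤ}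
    {φ : V →ₗ[k] W} (hφ : φ ∈ homCocycles V W n) :
    f.pre φ - g.pre φ ∈ homCoboundaries F W n := by
  have hφ2 : homD V W n φ = 0 := hφ.2
  refine ⟨n.negOnePow • (φ ∘ₗ s), ?_, ?_⟩
  · have hmem : φ ∘ₗ s ∈ homDeg F W (n - 1) := by
      refine ⟨fun i x hx => ?_, fun i a ha x => ?_⟩
      · have := hφ.1.1 _ _ (hs.1 i x hx)
        rw [LinearMap.comp_apply]
        convert this using 2
        ring
      · rw [LinearMap.comp_apply, hs.2 i a ha, Units.smul_def, map_zsmul, hφ.1.2 i a ha,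
          ← Units.smul_def, smul_smul, ← Int.negOnePow_add]
        congr 2
        ring
    rw [Units.smul_def]
    exact zsmul_mem hmem _
  · ext x
    have h1 := LinearMap.congr_fun h x
    have h2 := LinearMap.congr_fun hφ2 (s x)
    rw [homD_apply, Int.negOnePow_neg, Int.negOnePow_one] at h1
    rw [homD_apply, LinearMap.zero_apply, sub_eq_zero] at h2
    have h3 : V.d (s x) + s (F.d x) = f.toFun x - g.toFun x := by
      rw [Units.neg_smul, one_smul, sub_neg_eq_add] at h1
      exact h1
    rw [LinearMap.sub_apply, f.pre_apply, g.pre_apply, ← map_sub, ← h3, homD_apply,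
      Int.negOnePow_sub, Int.negOnePow_one, map_add]
    simp only [LinearMap.smul_apply, LinearMap.comp_apply, Units.smul_def, map_zsmul, h2, mul_neg,
      mul_one, Units.val_neg, neg_smul, sub_neg_eq_add]
    rw [smul_smul, ← Units.val_mul, ← Int.negOnePow_add, smul_smul, ← Units.val_mul,
      ← Int.negOnePow_add, Int.negOnePow_even _ (Even.add_self n)]
    simp

end HomFunctor

section Lifting

variable {k A : Type u} [Field k] [Ring A] [Algebra k A] {𝒜 : ℤ → Submodule k A}
  [GradedAlgebra 𝒜] {F V W : DGModule 𝒜}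

/-- The lifting property of semifree DG modules: if `g : V → W` is a quasi-isomorphism, then the
cone of `Hom_A(F, V) → Hom_A(F, W)` is acyclic.  The lift is built up along the levels of a
semibasis. -/
lemma IsSemifree.exists_lift (hF : F.IsSemifree) {g : Hom V W} (hg : g.IsQuasiIso) {n : ℤ}
    {φ' : F →ₗ[k] W} (hφ' : φ' ∈ homDeg F W n) {θ : F →ₗ[k] V}
    (hθ : θ ∈ homCocycles F V (n + 1)) (h : g.post θ = homD F W n φ') :
    ∃ φ ∈ homDeg F V n, homD F V n φ = θ ∧
      ∃ ψ ∈ homDeg F W (n - 1), homD F W (n - 1) ψ = g.post φ - φ' := by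
  classical
  obtain ⟨ι, e, deg, lvl, he⟩ := hF
  let C : (F →ₗ[k] V) × (F →ₗ[k] W) → F → Prop := fun p x =>
    homD F V n p.1 x = θ x ∧ homD F W (n - 1) p.2 x = g.post p.1 x - φ' x
  let D : (F →ₗ[k] V) × (F →ₗ[k] W) → Prop := fun p =>
    p.1 ∈ homDeg F V n ∧ p.2 ∈ homDeg F W (n - 1)
  have hw : ∀ ψ ∈ homDeg F W (n - 1), homD F W (n - 1) ψ ∈ homDeg F W n := fun ψ hψ => by
    have := homD_mem hψ
    rwa [sub_add_cancel] at this
  -- the conditions propagate from basis elements to their span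
  have hspan : ∀ p, D p → ∀ r : ℕ, (∀ i, lvl i < r → C p (e i)) →
      ∀ x ∈ Submodule.span A (e '' {j | lvl j < r}), C p x := by
    intro p hp r hr x hx
    constructor
    · rw [← sub_eq_zero, ← LinearMap.sub_apply]
      refine homDeg_eq_zero_of_mem_span ((homDeg F V (n + 1)).sub_mem (homD_mem hp.1) hθ.1) ?_ hx
      rintro _ ⟨j, hj, rfl⟩
      rw [LinearMap.sub_apply, (hr j hj).1, sub_self]
    · rw [← sub_eq_zero, ← LinearMap.sub_apply, ← LinearMap.sub_apply]
      refine homDeg_eq_zero_of_mem_span ((homDeg F W n).sub_mem (hw _ hp.2)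
        ((homDeg F W n).sub_mem (g.post_mem hp.1) hφ')) ?_ hx
      rintro _ ⟨j, hj, rfl⟩
      rw [LinearMap.sub_apply, (hr j hj).2, LinearMap.sub_apply, sub_self]
  -- values at a single basis element
  have hval : ∀ p, D p → ∀ i, C p (F.d (e i)) → ∃ v ∈ V.gr (deg i - n),
      ∃ y ∈ W.gr (deg i - (n - 1)), V.d v = θ (e i) + n.negOnePow • p.1 (F.d (e i)) ∧
        W.d y = g.toFun v - (φ' (e i) + n.negOnePow • p.2 (F.d (e i))) := by
    intro p hp i hi
    have hdi := F.d_mem (he i).1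
    have hθ0 := LinearMap.congr_fun (show homD F V (n + 1) θ = 0 from hθ.2) (e i)
    rw [homD_apply, LinearMap.zero_apply, sub_eq_zero] at hθ0
    have h1 := hi.1
    have h2 := hi.2
    rw [homD_apply, F.d_d, map_zero, smul_zero, sub_zero] at h1 h2
    have hh := LinearMap.congr_fun h (e i)
    rw [homD_apply, g.post_apply] at hh
    have e1 : deg i - n - 1 + 1 = deg i - n := by ring
    have e2 : deg i - n + 1 = deg i - (n - 1) := by ring
    have hu : θ (e i) + n.negOnePow • p.1 (F.d (e i)) ∈ V.gr (deg i - n - 1) := by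
      refine (V.gr _).add_mem ?_ ?_
      · have := hθ.1.1 _ _ (he i).1
        rwa [← sub_sub] at this
      · rw [Units.smul_def]
        refine zsmul_mem ?_ _
        have := hp.1.1 _ _ hdi
        rwa [sub_right_comm] at this
    have hdu : V.d (θ (e i) + n.negOnePow • p.1 (F.d (e i))) = 0 := by
      rw [map_add, hθ0, Units.smul_def, Units.smul_def, map_zsmul, h1, Int.negOnePow_succ,
        Units.val_neg, neg_smul, neg_add_cancel]
    have hv : φ' (e i) + n.negOnePow • p.2 (F.d (e i)) ∈ W.gr (deg i - n - 1 + 1) := by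
      rw [e1]
      refine (W.gr _).add_mem (hφ'.1 _ _ (he i).1) ?_
      rw [Units.smul_def]
      refine zsmul_mem ?_ _
      have := hp.2.1 _ _ hdi
      convert this using 2
      ring
    have hvu : W.d (φ' (e i) + n.negOnePow • p.2 (F.d (e i))) =
        g.toFun (θ (e i) + n.negOnePow • p.1 (F.d (e i))) := by
      simp only [map_add, hh, Units.smul_def, map_zsmul, h2, g.post_apply, smul_sub]
      abel
    obtain ⟨v, hv, hdv, y, hy, hdy⟩ := hg.exists_lift hu hdu hv hvu
    rw [e1] at hv hy
    rw [e2] at hy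
    exact ⟨v, hv, y, hy, hdv, hdy⟩
  -- one step of the construction
  have hstep : ∀ (r : ℕ) (p : {p // D p ∧ ∀ i, lvl i < r → C p (e i)}),
      ∃ q : {p // D p ∧ ∀ i, lvl i < r + 1 → C p (e i)},
        ∀ i, lvl i < r → q.1.1 (e i) = p.1.1 (e i) ∧ q.1.2 (e i) = p.1.2 (e i) := by
    rintro r ⟨p, hp, hr⟩
    have hx : ∀ i, ∃ z : V × W, z.1 ∈ V.gr (deg i - n) ∧ z.2 ∈ W.gr (deg i - (n - 1)) ∧
        (lvl i < r → z.1 = p.1 (e i) ∧ z.2 = p.2 (e i)) ∧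
        (lvl i < r + 1 → V.d z.1 = θ (e i) + n.negOnePow • p.1 (F.d (e i)) ∧
          W.d z.2 = g.toFun z.1 - (φ' (e i) + n.negOnePow • p.2 (F.d (e i)))) := by
      intro i
      by_cases hi : lvl i < r
      · refine ⟨(p.1 (e i), p.2 (e i)), hp.1.1 _ _ (he i).1, hp.2.1 _ _ (he i).1,
          fun _ => ⟨rfl, rfl⟩, fun _ => ?_⟩
        obtain ⟨h1, h2⟩ := hr i hi
        rw [homD_apply] at h1 h2
        rw [sub_eq_iff_eq_add] at h1 h2
        refine ⟨h1, h2.trans ?_⟩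
        rw [Int.negOnePow_sub, Int.negOnePow_one, g.post_apply]
        simp only [Units.smul_def, mul_neg, mul_one, Units.val_neg, neg_smul]
        abel
      · by_cases hi' : lvl i < r + 1
        · obtain ⟨v, hv, y, hy, h1, h2⟩ := hval p hp i (hspan p hp r hr _ (by
            have : lvl i = r := by omega
            rw [← this]; exact (he i).2))
          exact ⟨(v, y), hv, hy, fun hh => absurd hh hi, fun _ => ⟨h1, h2⟩⟩
        · exact ⟨(0, 0), zero_mem _, zero_mem _, fun hh => absurd hh hi, fun hh => absurd hh hi'⟩
    choose z hz1 hz2 hz3 hz4 using hx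
    obtain ⟨f1, hf1, hfe1⟩ := exists_homDeg n e deg (fun i => (he i).1) (fun i => (z i).1) hz1
    obtain ⟨f2, hf2, hfe2⟩ := exists_homDeg (n - 1) e deg (fun i => (he i).1) (fun i => (z i).2) hz2
    have hagree1 : ∀ x ∈ Submodule.span A (e '' {j | lvl j < r}), f1 x = p.1 x := by
      intro x hx
      rw [← sub_eq_zero, ← LinearMap.sub_apply]
      refine homDeg_eq_zero_of_mem_span ((homDeg F V n).sub_mem hf1 hp.1) ?_ hx
      rintro _ ⟨j, hj, rfl⟩
      rw [LinearMap.sub_apply, hfe1, (hz3 j hj).1, sub_self]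
    have hagree2 : ∀ x ∈ Submodule.span A (e '' {j | lvl j < r}), f2 x = p.2 x := by
      intro x hx
      rw [← sub_eq_zero, ← LinearMap.sub_apply]
      refine homDeg_eq_zero_of_mem_span ((homDeg F W (n - 1)).sub_mem hf2 hp.2) ?_ hx
      rintro _ ⟨j, hj, rfl⟩
      rw [LinearMap.sub_apply, hfe2, (hz3 j hj).2, sub_self]
    refine ⟨⟨(f1, f2), ⟨hf1, hf2⟩, fun i hi => ?_⟩, fun i hi => ?_⟩
    · have hmem : F.d (e i) ∈ Submodule.span A (e '' {j | lvl j < r}) :=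
        Submodule.span_mono (Set.image_mono fun j hj =>
          lt_of_lt_of_le hj (Nat.lt_succ_iff.mp hi)) (he i).2
      constructor
      · rw [homD_apply, hfe1, hagree1 _ hmem, (hz4 i hi).1, add_sub_cancel_right]
      · rw [homD_apply, hfe2, hagree2 _ hmem, (hz4 i hi).2, Int.negOnePow_sub, Int.negOnePow_one,
          g.post_apply, hfe1]
        simp only [Units.smul_def, mul_neg, mul_one, Units.val_neg, neg_smul]
        abel
    · rw [← (hz3 i hi).1, ← (hz3 i hi).2]
      exact ⟨hfe1 i, hfe2 i⟩
  choose next hnext using hstep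
  let P : ∀ r : ℕ, {p // D p ∧ ∀ i, lvl i < r → C p (e i)} := fun r =>
    Nat.rec ⟨(0, 0), ⟨zero_mem _, zero_mem _⟩, fun i hi => absurd hi (Nat.not_lt_zero _)⟩ next r
  have hP : ∀ r i, lvl i < r → (P r).1.1 (e i) = (P (lvl i + 1)).1.1 (e i) ∧
      (P r).1.2 (e i) = (P (lvl i + 1)).1.2 (e i) := by
    intro r i hi
    induction r with
    | zero => omega
    | succ r ih =>
      by_cases hr : lvl i < r
      · obtain ⟨h1, h2⟩ := hnext r (P r) i hr
        exact ⟨h1.trans (ih hr).1, h2.trans (ih hr).2⟩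
      · have : lvl i = r := by omega
        rw [this]; exact ⟨rfl, rfl⟩
  obtain ⟨φ, hφ, hφe⟩ := exists_homDeg n e deg (fun i => (he i).1)
    (fun i => (P (lvl i + 1)).1.1 (e i)) (fun i => (P (lvl i + 1)).2.1.1.1 _ _ (he i).1)
  obtain ⟨ψ, hψ, hψe⟩ := exists_homDeg (n - 1) e deg (fun i => (he i).1)
    (fun i => (P (lvl i + 1)).1.2 (e i)) (fun i => (P (lvl i + 1)).2.1.2.1 _ _ (he i).1)
  have h1 : ∀ r, ∀ x ∈ Submodule.span A (e '' {j | lvl j < r}), φ x = (P r).1.1 x := by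
    intro r x hx
    rw [← sub_eq_zero, ← LinearMap.sub_apply]
    refine homDeg_eq_zero_of_mem_span ((homDeg F V n).sub_mem hφ (P r).2.1.1) ?_ hx
    rintro _ ⟨j, hj, rfl⟩
    rw [LinearMap.sub_apply, hφe, (hP r j hj).1, sub_self]
  have h2 : ∀ r, ∀ x ∈ Submodule.span A (e '' {j | lvl j < r}), ψ x = (P r).1.2 x := by
    intro r x hx
    rw [← sub_eq_zero, ← LinearMap.sub_apply]
    refine homDeg_eq_zero_of_mem_span ((homDeg F W (n - 1)).sub_mem hψ (P r).2.1.2) ?_ hx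
    rintro _ ⟨j, hj, rfl⟩
    rw [LinearMap.sub_apply, hψe, (hP r j hj).2, sub_self]
  have hmem : ∀ i, F.d (e i) ∈ Submodule.span A (e '' {j | lvl j < lvl i + 1}) := fun i =>
    Submodule.span_mono (Set.image_mono fun j hj => Nat.lt_succ_of_lt hj) (he i).2
  refine ⟨φ, hφ, homDeg_ext (homD_mem hφ) hθ.1 e fun i => ?_, ψ, hψ,
    homDeg_ext (hw _ hψ) ((homDeg F W n).sub_mem (g.post_mem hφ) hφ') e fun i => ?_⟩
  · rw [homD_apply, hφe, h1 _ _ (hmem i), ← homD_apply]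
    exact ((P (lvl i + 1)).2.2 i (Nat.lt_succ_self _)).1
  · rw [homD_apply, hψe, h2 _ _ (hmem i), ← homD_apply, LinearMap.sub_apply, g.post_apply, hφe,
      ← g.post_apply]
    exact ((P (lvl i + 1)).2.2 i (Nat.lt_succ_self _)).2

/-- `Hom_A(F, -)` preserves quasi-isomorphisms if `F` is semifree. -/
lemma IsSemifree.nonempty_equiv_post (hF : F.IsSemifree) {g : Hom V W} (hg : g.IsQuasiIso)
    (n : ℤ) : Nonempty (homCohomology F V n ≃ₗ[k] homCohomology F W n) := by
  have hcoc : ∀ {n : ℤ} {z : F →ₗ[k] V}, z ∈ homCocycles F V n → g.post z ∈ homCocycles F W n := by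
    intro n z hz
    refine ⟨g.post_mem hz.1, ?_⟩
    have hz2 : homD F V n z = 0 := hz.2
    change homD F W n (g.post z) = 0
    rw [g.homD_post, hz2, map_zero]
  refine nonempty_quotient_equiv g.post (fun z hz => hcoc hz) (fun z hz => ⟨?_, ?_⟩) ?_
  · rintro ⟨φ', hφ', h⟩
    obtain ⟨φ, hφ, h1, -⟩ := hF.exists_lift hg (n := n - 1) (φ' := φ') hφ' (θ := z)
      (by rwa [sub_add_cancel]) h.symm
    exact ⟨φ, hφ, h1⟩
  · rintro ⟨φ, hφ, rfl⟩
    exact ⟨g.post φ, g.post_mem hφ, g.homD_post _ _⟩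
  · intro z' hz'
    have hz2 : homD F W n z' = 0 := hz'.2
    obtain ⟨φ, hφ, h1, ψ, hψ, h2⟩ := hF.exists_lift hg (n := n) (φ' := z') hz'.1 (θ := 0)
      (zero_mem _) (by rw [map_zero, hz2])
    exact ⟨φ, ⟨hφ, h1⟩, ψ, hψ, h2⟩

/-- A cocycle of degree `0` is a morphism. -/
def homOfCocycle {f : F →ₗ[k] V} (hf : f ∈ homCocycles F V 0) : Hom F V where
  toFun :=
    { toFun := f
      map_add' := f.map_add
      map_smul' := fun a x => by
        rw [homDeg_smul hf.1, twist, if_pos Even.zero]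
        rfl }
  map_mem {n u} hu := by
    have := hf.1.1 n u hu
    rwa [sub_zero] at this
  map_d u := by
    have h := LinearMap.congr_fun (show homD F V 0 f = 0 from hf.2) u
    rw [homD_apply, Int.negOnePow_zero, one_smul, LinearMap.zero_apply, sub_eq_zero] at h
    exact h.symm

/-- The comparison of two semifree resolutions. -/
lemma SemifreeResolution.exists_comparison {U : DGModule 𝒜} (R R' : SemifreeResolution U) :
    ∃ (f : Hom R.F R'.F) (s : R.F →ₗ[k] U), s ∈ homDeg R.F U (-1) ∧
      homD R.F U (-1) s = R'.π.post (f.toFun.restrictScalars k) - R.π.toFun.restrictScalars k := by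
  have h0 := R.π.mem_homCocycles
  obtain ⟨φ, hφ, h1, ψ, hψ, h2⟩ := R.isSemifree.exists_lift R'.isQuasiIso (n := 0)
    h0.1 (θ := 0) (zero_mem _) (by
      rw [map_zero]; exact (show homD R.F U 0 _ = 0 from h0.2).symm)
  exact ⟨homOfCocycle ⟨hφ, h1⟩, ψ, hψ, h2⟩

lemma SemifreeResolution.exists_homotopy {U : DGModule 𝒜} (R R' : SemifreeResolution U)
    {f : Hom R.F R'.F} {s : R.F →ₗ[k] U} (hs : s ∈ homDeg R.F U (-1))
    (h : homD R.F U (-1) s =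
      R'.π.post (f.toFun.restrictScalars k) - R.π.toFun.restrictScalars k)
    {g : Hom R'.F R.F} {t : R'.F →ₗ[k] U} (ht : t ∈ homDeg R'.F U (-1))
    (h' : homD R'.F U (-1) t =
      R.π.post (g.toFun.restrictScalars k) - R'.π.toFun.restrictScalars k) :
    ∃ r ∈ homDeg R.F R.F (-1), homD R.F R.F (-1) r =
      (g.comp f).toFun.restrictScalars k - (LinearMap.id : R.F →ₗ[k] R.F) := by
  have hid : (LinearMap.id : R.F →ₗ[k] R.F) ∈ homCocycles R.F R.F 0 :=
    Hom.mem_homCocycles (⟨LinearMap.id, fun h => h, fun _ => rfl⟩ : Hom R.F R.F)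
  obtain ⟨φ, hφ, h1, -⟩ := R.isSemifree.exists_lift R.isQuasiIso (n := -1)
    (φ' := f.pre t + s) ((homDeg _ _ _).add_mem (f.pre_mem ht) hs)
    (θ := (g.comp f).toFun.restrictScalars k - LinearMap.id)
    ((homCocycles R.F R.F 0).sub_mem (g.comp f).mem_homCocycles hid) (by
      rw [map_add, f.homD_pre, h', h]
      ext x
      simp only [LinearMap.add_apply, Hom.pre_apply, LinearMap.sub_apply, Hom.post_apply, map_sub,
        LinearMap.restrictScalars_apply, LinearMap.id_apply]
      change R.π.toFun (g.toFun (f.toFun x)) - _ = _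
      abel)
  exact ⟨φ, hφ, h1⟩

/-- Ext does not depend on the choice of a semifree resolution. -/
lemma SemifreeResolution.nonempty_equiv {U : DGModule 𝒜} (R R' : SemifreeResolution U)
    (V : DGModule 𝒜) (n : ℤ) :
    Nonempty (homCohomology R.F V n ≃ₗ[k] homCohomology R'.F V n) := by
  obtain ⟨f, s, hs, h⟩ := R.exists_comparison R'
  obtain ⟨g, t, ht, h'⟩ := R'.exists_comparison R
  obtain ⟨r, hr, hgf⟩ := R.exists_homotopy R' hs h ht h'
  obtain ⟨r', hr', hfg⟩ := R'.exists_homotopy R ht h' hs h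
  have hcoc : ∀ {F G : DGModule 𝒜} (g : Hom F G) {z}, z ∈ homCocycles G V n →
      g.pre z ∈ homCocycles F V n := by
    intro F G g z hz
    refine ⟨g.pre_mem hz.1, ?_⟩
    have hz2 : homD G V n z = 0 := hz.2
    change homD F V n (g.pre z) = 0
    rw [g.homD_pre, hz2, map_zero]
  have hcob : ∀ {F G : DGModule 𝒜} (g : Hom F G) {z}, z ∈ homCoboundaries G V n →
      g.pre z ∈ homCoboundaries F V n := by
    rintro F G g _ ⟨φ, hφ, rfl⟩
    exact ⟨g.pre φ, g.pre_mem hφ, g.homD_pre _ _⟩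
  have h1 : ∀ z ∈ homCocycles R.F V n, f.pre (g.pre z) - z ∈ homCoboundaries R.F V n :=
    fun z hz => pre_sub_pre_mem (f := g.comp f)
      (g := ⟨LinearMap.id, fun h => h, fun _ => rfl⟩) hr hgf hz
  have h2 : ∀ z ∈ homCocycles R'.F V n, g.pre (f.pre z) - z ∈ homCoboundaries R'.F V n :=
    fun z hz => pre_sub_pre_mem (f := f.comp g)
      (g := ⟨LinearMap.id, fun h => h, fun _ => rfl⟩) hr' hfg hz
  refine nonempty_quotient_equiv g.pre (fun z hz => hcoc g hz) (fun z hz => ⟨fun hz' => ?_,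
    hcob g⟩) fun z' hz' => ⟨f.pre z', hcoc f hz', h2 z' hz'⟩
  have := (homCoboundaries R.F V n).sub_mem (hcob f hz') (h1 z hz)
  rwa [sub_sub_cancel] at this

lemma nonempty_ext_equiv_left {U U' : DGModule 𝒜} {f : Hom U U'} (hf : f.IsQuasiIso)
    (V : DGModule 𝒜) (n : ℤ) : Nonempty (Ext U V n ≃ₗ[k] Ext U' V n) :=
  SemifreeResolution.nonempty_equiv
    ⟨(resolution U).F, (resolution U).isSemifree, f.comp (resolution U).π,
      hf.comp (resolution U).isQuasiIso⟩ (resolution U') V n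

lemma nonempty_ext_equiv_right {V V' : DGModule 𝒜} {g : Hom V V'} (hg : g.IsQuasiIso)
    (U : DGModule 𝒜) (n : ℤ) : Nonempty (Ext U V n ≃ₗ[k] Ext U V' n) :=
  (resolution U).isSemifree.nonempty_equiv_post hg n

end Lifting

end DGModule

/-! ### Exterior algebras -/

namespace IsExteriorOn

section Ungraded

variable {k A : Type u} [Field k] [Ring A] [Algebra k A] {𝒜 : ℤ → Submodule k A}
  {c : ℕ} {deg : Fin c → ℤ} {ξ : Fin c → A}

lemma equiv_ι (h : IsExteriorOn 𝒜 deg ξ) (v : Fin c → k) :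
    h.equiv (ExteriorAlgebra.ι k v) = ∑ i, v i • ξ i := by
  simp [equiv, Fintype.linearCombination_apply]

/-- Induction along left multiplication by the generators. -/
@[elab_as_elim]
lemma gen_induction (h : IsExteriorOn 𝒜 deg ξ) {P : A → Prop} (a : A)
    (algebraMap : ∀ r, P (algebraMap k A r)) (add : ∀ x y, P x → P y → P (x + y))
    (smul : ∀ (r : k) x, P x → P (r • x)) (mul : ∀ i x, P x → P (ξ i * x)) : P a := by
  obtain ⟨x, rfl⟩ := h.equiv.surjective a
  induction x using CliffordAlgebra.left_induction with
  | algebraMap r =>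
    have := algebraMap r
    rwa [← h.equiv.commutes] at this
  | add x y hx hy => rw [map_add]; exact add _ _ hx hy
  | ι_mul x v hx =>
    have h0 : P 0 := by
      have := algebraMap 0
      rwa [map_zero] at this
    have : h.equiv (CliffordAlgebra.ι 0 v * x) = ∑ i, v i • (ξ i * h.equiv x) := by
      rw [map_mul]
      have := h.equiv_ι v
      rw [ExteriorAlgebra.ι] at this
      rw [this, Finset.sum_mul]
      simp only [smul_mul_assoc]
    rw [this]
    refine Finset.sum_induction _ P add h0 fun i _ => smul _ _ (mul _ _ hx)

lemma linearCombination_single (i : Fin c) :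
    Fintype.linearCombination k ξ (Pi.single i 1) = ξ i := by
  simp

lemma gen_mul_self (h : IsExteriorOn 𝒜 deg ξ) (i : Fin c) : ξ i * ξ i = 0 := by
  have := h.sq_zero (Pi.single i 1)
  rwa [linearCombination_single] at this

lemma gen_mul_gen (h : IsExteriorOn 𝒜 deg ξ) (i j : Fin c) : ξ i * ξ j = -(ξ j * ξ i) := by
  have := h.sq_zero (Pi.single i 1 + Pi.single j 1)
  rw [map_add, linearCombination_single, linearCombination_single, add_mul, mul_add, mul_add,
    h.gen_mul_self, h.gen_mul_self, zero_add, add_zero] at this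
  exact eq_neg_of_add_eq_zero_left this

/-- The left contraction of the exterior algebra by the `j`-th coordinate: the derivation with
`ξ_j ↦ 1` and `ξ_i ↦ 0` for `i ≠ j`. -/
def contraction (h : IsExteriorOn 𝒜 deg ξ) (j : Fin c) : A →ₗ[k] A :=
  h.equiv.toLinearMap ∘ₗ CliffordAlgebra.contractLeft (Q := (0 : QuadraticForm k (Fin c → k)))
    (LinearMap.proj j) ∘ₗ h.equiv.symm.toLinearMap

lemma contraction_algebraMap (h : IsExteriorOn 𝒜 deg ξ) (j : Fin c) (r : k) :
    h.contraction j (algebraMap k A r) = 0 := by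
  change h.equiv (CliffordAlgebra.contractLeft (Q := (0 : QuadraticForm k (Fin c → k))) _
    (h.equiv.symm _)) = 0
  rw [h.equiv.symm.commutes, CliffordAlgebra.contractLeft_algebraMap, map_zero]

lemma contraction_gen_mul (h : IsExteriorOn 𝒜 deg ξ) (j i : Fin c) (a : A) :
    h.contraction j (ξ i * a) = (if i = j then a else 0) - ξ i * h.contraction j a := by
  have hi : ξ i = h.equiv (ExteriorAlgebra.ι k (Pi.single i 1)) := by
    rw [equiv_ι]
    simp [Pi.single_apply]
  change h.equiv (CliffordAlgebra.contractLeft (Q := (0 : QuadraticForm k (Fin c → k))) _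
    (h.equiv.symm _)) = _ - _ * h.equiv (CliffordAlgebra.contractLeft
      (Q := (0 : QuadraticForm k (Fin c → k))) _ (h.equiv.symm a))
  rw [hi, map_mul, AlgEquiv.symm_apply_apply, ExteriorAlgebra.ι,
    CliffordAlgebra.contractLeft_ι_mul, map_sub, map_mul, map_smul, AlgEquiv.apply_symm_apply,
    LinearMap.proj_apply, Pi.single_apply]
  by_cases hij : i = j
  · simp [hij]
  · simp [hij, Ne.symm hij]

lemma contraction_contraction (h : IsExteriorOn 𝒜 deg ξ) (i j : Fin c) (a : A) :
    h.contraction i (h.contraction j a) = -h.contraction j (h.contraction i a) := by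
  change h.equiv (CliffordAlgebra.contractLeft (Q := (0 : QuadraticForm k (Fin c → k))) _
    (h.equiv.symm (h.equiv _))) = -h.equiv (CliffordAlgebra.contractLeft
      (Q := (0 : QuadraticForm k (Fin c → k))) _ (h.equiv.symm (h.equiv _)))
  rw [AlgEquiv.symm_apply_apply, AlgEquiv.symm_apply_apply, ← map_neg]
  exact congrArg h.equiv (CliffordAlgebra.contractLeft_comm _ _ _)

lemma contraction_self (h : IsExteriorOn 𝒜 deg ξ) (i : Fin c) (a : A) :
    h.contraction i (h.contraction i a) = 0 := by
  change h.equiv (CliffordAlgebra.contractLeft (Q := (0 : QuadraticForm k (Fin c → k))) _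
    (h.equiv.symm (h.equiv _))) = 0
  rw [AlgEquiv.symm_apply_apply]
  change h.equiv (CliffordAlgebra.contractLeft (Q := (0 : QuadraticForm k (Fin c → k))) _
    (CliffordAlgebra.contractLeft (Q := (0 : QuadraticForm k (Fin c → k))) _ _)) = 0
  rw [CliffordAlgebra.contractLeft_contractLeft, map_zero]

/-- The operators `a ↦ ∂_j (ξ_j a)` preserve the ideals `ξ_i A`, and the `i`-th of them kills
`ξ_i A`; on scalars and on elements killed by all contractions they are the identity. -/
lemma eq_algebraMap_of_contraction_eq_zero (h : IsExteriorOn 𝒜 deg ξ) {a : A}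
    (ha : ∀ j, h.contraction j a = 0) : ∃ r, a = algebraMap k A r := by
  let q : Fin c → A →ₗ[k] A := fun j => h.contraction j ∘ₗ LinearMap.mulLeft k (ξ j)
  have hq : ∀ j x, q j x = h.contraction j (ξ j * x) := fun _ _ => rfl
  let Q : List (Fin c) → A →ₗ[k] A := fun l => l.foldr (fun j f => q j ∘ₗ f) LinearMap.id
  have hQ : ∀ j l x, Q (j :: l) x = q j (Q l x) := fun _ _ _ => rfl
  have hqi : ∀ i x, q i (ξ i * x) = 0 := fun i x => by
    rw [hq, ← mul_assoc, h.gen_mul_self, zero_mul, map_zero]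
  have hideal : ∀ l i x, ∃ y, Q l (ξ i * x) = ξ i * y := by
    intro l i x
    induction l with
    | nil => exact ⟨x, rfl⟩
    | cons j l ih =>
      obtain ⟨y, hy⟩ := ih
      rw [hQ, hy]
      by_cases hij : i = j
      · exact ⟨0, by rw [hij, hqi, mul_zero]⟩
      · refine ⟨q j y, ?_⟩
        rw [hq, ← mul_assoc, h.gen_mul_gen, neg_mul, mul_assoc, map_neg, contraction_gen_mul,
          if_neg hij, zero_sub, neg_neg, hq]
  have hkill : ∀ l i x, i ∈ l → Q l (ξ i * x) = 0 := by
    intro l i x hi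
    induction l with
    | nil => simp at hi
    | cons j l ih =>
      rw [hQ]
      by_cases hil : i ∈ l
      · rw [ih hil, map_zero]
      · obtain rfl : i = j := by simpa [hil] using hi
        obtain ⟨y, hy⟩ := hideal l i x
        rw [hy, hqi]
  have hscal : ∀ l r, Q l (algebraMap k A r) = algebraMap k A r := by
    intro l r
    induction l with
    | nil => rfl
    | cons j l ih => rw [hQ, ih, hq, contraction_gen_mul, if_pos rfl, contraction_algebraMap,
        mul_zero, sub_zero]
  have hid : ∀ l, Q l a = a := by
    intro l
    induction l with
    | nil => rfl
    | cons j l ih => rw [hQ, ih, hq, contraction_gen_mul, if_pos rfl, ha, mul_zero, sub_zero]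
  have key : ∀ x : A, ∃ r, Q (List.finRange c) x = algebraMap k A r := by
    intro x
    induction x using h.gen_induction with
    | algebraMap r => exact ⟨r, hscal _ r⟩
    | add x y hx hy =>
      obtain ⟨r, hr⟩ := hx
      obtain ⟨s, hs⟩ := hy
      exact ⟨r + s, by rw [map_add, hr, hs, map_add]⟩
    | smul t x hx =>
      obtain ⟨r, hr⟩ := hx
      exact ⟨t * r, by rw [map_smul, hr, map_mul, Algebra.smul_def]⟩
    | mul i x _ => exact ⟨0, by rw [hkill _ _ _ (List.mem_finRange i), map_zero]⟩
  obtain ⟨r, hr⟩ := key a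
  exact ⟨r, by rw [← hr, hid]⟩

end Ungraded

section Graded

open DGModule

variable {k A : Type u} [Field k] [Ring A] [Algebra k A] {𝒜 : ℤ → Submodule k A}
  [GradedAlgebra 𝒜] {c : ℕ} {deg : Fin c → ℤ} {ξ : Fin c → A}

lemma signMap_gen_mul (h : IsExteriorOn 𝒜 deg ξ) (hdeg : ∀ i, Odd (deg i)) (i : Fin c) (a : A) :
    signMap 𝒜 (ξ i * a) = -(ξ i * signMap 𝒜 a) := by
  rw [signMap_mul (h.mem i), Int.negOnePow_odd _ (hdeg i), Units.neg_smul, one_smul]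

lemma signMap_algebraMap (r : k) : signMap 𝒜 (algebraMap k A r) = algebraMap k A r := by
  rw [Algebra.algebraMap_eq_smul_one, map_smul, signMap_one]

lemma signMap_signMap (a : A) : signMap 𝒜 (signMap 𝒜 a) = a := by
  induction a using DirectSum.Decomposition.inductionOn 𝒜 with
  | zero => simp
  | @homogeneous j m =>
    rw [signMap_of_mem m.2, Units.smul_def, map_zsmul, signMap_of_mem m.2, ← Units.smul_def,
      smul_smul, ← Int.negOnePow_add, Int.negOnePow_even _ (Even.add_self j), one_smul]
  | add x y hx hy => rw [map_add, map_add, hx, hy]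

/-- The generators commute with all elements up to sign. -/
lemma gen_mul (h : IsExteriorOn 𝒜 deg ξ) (hdeg : ∀ i, Odd (deg i)) (i : Fin c) (a : A) :
    ξ i * a = signMap 𝒜 a * ξ i := by
  induction a using h.gen_induction with
  | algebraMap r => rw [signMap_algebraMap, Algebra.commutes]
  | add x y hx hy => rw [mul_add, hx, hy, map_add, add_mul]
  | smul r x hx => rw [mul_smul_comm, hx, map_smul, smul_mul_assoc]
  | mul j x hx =>
    rw [h.signMap_gen_mul hdeg, neg_mul, mul_assoc, ← hx, ← mul_assoc, h.gen_mul_gen, neg_mul,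
      mul_assoc]

lemma signMap_contraction (h : IsExteriorOn 𝒜 deg ξ) (hdeg : ∀ i, Odd (deg i)) (j : Fin c)
    (a : A) : signMap 𝒜 (h.contraction j a) = -h.contraction j (signMap 𝒜 a) := by
  induction a using h.gen_induction with
  | algebraMap r => rw [signMap_algebraMap, contraction_algebraMap, map_zero, neg_zero]
  | add x y hx hy => rw [map_add, map_add, hx, hy, map_add, map_add, neg_add]
  | smul r x hx => rw [map_smul, map_smul, hx, map_smul, map_smul, smul_neg]
  | mul i x hx =>
    rw [h.signMap_gen_mul hdeg, map_neg, contraction_gen_mul, contraction_gen_mul, map_sub,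
      h.signMap_gen_mul hdeg, hx]
    split_ifs <;> simp

/-- An exterior algebra on generators of positive degrees has no elements of negative degree. -/
lemma eq_zero_of_neg (h : IsExteriorOn 𝒜 deg ξ) (hdeg : ∀ i, 0 < deg i) {n : ℤ} (hn : n < 0)
    {a : A} (ha : a ∈ 𝒜 n) : a = 0 := by
  have key : ∀ a : A, ∀ n < 0, (DirectSum.decompose 𝒜 a n : A) = 0 := by
    intro a
    induction a using h.gen_induction with
    | algebraMap r =>
      intro n hn
      exact DirectSum.decompose_of_mem_ne 𝒜 (SetLike.algebraMap_mem_graded 𝒜 r) hn.ne'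
    | add x y hx hy =>
      intro n hn
      rw [DirectSum.decompose_add, DirectSum.add_apply, Submodule.coe_add, hx n hn, hy n hn,
        add_zero]
    | smul r x hx =>
      intro n hn
      rw [DirectSum.decompose_smul]
      change r • ((DirectSum.decompose 𝒜 x n : 𝒜 n) : A) = 0
      rw [hx n hn, smul_zero]
    | mul i x hx =>
      intro n hn
      have : n = deg i + (n - deg i) := by ring
      rw [this, DirectSum.coe_decompose_mul_add_of_left_mem 𝒜 (h.mem i),
        hx _ (by have := hdeg i; omega), mul_zero]
  rw [← DirectSum.decompose_of_mem_same 𝒜 ha, key a n hn]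

end Graded

end IsExteriorOn

/-! ### Finite-dimensional models -/

namespace DGModule

/-- A family of subspaces with a compatible family of projections is a grading. -/
lemma isInternal_of_proj {k M : Type*} [Field k] [AddCommGroup M] [Module k M]
    (gr : ℤ → Submodule k M) (p : ℤ → M →ₗ[k] M) (h1 : ∀ n, ∀ x ∈ gr n, p n x = x)
    (h2 : ∀ m n, ∀ x ∈ gr m, m ≠ n → p n x = 0) (h3 : ∀ x, x ∈ ⨆ n, gr n) :
    DirectSum.IsInternal gr := by
  rw [DirectSum.isInternal_submodule_iff_iSupIndep_and_iSup_eq_top]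
  refine ⟨?_, eq_top_iff.mpr fun x _ => h3 x⟩
  rw [iSupIndep_def]
  intro n
  rw [Submodule.disjoint_def]
  intro x hx hx'
  rw [← h1 n x hx]
  have : (⨆ j, ⨆ (_ : j ≠ n), gr j) ≤ LinearMap.ker (p n) :=
    iSup₂_le fun j hj y hy => h2 j n y hy hj
  exact this hx'

section Constructions

variable {k A : Type u} [Field k] [Ring A] [Algebra k A] {𝒜 : ℤ → Submodule k A}

/-- The DG submodule carried by a homogeneous submodule that is stable under the differential. -/
def sub (U : DGModule 𝒜) (G : Submodule A U) (hG : ∀ n, ∀ x ∈ G, U.proj n x ∈ G)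
    (hd : ∀ x ∈ G, U.d x ∈ G) : DGModule 𝒜 where
  carrier := G
  gr n := (U.gr n).comap (G.subtype.restrictScalars k)
  isInternal := by
    refine isInternal_of_proj _ (fun n => (U.proj n).restrict (p := G.restrictScalars k)
      (q := G.restrictScalars k) (hG n)) (fun n x hx => Subtype.ext (proj_of_mem hx))
      (fun m n x hx h => Subtype.ext (proj_of_mem_ne hx h)) fun x => ?_
    obtain ⟨s, hs, -⟩ := exists_finset_sum_proj (x : U)
    have : x = ∑ n ∈ s, (⟨U.proj n x, hG n x x.2⟩ : G) := by
      refine Subtype.ext ?_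
      rw [AddSubmonoidClass.coe_finsetSum]
      exact hs
    rw [this]
    exact Submodule.sum_mem _ fun n _ => Submodule.mem_iSup_of_mem n (U.proj_mem n (x : U))
  smul_mem ha hu := U.smul_mem ha hu
  d := U.d.restrict (p := G.restrictScalars k) (q := G.restrictScalars k) hd
  d_mem hu := U.d_mem hu
  d_d u := Subtype.ext (U.d_d u)
  d_smul ha u := Subtype.ext (by
    have := U.d_smul ha (u : U)
    rw [Units.smul_def] at this ⊢
    exact this)

/-- The inclusion of a DG submodule. -/
def subHom (U : DGModule 𝒜) (G : Submodule A U) (hG : ∀ n, ∀ x ∈ G, U.proj n x ∈ G)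
    (hd : ∀ x ∈ G, U.d x ∈ G) : Hom (U.sub G hG hd) U where
  toFun := G.subtype
  map_mem h := h
  map_d _ := rfl

/-- The map induced on a quotient by an `A`-submodule by a `k`-linear map that preserves it. -/
def quotMap {M : Type u} [AddCommGroup M] [Module k M] [Module A M] [IsScalarTower k A M]
    (N : Submodule A M) (T : M →ₗ[k] M) (hT : ∀ x ∈ N, T x ∈ N) : (M ⧸ N) →ₗ[k] (M ⧸ N) :=
  (Submodule.Quotient.restrictScalarsEquiv k N).toLinearMap ∘ₗ
    (N.restrictScalars k).mapQ (N.restrictScalars k) T hT ∘ₗ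
      (Submodule.Quotient.restrictScalarsEquiv k N).symm.toLinearMap

/-- The quotient of a DG module by a DG submodule. -/
def quot (U : DGModule 𝒜) (N : Submodule A U) (hN : ∀ n, ∀ x ∈ N, U.proj n x ∈ N)
    (hd : ∀ x ∈ N, U.d x ∈ N) : DGModule 𝒜 where
  carrier := U ⧸ N
  gr n := (U.gr n).map (N.mkQ.restrictScalars k)
  isInternal := by
    refine isInternal_of_proj _ (fun n => quotMap N (U.proj n) (hN n)) ?_ ?_ ?_
    · rintro n _ ⟨x, hx, rfl⟩
      exact congrArg Submodule.Quotient.mk (proj_of_mem hx)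
    · rintro m n _ ⟨x, hx, rfl⟩ h
      exact congrArg Submodule.Quotient.mk (proj_of_mem_ne hx h)
    · intro x
      obtain ⟨x, rfl⟩ := Submodule.Quotient.mk_surjective _ x
      obtain ⟨s, hs, -⟩ := exists_finset_sum_proj x
      have : (Submodule.Quotient.mk x : U ⧸ N) = ∑ n ∈ s, N.mkQ (U.proj n x) := by
        rw [← map_sum, ← hs]
        rfl
      rw [this]
      exact Submodule.sum_mem _ fun n _ =>
        Submodule.mem_iSup_of_mem n ⟨U.proj n x, U.proj_mem n x, rfl⟩
  smul_mem := by
    rintro i j a _ ha ⟨u, hu, rfl⟩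
    exact ⟨a • u, U.smul_mem ha hu, rfl⟩
  d := quotMap N U.d hd
  d_mem := by
    rintro n _ ⟨u, hu, rfl⟩
    exact ⟨U.d u, U.d_mem hu, rfl⟩
  d_d u := by
    obtain ⟨u, rfl⟩ := Submodule.Quotient.mk_surjective _ u
    exact congrArg Submodule.Quotient.mk (U.d_d u)
  d_smul ha u := by
    obtain ⟨u, rfl⟩ := Submodule.Quotient.mk_surjective _ u
    have := congrArg (Submodule.Quotient.mk (p := N)) (U.d_smul ha u)
    rw [Units.smul_def] at this ⊢
    exact this

/-- The projection onto a quotient DG module. -/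
def quotHom (U : DGModule 𝒜) (N : Submodule A U) (hN : ∀ n, ∀ x ∈ N, U.proj n x ∈ N)
    (hd : ∀ x ∈ N, U.d x ∈ N) : Hom U (U.quot N hN hd) where
  toFun := N.mkQ
  map_mem hu := ⟨_, hu, rfl⟩
  map_d _ := rfl

lemma HasFiniteHomology.of_isQuasiIso {U V : DGModule 𝒜} (hU : U.HasFiniteHomology) {f : Hom U V}
    (hf : f.IsQuasiIso) : V.HasFiniteHomology := by
  have : Module.Finite k (⨁ n : ℤ, U.homology n) := hU
  exact Module.Finite.equiv (M := ⨁ n : ℤ, U.homology n) (N := ⨁ n : ℤ, V.homology n)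
    (DFinsupp.mapRange.linearEquiv fun n => LinearEquiv.ofBijective (f.homologyMap n) (hf n))

/-- A contraction of the complex of vector spaces underlying `U`: a homotopy `h` from the identity
to a projection `p` onto a space of representatives of the homology. -/
structure Contraction (U : DGModule 𝒜) where
  h : U →ₗ[k] U
  p : U →ₗ[k] U
  h_mem : ∀ n, ∀ x ∈ U.gr n, h x ∈ U.gr (n + 1)
  p_mem : ∀ n, ∀ x ∈ U.gr n, p x ∈ U.gr n
  eq_add : ∀ x, x = p x + (U.d (h x) + h (U.d x))
  d_p : ∀ x, U.d (p x) = 0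
  p_d : ∀ x, p (U.d x) = 0
  p_p : ∀ x, p (p x) = p x

/-- If `s` is a homogeneous generalized inverse of `d`, then `p = (1 - ds)(1 - sd)` and
`h = s - ssd` form a contraction. -/
lemma nonempty_contraction (U : DGModule 𝒜) : Nonempty U.Contraction := by
  obtain ⟨s₀, hs₀⟩ := U.d.rangeRestrict.exists_rightInverse_of_surjective U.d.range_rangeRestrict
  obtain ⟨s₁, hs₁⟩ := LinearMap.exists_extend s₀
  have hs1 : ∀ x, U.d (s₁ (U.d x)) = U.d x := by
    intro x
    have h1 : s₁ (U.d x) = s₀ (U.d.rangeRestrict x) := LinearMap.congr_fun hs₁ (U.d.rangeRestrict x)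
    have h2 := congrArg Subtype.val (LinearMap.congr_fun hs₀ (U.d.rangeRestrict x))
    rw [h1]
    exact h2
  -- the part of degree `1` of the generalized inverse
  let T : (⨁ n, U.gr n) →ₗ[k] U :=
    DirectSum.toModule k ℤ U fun n => U.proj (n + 1) ∘ₗ s₁ ∘ₗ (U.gr n).subtype
  let s : U →ₗ[k] U := T ∘ₗ U.grEquiv.symm.toLinearMap
  have hs : ∀ n, ∀ x ∈ U.gr n, s x = U.proj (n + 1) (s₁ x) := by
    intro n x hx
    have : U.grEquiv.symm x = DirectSum.lof k ℤ (fun i => U.gr i) n ⟨x, hx⟩ := by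
      rw [LinearEquiv.symm_apply_eq, grEquiv_apply, DirectSum.coeLinearMap_lof]
    change T (U.grEquiv.symm x) = _
    rw [this, DirectSum.toModule_lof]
    rfl
  have hsm : ∀ n, ∀ x ∈ U.gr n, s x ∈ U.gr (n + 1) := by
    intro n x hx
    rw [hs n x hx]
    exact U.proj_mem _ _
  have hds : ∀ x, U.d (s (U.d x)) = U.d x := by
    intro x
    induction x using gr_induction with
    | zero => simp
    | homogeneous n x hx =>
      rw [hs _ _ (U.d_mem hx), ← proj_d, hs1, proj_of_mem (U.d_mem hx)]
    | add x y hx hy => simp only [map_add, hx, hy]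
  refine ⟨⟨s - s ∘ₗ s ∘ₗ U.d, (LinearMap.id - U.d ∘ₗ s) ∘ₗ (LinearMap.id - s ∘ₗ U.d),
    fun n x hx => ?_, fun n x hx => ?_, fun x => ?_, fun x => ?_, fun x => ?_, fun x => ?_⟩⟩
  · refine (U.gr _).sub_mem (hsm n x hx) ?_
    have := hsm _ _ (hsm _ _ (U.d_mem hx))
    rwa [sub_add_cancel] at this
  · have h1 : ∀ y ∈ U.gr n, s (U.d y) ∈ U.gr n := fun y hy => by
      have := hsm _ _ (U.d_mem hy)
      rwa [sub_add_cancel] at this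
    have h2 : ∀ y ∈ U.gr n, U.d (s y) ∈ U.gr n := fun y hy => by
      have := U.d_mem (hsm _ _ hy)
      rwa [add_sub_cancel_right] at this
    have h3 := (U.gr n).sub_mem hx (h1 x hx)
    exact (U.gr n).sub_mem h3 (h2 _ h3)
  all_goals simp only [LinearMap.sub_apply, LinearMap.comp_apply, LinearMap.id_apply, map_sub,
    U.d_d, hds, map_zero]
  all_goals abel

namespace Contraction

variable {U : DGModule 𝒜} (C : U.Contraction)

lemma proj_p (n : ℤ) (x : U) : U.proj n (C.p x) = C.p (U.proj n x) := by
  have := proj_map C.p 0 (fun n x hx => by rw [add_zero]; exact C.p_mem n x hx) n x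
  rwa [add_zero] at this

lemma proj_h (n : ℤ) (x : U) : U.proj n (C.h x) = C.h (U.proj (n - 1) x) := by
  have := proj_map C.h 1 C.h_mem (n - 1) x
  rwa [sub_add_cancel] at this

lemma finite_range (hU : U.HasFiniteHomology) : Module.Finite k (LinearMap.range C.p) := by
  have : Module.Finite k (⨁ n : ℤ, U.homology n) := hU
  let θ : (⨁ n : ℤ, U.homology n) →ₗ[k] U := DirectSum.toModule k ℤ U fun n =>
    Submodule.liftQ _ (C.p ∘ₗ (U.cycles n).subtype) (by
      rintro ⟨z, hz⟩ h
      obtain ⟨w, -, hw⟩ : ∃ w ∈ U.gr (n + 1), U.d w = z := h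
      change C.p z = 0
      rw [← hw, C.p_d])
  have hle : LinearMap.range C.p ≤ LinearMap.range θ := by
    rintro _ ⟨x, rfl⟩
    induction x using gr_induction with
    | zero => rw [map_zero]; exact zero_mem _
    | homogeneous n x hx =>
      refine ⟨DirectSum.lof k ℤ (fun n => U.homology n) n
        (Submodule.Quotient.mk ⟨C.p x, C.p_mem n x hx, C.d_p x⟩), ?_⟩
      rw [DirectSum.toModule_lof]
      exact C.p_p x
    | add x y hx hy => rw [map_add]; exact add_mem hx hy
  exact Submodule.finiteDimensional_of_le hle

/-- If the homology is finite, then `p` lives in finitely many degrees. -/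
lemma exists_bound (hU : U.HasFiniteHomology) :
    ∃ b : ℕ, ∀ n : ℤ, (b : ℤ) < |n| → ∀ x ∈ U.gr n, C.p x = 0 := by
  obtain ⟨S, hS⟩ := (Module.Finite.iff_fg.mp (C.finite_range hU))
  choose s _ hs using fun x : U => exists_finset_sum_proj x
  classical
  let t : Finset ℤ := S.biUnion s
  refine ⟨∑ n ∈ t, n.natAbs, fun n hn x hx => ?_⟩
  have hnt : n ∉ t := fun h => by
    have := Finset.single_le_sum (f := fun n : ℤ => n.natAbs) (fun _ _ => Nat.zero_le _) h
    rw [Int.abs_eq_natAbs] at hn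
    have h2 : n.natAbs ≤ ∑ n ∈ t, n.natAbs := this
    omega
  have hker : Submodule.span k (S : Set U) ≤ LinearMap.ker (U.proj n) :=
    Submodule.span_le.mpr fun y hy => hs y n fun h => hnt (Finset.mem_biUnion.mpr ⟨y, hy, h⟩)
  rw [hS] at hker
  rw [← proj_of_mem (C.p_mem n x hx)]
  exact hker ⟨x, rfl⟩

end Contraction

lemma proj_smul {U : DGModule 𝒜} {i : ℤ} {a : A} (ha : a ∈ 𝒜 i) (n : ℤ) (x : U) :
    U.proj n (a • x) = a • U.proj (n - i) x := by
  have := proj_map (U := U) (V := U) (Module.toModuleEnd k (S := A) U a) i (fun m y hy => by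
    rw [add_comm]; exact U.smul_mem ha hy) (n - i) x
  rwa [sub_add_cancel] at this

/-- Over an exterior algebra on generators of positive odd degrees, a DG module with finite
homology that is bounded above contains a quasi-isomorphic finite-dimensional DG submodule: the span
of all words in the generators and a contracting homotopy, applied to representatives of the
homology. -/
lemma exists_finite_sub {c : ℕ} {deg : Fin c → ℤ} {ξ : Fin c → A} (hΛ : IsExteriorOn 𝒜 deg ξ)
    (hdeg : ∀ i, 0 < deg i ∧ Odd (deg i)) (T : DGModule 𝒜) (hT : T.HasFiniteHomology) {m : ℤ}
    (hm : ∀ n, m < n → ∀ x ∈ T.gr n, x = 0) :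
    ∃ (G : DGModule 𝒜) (f : Hom G T), f.IsQuasiIso ∧ Module.Finite k G := by
  obtain ⟨C⟩ := T.nonempty_contraction
  obtain ⟨b, hb⟩ := C.exists_bound hT
  let X : Fin c → T →ₗ[k] T := fun i => Module.toModuleEnd k (S := A) T (ξ i)
  have hX : ∀ i x, X i x = ξ i • x := fun _ _ => rfl
  let W : ℕ → Submodule k T := fun r =>
    Nat.rec (LinearMap.range C.p) (fun _ w => (⨆ i, w.map (X i)) ⊔ w.map C.h) r
  have hW : ∀ r, W (r + 1) = (⨆ i, (W r).map (X i)) ⊔ (W r).map C.h := fun _ => rfl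
  have hind : ∀ (Q : ℕ → Submodule k T), LinearMap.range C.p ≤ Q 0 →
      (∀ r, ∀ x ∈ W r, x ∈ Q r → (∀ i, ξ i • x ∈ Q (r + 1)) ∧ C.h x ∈ Q (r + 1)) →
      ∀ r, W r ≤ Q r := by
    intro Q h0 h1 r
    induction r with
    | zero => exact h0
    | succ r ih =>
      rw [hW]
      refine sup_le (iSup_le fun i => ?_) ?_
      · rintro _ ⟨x, hx, rfl⟩; exact (h1 r x hx (ih hx)).1 i
      · rintro _ ⟨x, hx, rfl⟩; exact (h1 r x hx (ih hx)).2
  let G₀ : Submodule k T := ⨆ r, W r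
  have hWG : ∀ r, W r ≤ G₀ := fun r => le_iSup W r
  have hGξ : ∀ i, ∀ x ∈ G₀, ξ i • x ∈ G₀ := by
    intro i x hx
    have : G₀ ≤ G₀.comap (X i) := iSup_le fun r y hy =>
      hWG (r + 1) ((le_sup_of_le_left (le_iSup (fun i => (W r).map (X i)) i)) ⟨y, hy, rfl⟩)
    exact this hx
  have hGh : ∀ x ∈ G₀, C.h x ∈ G₀ := by
    intro x hx
    have : G₀ ≤ G₀.comap C.h := iSup_le fun r y hy =>
      hWG (r + 1) ((le_sup_right : (W r).map C.h ≤ _) ⟨y, hy, rfl⟩)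
    exact this hx
  have hGp : ∀ x, C.p x ∈ G₀ := fun x => hWG 0 ⟨x, rfl⟩
  have hGd : ∀ x ∈ G₀, T.d x ∈ G₀ := by
    intro x hx
    have : G₀ ≤ G₀.comap T.d := by
      refine iSup_le (hind (fun _ => G₀.comap T.d) ?_ ?_)
      · rintro _ ⟨y, rfl⟩
        change T.d (C.p y) ∈ G₀
        rw [C.d_p]; exact zero_mem _
      · intro r y hy hdy
        have hy' := hWG r hy
        refine ⟨fun i => ?_, ?_⟩
        · change T.d (ξ i • y) ∈ G₀
          rw [T.d_smul (hΛ.mem i), Units.smul_def]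
          exact zsmul_mem (hGξ i _ hdy) _
        · change T.d (C.h y) ∈ G₀
          have : T.d (C.h y) = y - C.p y - C.h (T.d y) := by
            rw [sub_sub, eq_sub_iff_add_eq]
            conv_rhs => rw [C.eq_add y]
            abel
          rw [this]
          exact sub_mem (sub_mem hy' (hGp y)) (hGh _ hdy)
    exact this hx
  have hGproj : ∀ n, ∀ x ∈ G₀, T.proj n x ∈ G₀ := by
    have : ∀ r, W r ≤ ⨅ n, (W r).comap (T.proj n) := by
      refine hind (fun r => ⨅ n, (W r).comap (T.proj n)) ?_ ?_
      · rintro _ ⟨y, rfl⟩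
        refine (Submodule.mem_iInf _).mpr fun n => ?_
        change T.proj n (C.p y) ∈ LinearMap.range C.p
        rw [C.proj_p]
        exact ⟨_, rfl⟩
      · intro r y hy hpy
        rw [Submodule.mem_iInf] at hpy
        refine ⟨fun i => (Submodule.mem_iInf _).mpr fun n => ?_,
          (Submodule.mem_iInf _).mpr fun n => ?_⟩
        · change T.proj n (ξ i • y) ∈ W (r + 1)
          rw [proj_smul (hΛ.mem i)]
          exact (le_sup_of_le_left (le_iSup (fun i => (W r).map (X i)) i)) ⟨_, hpy _, rfl⟩
        · change T.proj n (C.h y) ∈ W (r + 1)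
          rw [C.proj_h]
          exact (le_sup_right : (W r).map C.h ≤ _) ⟨_, hpy _, rfl⟩
    intro n x hx
    have h2 : G₀ ≤ G₀.comap (T.proj n) := iSup_le fun r y hy =>
      hWG r ((Submodule.mem_iInf _).mp (this r hy) n)
    exact h2 hx
  -- words of length `r` have degree at least `r - b`
  have hlow : ∀ r, W r ≤ ⨅ n : {n : ℤ // n < r - b}, LinearMap.ker (T.proj n) := by
    refine hind (fun r => ⨅ n : {n : ℤ // n < r - b}, LinearMap.ker (T.proj n)) ?_ ?_
    · rintro _ ⟨y, rfl⟩
      refine (Submodule.mem_iInf _).mpr fun ⟨n, hn⟩ => ?_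
      change T.proj n (C.p y) = 0
      rw [C.proj_p]
      have hn' : n < -b := by simpa using hn
      exact hb n (by rw [abs_of_neg (by omega)]; omega) _ (T.proj_mem n y)
    · intro r y hy hpy
      rw [Submodule.mem_iInf] at hpy
      refine ⟨fun i => (Submodule.mem_iInf _).mpr fun ⟨n, hn⟩ => ?_,
        (Submodule.mem_iInf _).mpr fun ⟨n, hn⟩ => ?_⟩
      · change T.proj n (ξ i • y) = 0
        have := (hdeg i).1
        push_cast at hn
        rw [proj_smul (hΛ.mem i), show T.proj (n - deg i) y = 0 from
          hpy ⟨n - deg i, by omega⟩, smul_zero]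
      · change T.proj n (C.h y) = 0
        push_cast at hn
        rw [C.proj_h, show T.proj (n - 1) y = 0 from hpy ⟨n - 1, by omega⟩, map_zero]
  have hbot : ∀ r : ℕ, m + b < r → W r = ⊥ := by
    intro r hr
    refine (Submodule.eq_bot_iff _).mpr fun x hx => ext_proj fun n => ?_
    rw [map_zero]
    by_cases hn : n < r - b
    · exact (Submodule.mem_iInf _).mp (hlow r hx) ⟨n, hn⟩
    · exact hm n (by omega) _ (T.proj_mem n x)
  have hWfin : ∀ r, (W r).FG := by
    intro r
    induction r with
    | zero => exact Module.Finite.iff_fg.mp (C.finite_range hT)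
    | succ r ih =>
      rw [hW]
      exact (Submodule.fg_iSup _ fun i => ih.map _).sup (ih.map _)
  have hfin : Module.Finite k G₀ := by
    have hle : G₀ ≤ ⨆ r : Fin ((m + b).toNat + 1), W r := by
      refine iSup_le fun r => ?_
      by_cases hr : m + b < r
      · rw [hbot r hr]; exact bot_le
      · exact le_iSup (fun r : Fin ((m + b).toNat + 1) => W r) ⟨r, by omega⟩
    have : Module.Finite k ↥(⨆ r : Fin ((m + b).toNat + 1), W r) :=
      Module.Finite.iff_fg.mpr (Submodule.fg_iSup _ fun r => hWfin r)
    exact Submodule.finiteDimensional_of_le hle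
  let G : Submodule A T :=
    { G₀ with
      smul_mem' := by
        intro a x hx
        change a • x ∈ G₀
        induction a using hΛ.gen_induction with
        | algebraMap r => rw [algebraMap_smul]; exact G₀.smul_mem r hx
        | add a a' ha ha' => rw [add_smul]; exact add_mem ha ha'
        | smul r a ha => rw [smul_assoc]; exact G₀.smul_mem r ha
        | mul i a ha => rw [mul_smul]; exact hGξ i _ ha }
  refine ⟨T.sub G hGproj hGd, T.subHom G hGproj hGd, Hom.isQuasiIso_of _ ?_ ?_, hfin⟩
  · rintro ⟨z, hzG⟩ hz ⟨v, hv⟩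
    have hz' : T.d z = 0 := congrArg Subtype.val hz
    have hv' : T.d v = z := hv
    refine ⟨⟨C.h z, hGh z hzG⟩, Subtype.ext ?_⟩
    change T.d (C.h z) = z
    have := C.eq_add z
    rw [hz', map_zero, add_zero] at this
    nth_rw 2 [← hv'] at this
    rw [C.p_d, zero_add] at this
    exact this.symm
  · intro v hv
    refine ⟨⟨C.p v, hGp v⟩, Subtype.ext (C.d_p v), -C.h v, ?_⟩
    have := C.eq_add v
    rw [hv, map_zero, add_zero] at this
    rw [map_neg]
    change -T.d (C.h v) = C.p v - v
    nth_rw 3 [this]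
    abel

end Constructions

section Models

variable {k A : Type u} [Field k] [Ring A] [Algebra k A] {𝒜 : ℤ → Submodule k A}
  [GradedAlgebra 𝒜]

/-- A DG module with finite homology over a non-negatively graded algebra is quasi-isomorphic to a
quotient that is bounded above: one factors out `U_{>m} + d(U_{m+1})` for large `m`. -/
lemma exists_bounded_above (hA : ∀ n < 0, ∀ a ∈ 𝒜 n, a = 0) (U : DGModule 𝒜)
    (hU : U.HasFiniteHomology) : ∃ (T : DGModule 𝒜) (f : Hom U T) (m : ℤ), f.IsQuasiIso ∧
      T.HasFiniteHomology ∧ ∀ n, m < n → ∀ x ∈ T.gr n, x = 0 := by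
  obtain ⟨C⟩ := U.nonempty_contraction
  obtain ⟨m, hm⟩ := C.exists_bound hU
  let N : Submodule A U :=
    { carrier := {x | (∀ n < (m : ℤ), U.proj n x = 0) ∧ ∃ y, U.d y = U.proj m x}
      add_mem' := by
        rintro x y ⟨hx, x', hx'⟩ ⟨hy, y', hy'⟩
        exact ⟨fun n hn => by rw [map_add, hx n hn, hy n hn, add_zero], x' + y',
          by rw [map_add, map_add, hx', hy']⟩
      zero_mem' := ⟨fun n _ => map_zero _, 0, by rw [map_zero, map_zero]⟩
      smul_mem' := by
        rintro a x ⟨hx, y, hy⟩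
        induction a using DirectSum.Decomposition.inductionOn 𝒜 with
        | zero => exact ⟨fun n _ => by rw [zero_smul, map_zero], 0, by
            rw [zero_smul, map_zero, map_zero]⟩
        | @homogeneous i a =>
          rcases lt_trichotomy i 0 with hi | hi | hi
          · rw [hA i hi a a.2]
            exact ⟨fun n _ => by rw [zero_smul, map_zero], 0, by
              rw [zero_smul, map_zero, map_zero]⟩
          · subst hi
            refine ⟨fun n hn => ?_, (a : A) • y, ?_⟩
            · rw [proj_smul a.2, hx _ (by omega), smul_zero]
            · rw [proj_smul a.2, U.d_smul a.2, Int.negOnePow_zero, one_smul, sub_zero, hy]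
          · refine ⟨fun n hn => ?_, 0, ?_⟩
            · rw [proj_smul a.2, hx _ (by omega), smul_zero]
            · rw [proj_smul a.2, hx _ (by omega), smul_zero, map_zero]
        | add a b ha hb =>
          obtain ⟨ha, y, hy⟩ := ha
          obtain ⟨hb, z, hz⟩ := hb
          exact ⟨fun n hn => by rw [add_smul, map_add, ha n hn, hb n hn, add_zero], y + z, by
            rw [add_smul, map_add, map_add, hy, hz]⟩ }
  have hmem : ∀ x, x ∈ N ↔ (∀ n < (m : ℤ), U.proj n x = 0) ∧ ∃ y, U.d y = U.proj m x :=
    fun _ => Iff.rfl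
  have hproj : ∀ n, ∀ x ∈ N, U.proj n x ∈ N := by
    rintro n x ⟨hx, y, hy⟩
    rw [hmem]
    have h1 : ∀ l, l ≠ n → U.proj l (U.proj n x) = 0 := fun l hl =>
      proj_of_mem_ne (U.proj_mem n x) hl.symm
    have h2 : U.proj n (U.proj n x) = U.proj n x := proj_of_mem (U.proj_mem n x)
    refine ⟨fun l hl => ?_, ?_⟩
    · by_cases h : l = n
      · subst h; rw [h2, hx l hl]
      · exact h1 l h
    · by_cases h : (m : ℤ) = n
      · subst h; exact ⟨y, by rw [h2, hy]⟩
      · exact ⟨0, by rw [h1 _ h, map_zero]⟩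
  have hd : ∀ x ∈ N, U.d x ∈ N := by
    rintro x ⟨hx, y, hy⟩
    rw [hmem]
    refine ⟨fun n hn => ?_, U.proj (m + 1) x, (proj_d _ _).symm⟩
    rw [proj_d]
    by_cases h : n + 1 = m
    · rw [h, ← hy, U.d_d]
    · rw [hx _ (by omega), map_zero]
  have hp : ∀ x ∈ N, C.p x = 0 := by
    rintro x ⟨hx, y, hy⟩
    refine ext_proj fun n => ?_
    rw [C.proj_p, map_zero]
    rcases lt_trichotomy n m with h | h | h
    · rw [hx n h, map_zero]
    · rw [h, ← hy, C.p_d]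
    · exact hm n (by rw [abs_of_pos (by omega)]; exact h) _ (U.proj_mem n x)
  have hN : ∀ x ∈ N, U.d x = 0 → x = U.d (C.h x) ∧ C.h x ∈ N := by
    intro x hxN hdx
    refine ⟨?_, ?_⟩
    · conv_lhs => rw [C.eq_add x, hp x hxN, hdx, map_zero, add_zero, zero_add]
    · rw [hmem]
      refine ⟨fun n hn => ?_, 0, ?_⟩
      · rw [C.proj_h, hxN.1 _ (by omega), map_zero]
      · rw [C.proj_h, hxN.1 _ (by omega), map_zero, map_zero]
  have hq : (U.quotHom N hproj hd).IsQuasiIso := by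
    refine Hom.isQuasiIso_of _ (fun z hz => ?_) fun v hv => ?_
    · rintro ⟨v, hv⟩
      obtain ⟨v, rfl⟩ := Submodule.Quotient.mk_surjective _ v
      have h1 : U.d v - z ∈ N := (Submodule.Quotient.eq N).mp hv
      obtain ⟨h2, -⟩ := hN _ h1 (by rw [map_sub, U.d_d, hz, sub_zero])
      exact ⟨v - C.h (U.d v - z), by rw [map_sub, ← h2, sub_sub_cancel]⟩
    · obtain ⟨v, rfl⟩ := Submodule.Quotient.mk_surjective _ v
      have h1 : U.d v ∈ N := (Submodule.Quotient.mk_eq_zero N).mp hv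
      obtain ⟨h2, h3⟩ := hN _ h1 (U.d_d v)
      refine ⟨v - C.h (U.d v), by rw [map_sub, ← h2, sub_self], 0, ?_⟩
      rw [map_zero]
      refine ((sub_eq_zero.mpr ((Submodule.Quotient.eq N).mpr ?_)).symm)
      rw [sub_sub_cancel_left]
      exact N.neg_mem h3
  refine ⟨U.quot N hproj hd, U.quotHom N hproj hd, m, hq, hU.of_isQuasiIso hq, ?_⟩
  rintro n hn _ ⟨x, hx, rfl⟩
  refine (Submodule.Quotient.mk_eq_zero N).mpr ((hmem x).mpr ⟨fun l hl => ?_, 0, ?_⟩)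
  · exact proj_of_mem_ne hx (by omega)
  · rw [map_zero, proj_of_mem_ne hx (by omega)]

/-- Every DG module with finite homology over an exterior algebra has a finite-dimensional model
with the same Ext groups. -/
lemma exists_finite_model {c : ℕ} {deg : Fin c → ℤ} {ξ : Fin c → A} (hΛ : IsExteriorOn 𝒜 deg ξ)
    (hdeg : ∀ i, 0 < deg i ∧ Odd (deg i)) (U : DGModule 𝒜) (hU : U.HasFiniteHomology) :
    ∃ G : DGModule 𝒜, Module.Finite k G ∧
      (∀ V, cxPair U V = cxPair G V) ∧ ∀ V, cxPair V U = cxPair V G := by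
  obtain ⟨T, f, m, hf, hT, hm⟩ := exists_bounded_above
    (fun n hn a ha => hΛ.eq_zero_of_neg (fun i => (hdeg i).1) hn ha) U hU
  obtain ⟨G, g, hg, hG⟩ := exists_finite_sub hΛ hdeg T hT hm
  refine ⟨G, hG, fun V => ?_, fun V => ?_⟩
  · refine congrArg seqComplexity (funext fun n => ?_)
    obtain ⟨e⟩ := nonempty_ext_equiv_left hf V n
    obtain ⟨e'⟩ := nonempty_ext_equiv_left hg V n
    rw [e.rank_eq, e'.rank_eq]
  · refine congrArg seqComplexity (funext fun n => ?_)
    obtain ⟨e⟩ := nonempty_ext_equiv_right hf V n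
    obtain ⟨e'⟩ := nonempty_ext_equiv_right hg V n
    rw [e.rank_eq, e'.rank_eq]

end Models

end DGModule

/-! ### Adapted bases -/

namespace DGModule

section AdaptedBasis

variable {k A : Type u} [Field k] [Ring A] [Algebra k A] {𝒜 : ℤ → Submodule k A}
  {c : ℕ}

/-- A finite homogeneous basis of a DG module over an exterior algebra, with levels such that the
differential and the generators `ξ_s` strictly lower the level. -/
structure AdaptedBasis (ξ : Fin c → A) (U : DGModule 𝒜) where
  J : Type u
  [fintype : Fintype J]
  b : Module.Basis J k U
  degree : J → ℤ
  level : J → ℕ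
  mem : ∀ j, b j ∈ U.gr (degree j)
  level_d : ∀ i j, b.repr (U.d (b j)) i ≠ 0 → level i < level j
  level_smul : ∀ s i j, b.repr (ξ s • b j) i ≠ 0 → level i < level j

attribute [instance] AdaptedBasis.fintype

/-- A subspace `Z` of a vector space has a basis that extends to the whole space. -/
lemma exists_basis_extending {k V : Type u} [Field k] [AddCommGroup V] [Module k V]
    (Z : Submodule k V) : ∃ (I I' : Type u) (b : Module.Basis (I ⊕ I') k V),
      (∀ i, b (Sum.inl i) ∈ Z) ∧ ∀ z ∈ Z, ∀ i, b.repr z (Sum.inr i) = 0 := by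
  obtain ⟨Y, hY⟩ := Z.exists_isCompl
  refine ⟨_, _, ((Module.Basis.ofVectorSpace k Z).prod (Module.Basis.ofVectorSpace k Y)).map
    (Submodule.prodEquivOfIsCompl Z Y hY), fun i => ?_, fun z hz i => ?_⟩
  · simp
  · have := Submodule.prodEquivOfIsCompl_symm_apply_left Z Y hY ⟨z, hz⟩
    change (Submodule.prodEquivOfIsCompl Z Y hY).symm z = _ at this
    rw [Module.Basis.map_repr, LinearEquiv.trans_apply, this, Module.Basis.prod_repr_inr]
    simp

/-- Cycles of degree `n` get the level `-2n`, and the remaining basis elements of degree `n` the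
level `-2n + 3`, up to a constant that makes all levels non-negative: the differential sends the
latter to cycles of degree `n - 1`, and the generators `ξ_s` send cycles to cycles. -/
lemma nonempty_adaptedBasis {deg : Fin c → ℤ} {ξ : Fin c → A} (hΛ : IsExteriorOn 𝒜 deg ξ)
    (hdeg : ∀ i, 0 < deg i) (U : DGModule 𝒜) [Module.Finite k U] :
    Nonempty (AdaptedBasis ξ U) := by
  choose I I' b hb hb' using fun n =>
    exists_basis_extending ((U.cycles n).submoduleOf (U.gr n))
  let B := U.isInternal.collectedBasis b
  have : Fintype (Σ n, I n ⊕ I' n) := FiniteDimensional.fintypeBasisIndex B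
  let off : (Σ n, I n ⊕ I' n) → ℤ := fun j => -2 * j.1 + Sum.elim (fun _ => 0) (fun _ => 3) j.2
  let M : ℕ := ∑ j, (off j).natAbs
  have hM : ∀ j, 0 ≤ M + off j := fun j => by
    have h1 : (off j).natAbs ≤ M :=
      Finset.single_le_sum (f := fun j => (off j).natAbs) (fun _ _ => Nat.zero_le _)
        (Finset.mem_univ j)
    omega
  have hBmem : ∀ j, B j ∈ U.gr j.1 := fun j => U.isInternal.collectedBasis_mem b j
  have hBZ : ∀ n i, U.d (B ⟨n, Sum.inl i⟩) = 0 := fun n i => by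
    have h1 : B ⟨n, Sum.inl i⟩ = b n (Sum.inl i) := by
      rw [U.isInternal.collectedBasis_coe]
    rw [h1]
    exact (hb n i).2
  have hne : ∀ {n : ℤ} {x : U} (_ : x ∈ U.gr n) {j}, B.repr x j ≠ 0 → j.1 = n := by
    intro n x hx j hj
    by_contra h
    exact hj (U.isInternal.collectedBasis_repr_of_mem_ne b (Ne.symm h) hx)
  have hZ : ∀ {n : ℤ} {x : U} (_ : x ∈ U.gr n) (_ : U.d x = 0) {j}, B.repr x j ≠ 0 →
      off j = -2 * n := by
    rintro n x hx hdx ⟨m, j⟩ hj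
    obtain rfl : m = n := hne hx hj
    rcases j with j | j
    · change -2 * m + 0 = _
      omega
    · refine absurd ?_ hj
      rw [U.isInternal.collectedBasis_repr_of_mem b hx]
      exact hb' m ⟨x, hx⟩ ⟨hx, hdx⟩ j
  have hle : ∀ j, off j ≤ -2 * j.1 + 3 := by
    rintro ⟨m, j | j⟩
    · change -2 * m + 0 ≤ -2 * m + 3
      omega
    · exact le_refl _
  refine ⟨⟨_, B, fun j => j.1, fun j => (M + off j).toNat, hBmem, fun i j hi => ?_,
    fun s i j hi => ?_⟩⟩
  · have h1 := hZ (U.d_mem (hBmem j)) (U.d_d _) hi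
    have h2 : off j = -2 * j.1 + 3 := by
      rcases j with ⟨m, j | j⟩
      · exact absurd (by rw [hBZ]; simp) hi
      · rfl
    have := hM i
    have := hM j
    omega
  · have hs := hdeg s
    have h1 := U.smul_mem (hΛ.mem s) (hBmem j)
    have h2 := hne h1 hi
    have h3 := hle i
    have := hM i
    have := hM j
    rcases j with ⟨m, j | j⟩
    · have h4 := hZ h1 (by rw [U.d_smul (hΛ.mem s), hBZ, smul_zero, smul_zero]) hi
      have h5 : off ⟨m, Sum.inl j⟩ = -2 * m + 0 := rfl
      simp only at h4
      omega
    · have h5 : off ⟨m, Sum.inr j⟩ = -2 * m + 3 := rfl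
      simp only at h2
      omega

namespace AdaptedBasis

variable {ξ : Fin c → A} {U : DGModule 𝒜} (W : AdaptedBasis ξ U)

lemma repr_eq_zero {n : ℤ} {u : U} (hu : u ∈ U.gr n) {j : W.J} (hj : W.degree j ≠ n) :
    W.b.repr u j = 0 := by
  classical
  have key : W.b.coord j ∘ₗ U.proj n = 0 := by
    refine W.b.ext fun i => ?_
    rw [LinearMap.comp_apply, LinearMap.zero_apply, W.b.coord_apply]
    by_cases hi : W.degree i = n
    · rw [← hi, proj_of_mem (W.mem i), W.b.repr_self, Finsupp.single_apply, if_neg]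
      rintro rfl
      exact hj hi
    · rw [proj_of_mem_ne (W.mem i) hi, map_zero, Finsupp.zero_apply]
  have := LinearMap.congr_fun key u
  rwa [LinearMap.comp_apply, proj_of_mem hu] at this

end AdaptedBasis

end AdaptedBasis

end DGModule

/-! ### Koszul differentials in a ring of operators -/

namespace KoszulOperators

lemma sum_sum_eq_zero {ι M : Type*} [AddCommGroup M] (s : Finset ι) (f : ι → ι → M)
    (h0 : ∀ i, f i i = 0) (h1 : ∀ i j, f i j = -f j i) : ∑ i ∈ s, ∑ j ∈ s, f i j = 0 := by
  classical
  induction s using Finset.induction_on with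
  | empty => simp
  | insert a s ha ih =>
    have hswap : ∑ i ∈ s, f i a = -∑ j ∈ s, f a j := by
      rw [← Finset.sum_neg_distrib]
      exact Finset.sum_congr rfl fun i _ => h1 i a
    rw [Finset.sum_insert ha, Finset.sum_insert ha, h0]
    simp_rw [Finset.sum_insert ha]
    rw [Finset.sum_add_distrib, ih, hswap]
    abel

variable {R : Type*} [Ring R] {ι : Type*} [Fintype ι]

/-- The square of a Koszul differential `e + ∑ ω_s L_s` vanishes. -/
lemma sq_eq_zero {e : R} {L ω : ι → R} (he : e * e = 0) (heL : ∀ s, e * L s = -(L s * e))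
    (hL : ∀ s, L s * L s = 0) (hLL : ∀ s t, L s * L t = -(L t * L s))
    (hωe : ∀ s, ω s * e = e * ω s) (hωL : ∀ s t, ω s * L t = L t * ω s)
    (hωω : ∀ s t, ω s * ω t = ω t * ω s) :
    (e + ∑ s, ω s * L s) * (e + ∑ s, ω s * L s) = 0 := by
  have h1 : e * ∑ s, ω s * L s = -((∑ s, ω s * L s) * e) := by
    rw [Finset.mul_sum, Finset.sum_mul, ← Finset.sum_neg_distrib]
    refine Finset.sum_congr rfl fun s _ => ?_
    rw [← mul_assoc, ← hωe, mul_assoc, heL, mul_neg, mul_assoc]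
  have h2 : (∑ s, ω s * L s) * ∑ s, ω s * L s = 0 := by
    rw [Finset.sum_mul]
    simp_rw [Finset.mul_sum]
    have h3 : ∀ s t, ω s * L s * (ω t * L t) = ω s * ω t * (L s * L t) := fun s t => by
      rw [mul_assoc, ← mul_assoc (L s), ← hωL, mul_assoc, mul_assoc]
    simp_rw [h3]
    refine sum_sum_eq_zero _ (fun s t => ω s * ω t * (L s * L t)) (fun s => ?_) fun s t => ?_
    · rw [hL, mul_zero]
    · rw [hωω, hLL, mul_neg]
  rw [add_mul, mul_add, mul_add, he, h1, h2]
  abel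

/-- The homotopy `u_j g_j`, where `g_j` is a contraction, shows that the `j`-th variable can be
eliminated. -/
lemma homotopy {e : R} {L ω : ι → R} {u g : R} (j : ι) (heg : e * g = -(g * e))
    (hLg : ∀ s, s ≠ j → L s * g = -(g * L s)) (hLgj : L j * g = 1 - g * L j)
    (hue : u * e = e * u) (huL : ∀ s, u * L s = L s * u)
    (hωu : ∀ s, s ≠ j → ω s * u = u * ω s) (hωuj : ω j * u = 1) (hωg : ∀ s, ω s * g = g * ω s) :
    (e + ∑ s, ω s * L s) * (u * g) + u * g * (e + ∑ s, ω s * L s) =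
      1 - (1 - u * ω j) * (g * L j) := by
  classical
  have h1 : e * (u * g) + u * g * e = 0 := by
    rw [← mul_assoc, ← hue, mul_assoc, heg, mul_neg, mul_assoc, neg_add_cancel]
  have h2 : (∑ s, ω s * L s) * (u * g) + u * g * ∑ s, ω s * L s =
      ∑ s, (ω s * u * (L s * g) + u * ω s * (g * L s)) := by
    rw [Finset.sum_mul, Finset.mul_sum, ← Finset.sum_add_distrib]
    refine Finset.sum_congr rfl fun s _ => ?_
    congr 1
    · rw [mul_assoc, ← mul_assoc (L s), ← huL, mul_assoc, mul_assoc]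
    · rw [mul_assoc, ← mul_assoc g, ← hωg, mul_assoc, mul_assoc]
  have h3 : ∑ s, (ω s * u * (L s * g) + u * ω s * (g * L s)) =
      1 - (1 - u * ω j) * (g * L j) := by
    rw [Finset.sum_eq_single j (fun s _ hs => ?_) (fun h => absurd (Finset.mem_univ j) h)]
    · rw [hωuj, hLgj, one_mul, sub_mul, one_mul]
      abel
    · rw [hωu s hs, hLg s hs, mul_neg, neg_add_cancel]
  rw [← h3, ← h2, add_mul, mul_add (u * g)]
  have : e * (u * g) + (∑ s, ω s * L s) * (u * g) + (u * g * e + u * g * ∑ s, ω s * L s) =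
    (e * (u * g) + u * g * e) + ((∑ s, ω s * L s) * (u * g) + u * g * ∑ s, ω s * L s) := by abel
  rw [this, h1, zero_add]

/-- Operators on `A ⊗ Γ ⊗ U` and their relations: `σ` is the sign of `A`, `Δ` the differential of `U`,
`a s` and `X s` are the actions of `ξ_s` on `A` and on `U`, and `ω s` is the division by the `s`-th
divided power variable. -/
structure Relations (σ Δ : R) (a X ω : ι → R) : Prop where
  sign_sq : σ * σ = 1
  d_sq : Δ * Δ = 0
  sign_a : ∀ s, σ * a s = -(a s * σ)
  a_sq : ∀ s, a s * a s = 0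
  a_a : ∀ s t, a s * a t = -(a t * a s)
  X_sq : ∀ s, X s * X s = 0
  X_X : ∀ s t, X s * X t = -(X t * X s)
  d_X : ∀ s, Δ * X s = -(X s * Δ)
  sign_d : σ * Δ = Δ * σ
  sign_X : ∀ s, σ * X s = X s * σ
  a_d : ∀ s, a s * Δ = Δ * a s
  a_X : ∀ s t, a s * X t = X t * a s
  down_sign : ∀ s, ω s * σ = σ * ω s
  down_d : ∀ s, ω s * Δ = Δ * ω s
  down_a : ∀ s t, ω s * a t = a t * ω s
  down_X : ∀ s t, ω s * X t = X t * ω s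
  down_down : ∀ s t, ω s * ω t = ω t * ω s

namespace Relations

variable {σ Δ : R} {a X ω : ι → R}

omit [Fintype ι] in
lemma tensorD_mul (H : Relations σ Δ a X ω) (s : ι) :
    σ * Δ * (a s - σ * X s) = -((a s - σ * X s) * (σ * Δ)) := by
  have h1 : σ * Δ * a s = -(a s * (σ * Δ)) := by
    rw [mul_assoc, ← H.a_d, ← mul_assoc, H.sign_a, neg_mul, mul_assoc]
  have h2 : σ * Δ * (σ * X s) = -(σ * X s * (σ * Δ)) := by
    rw [mul_assoc, ← mul_assoc Δ, ← H.sign_d, mul_assoc, H.d_X, mul_neg, mul_neg,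
      mul_assoc σ (X s), ← mul_assoc (X s) σ, ← H.sign_X, mul_assoc]
  rw [mul_sub, sub_mul, h1, h2]
  abel

lemma koszul_sq (H : Relations σ Δ a X ω) :
    (σ * Δ + ∑ s, ω s * (a s - σ * X s)) * (σ * Δ + ∑ s, ω s * (a s - σ * X s)) = 0 := by
  have hA : ∀ s t, a s * (σ * X t) = -(σ * X t * a s) := by
    intro s t
    rw [mul_assoc, ← H.a_X, ← mul_assoc, ← mul_assoc, H.sign_a, neg_mul, neg_neg]
  have hX : ∀ s t, σ * X s * (σ * X t) = X s * X t := by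
    intro s t
    rw [mul_assoc, ← mul_assoc (X s), ← H.sign_X, mul_assoc, ← mul_assoc, H.sign_sq, one_mul]
  refine sq_eq_zero ?_ H.tensorD_mul (fun s => ?_) (fun s t => ?_) (fun s => ?_) (fun s t => ?_)
    H.down_down
  · rw [mul_assoc, ← mul_assoc Δ, ← H.sign_d, mul_assoc, H.d_sq, mul_zero, mul_zero]
  · rw [mul_sub, sub_mul, sub_mul, hA, hX, H.a_sq, H.X_sq]
    abel
  · rw [mul_sub, sub_mul, sub_mul, mul_sub, sub_mul, sub_mul, hA, hA, hX, hX, H.a_a, H.X_X]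
    abel
  · rw [← mul_assoc, H.down_sign, mul_assoc, H.down_d, mul_assoc]
  · rw [mul_sub, sub_mul, H.down_a, ← mul_assoc, H.down_sign, mul_assoc, H.down_X, mul_assoc]

lemma koszul_homotopy {u g : R} (j : ι) (hσg : σ * g = -(g * σ))
    (hag : ∀ s, s ≠ j → a s * g = -(g * a s)) (hagj : a j * g = 1 - g * a j)
    (hΔg : g * Δ = Δ * g) (hXg : ∀ s, g * X s = X s * g) (huσ : u * σ = σ * u)
    (huΔ : u * Δ = Δ * u) (hua : ∀ s, u * a s = a s * u) (huX : ∀ s, u * X s = X s * u)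
    (hωu : ∀ s, s ≠ j → ω s * u = u * ω s) (hωuj : ω j * u = 1) (hωg : ∀ s, ω s * g = g * ω s) :
    (σ * Δ + ∑ s, ω s * (a s - σ * X s)) * (u * g) +
      u * g * (σ * Δ + ∑ s, ω s * (a s - σ * X s)) =
        1 - (1 - u * ω j) * (g * (a j - σ * X j)) := by
  have hX : ∀ s, σ * X s * g = -(g * (σ * X s)) := by
    intro s
    rw [mul_assoc, ← hXg, ← mul_assoc, hσg, neg_mul, mul_assoc]
  refine homotopy j ?_ (fun s hs => ?_) ?_ ?_ (fun s => ?_) hωu hωuj hωg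
  · rw [mul_assoc, ← hΔg, ← mul_assoc, hσg, neg_mul, mul_assoc]
  · rw [sub_mul, mul_sub, hag s hs, hX]
    abel
  · rw [sub_mul, mul_sub, hagj, hX]
    abel
  · rw [← mul_assoc, huσ, mul_assoc, huΔ, mul_assoc]
  · rw [mul_sub, sub_mul, hua, ← mul_assoc, huσ, mul_assoc, huX, mul_assoc]

end Relations

end KoszulOperators

/-! ### The Koszul resolution -/

namespace DGModule

namespace AdaptedBasis

section Operators

variable {k A : Type u} [Field k] [Ring A] [Algebra k A] {𝒜 : ℤ → Submodule k A}
  {c : ℕ} {ξ : Fin c → A} {U : DGModule 𝒜} (W : AdaptedBasis ξ U)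

/-- The module underlying the Koszul resolution of `U`: it is `A ⊗ Γ ⊗ U`, where `Γ` is the divided
power coalgebra with basis indexed by the exponents `Fin c →₀ ℕ`. -/
abbrev Koszul : Type u := ((Fin c →₀ ℕ) × W.J) →₀ A

/-- The element `a ⊗ γ^(m) ⊗ u`. -/
def tmul (m : Fin c →₀ ℕ) (a : A) : U →ₗ[k] W.Koszul :=
  W.b.constr k fun j => Finsupp.single (m, j) a

lemma tmul_basis (m : Fin c →₀ ℕ) (a : A) (j : W.J) :
    W.tmul m a (W.b j) = Finsupp.single (m, j) a := W.b.constr_basis k _ j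

lemma tmul_apply (m : Fin c →₀ ℕ) (a : A) (u : U) :
    W.tmul m a u = ∑ j, Finsupp.single (m, j) (W.b.repr u j • a) := by
  rw [tmul, Module.Basis.constr_apply_fintype]
  simp only [Finsupp.smul_single]
  rfl

variable {W} in
lemma koszul_ext {M : Type*} [AddCommGroup M] [Module k M] {f g : W.Koszul →ₗ[k] M}
    (h : ∀ m j a, f (Finsupp.single (m, j) a) = g (Finsupp.single (m, j) a)) : f = g :=
  Finsupp.lhom_ext fun t a => h t.1 t.2 a

variable {W} in
/-- Two linear maps agree on a fixed `a ⊗ γ^(m) ⊗ u` for all `u` if they do so for basis elements. -/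
lemma tmul_ext {M : Type*} [AddCommGroup M] [Module k M] {f g : U →ₗ[k] M}
    (h : ∀ j, f (W.b j) = g (W.b j)) (u : U) : f u = g u :=
  LinearMap.congr_fun (W.b.ext h) u

/-- A linear endomorphism of `A`, acting on `A ⊗ Γ ⊗ U`. -/
def coef (T : A →ₗ[k] A) : Module.End k W.Koszul := Finsupp.mapRange.linearMap T

lemma coef_single (T : A →ₗ[k] A) (t : (Fin c →₀ ℕ) × W.J) (a : A) :
    W.coef T (Finsupp.single t a) = Finsupp.single t (T a) := by
  simp [coef]

lemma coef_tmul (T : A →ₗ[k] A) (m : Fin c →₀ ℕ) (a : A) (u : U) :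
    W.coef T (W.tmul m a u) = W.tmul m (T a) u := by
  simp only [tmul_apply, map_sum, coef_single, map_smul]

/-- A linear endomorphism of `U`, acting on `A ⊗ Γ ⊗ U`. -/
def act (f : U →ₗ[k] U) : Module.End k W.Koszul :=
  Finsupp.lsum k fun t => ∑ i, W.b.repr (f (W.b t.2)) i • Finsupp.lsingle (t.1, i)

lemma act_single (f : U →ₗ[k] U) (m : Fin c →₀ ℕ) (j : W.J) (a : A) :
    W.act f (Finsupp.single (m, j) a) = W.tmul m a (f (W.b j)) := by
  simp [act, tmul_apply]

lemma act_tmul (f : U →ₗ[k] U) (m : Fin c →₀ ℕ) (a : A) (u : U) :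
    W.act f (W.tmul m a u) = W.tmul m a (f u) := by
  refine tmul_ext (W := W) (f := W.act f ∘ₗ W.tmul m a) (g := W.tmul m a ∘ₗ f) (fun j => ?_) u
  rw [LinearMap.comp_apply, LinearMap.comp_apply, tmul_basis, act_single]

/-- Division by the `s`-th divided power variable. -/
def down (s : Fin c) : Module.End k W.Koszul :=
  Finsupp.lsum k fun t =>
    if t.1 s = 0 then 0 else Finsupp.lsingle (t.1 - Finsupp.single s 1, t.2)

lemma down_single (s : Fin c) (m : Fin c →₀ ℕ) (j : W.J) (a : A) :
    W.down s (Finsupp.single (m, j) a) =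
      if m s = 0 then 0 else Finsupp.single (m - Finsupp.single s 1, j) a := by
  rw [down, Finsupp.lsum_single]
  split_ifs <;> simp

lemma down_tmul (s : Fin c) (m : Fin c →₀ ℕ) (a : A) (u : U) :
    W.down s (W.tmul m a u) = if m s = 0 then 0 else W.tmul (m - Finsupp.single s 1) a u := by
  simp only [tmul_apply, map_sum, down_single]
  split_ifs <;> simp

/-- Multiplication by the `s`-th divided power variable, without a coefficient. -/
def up (s : Fin c) : Module.End k W.Koszul :=
  Finsupp.lsum k fun t => Finsupp.lsingle (t.1 + Finsupp.single s 1, t.2)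

lemma up_single (s : Fin c) (m : Fin c →₀ ℕ) (j : W.J) (a : A) :
    W.up s (Finsupp.single (m, j) a) = Finsupp.single (m + Finsupp.single s 1, j) a := by
  simp [up]

lemma up_tmul (s : Fin c) (m : Fin c →₀ ℕ) (a : A) (u : U) :
    W.up s (W.tmul m a u) = W.tmul (m + Finsupp.single s 1) a u := by
  simp only [tmul_apply, map_sum, up_single]

lemma coef_mul (S T : A →ₗ[k] A) : W.coef S * W.coef T = W.coef (S ∘ₗ T) :=
  koszul_ext fun m j a => by
    rw [Module.End.mul_apply, coef_single, coef_single, coef_single, LinearMap.comp_apply]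

lemma coef_id : W.coef LinearMap.id = 1 :=
  koszul_ext fun m j a => by rw [coef_single]; rfl

lemma coef_neg (T : A →ₗ[k] A) : W.coef (-T) = -W.coef T :=
  koszul_ext fun m j a => by
    rw [LinearMap.neg_apply, coef_single, coef_single, LinearMap.neg_apply, Finsupp.single_neg]

lemma coef_sub (S T : A →ₗ[k] A) : W.coef (S - T) = W.coef S - W.coef T :=
  koszul_ext fun m j a => by
    rw [LinearMap.sub_apply, coef_single, coef_single, coef_single, LinearMap.sub_apply,
      Finsupp.single_sub]

lemma coef_zero : W.coef 0 = 0 :=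
  koszul_ext fun m j a => by rw [coef_single, LinearMap.zero_apply, Finsupp.single_zero]; rfl

lemma act_mul (f g : U →ₗ[k] U) : W.act f * W.act g = W.act (f ∘ₗ g) :=
  koszul_ext fun m j a => by
    rw [Module.End.mul_apply, act_single, act_tmul, act_single, LinearMap.comp_apply]

lemma act_neg (f : U →ₗ[k] U) : W.act (-f) = -W.act f :=
  koszul_ext fun m j a => by
    rw [LinearMap.neg_apply, act_single, act_single, LinearMap.neg_apply, map_neg]

lemma act_zero : W.act 0 = 0 :=
  koszul_ext fun m j a => by rw [act_single, LinearMap.zero_apply, map_zero]; rfl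

lemma coef_act (T : A →ₗ[k] A) (f : U →ₗ[k] U) : W.coef T * W.act f = W.act f * W.coef T :=
  koszul_ext fun m j a => by
    rw [Module.End.mul_apply, Module.End.mul_apply, act_single, coef_tmul, coef_single, act_single]

lemma down_coef (s : Fin c) (T : A →ₗ[k] A) : W.down s * W.coef T = W.coef T * W.down s :=
  koszul_ext fun m j a => by
    rw [Module.End.mul_apply, Module.End.mul_apply, coef_single, down_single, down_single]
    split_ifs
    · rw [map_zero]
    · rw [coef_single]

lemma down_act (s : Fin c) (f : U →ₗ[k] U) : W.down s * W.act f = W.act f * W.down s :=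
  koszul_ext fun m j a => by
    rw [Module.End.mul_apply, Module.End.mul_apply, act_single, down_tmul, down_single]
    split_ifs
    · rw [map_zero]
    · rw [act_single]

lemma up_coef (s : Fin c) (T : A →ₗ[k] A) : W.up s * W.coef T = W.coef T * W.up s :=
  koszul_ext fun m j a => by
    rw [Module.End.mul_apply, Module.End.mul_apply, coef_single, up_single, up_single, coef_single]

lemma up_act (s : Fin c) (f : U →ₗ[k] U) : W.up s * W.act f = W.act f * W.up s :=
  koszul_ext fun m j a => by
    rw [Module.End.mul_apply, Module.End.mul_apply, act_single, up_tmul, up_single, act_single]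

lemma down_down (s t : Fin c) : W.down s * W.down t = W.down t * W.down s :=
  koszul_ext fun m j a => by
    by_cases hst : s = t
    · rw [hst]
    · have h1 : (m - Finsupp.single t 1 : Fin c →₀ ℕ) s = m s := by simp [Ne.symm hst]
      have h2 : (m - Finsupp.single s 1 : Fin c →₀ ℕ) t = m t := by simp [hst]
      rw [Module.End.mul_apply, Module.End.mul_apply, down_single, down_single]
      by_cases hs : m s = 0 <;> by_cases ht : m t = 0 <;>
        simp [hs, ht, h1, h2, down_single, tsub_right_comm]

lemma down_up_of_ne {s t : Fin c} (hst : s ≠ t) : W.down s * W.up t = W.up t * W.down s :=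
  koszul_ext fun m j a => by
    have h1 : (m + Finsupp.single t 1 : Fin c →₀ ℕ) s = m s := by simp [Ne.symm hst]
    rw [Module.End.mul_apply, Module.End.mul_apply, up_single, down_single, down_single, h1]
    split_ifs with hs
    · rw [map_zero]
    · rw [up_single]
      congr 2
      refine tsub_add_eq_add_tsub ?_ |>.symm
      rw [Finsupp.single_le_iff]
      omega

lemma down_up_self (s : Fin c) : W.down s * W.up s = 1 :=
  koszul_ext fun m j a => by
    rw [Module.End.mul_apply, up_single, down_single, if_neg (by simp), add_tsub_cancel_right]
    rfl

lemma up_down_single (s : Fin c) (m : Fin c →₀ ℕ) (j : W.J) (a : A) :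
    W.up s (W.down s (Finsupp.single (m, j) a)) =
      if m s = 0 then 0 else Finsupp.single (m, j) a := by
  rw [down_single]
  split_ifs with hs
  · rw [map_zero]
  · rw [up_single, tsub_add_cancel_of_le]
    rw [Finsupp.single_le_iff]
    omega

end Operators

section Graded

variable {k A : Type u} [Field k] [Ring A] [Algebra k A] {𝒜 : ℤ → Submodule k A}
  [GradedAlgebra 𝒜] {c : ℕ} {deg : Fin c → ℤ} {ξ : Fin c → A} {U : DGModule 𝒜}
  (h : IsExteriorOn 𝒜 deg ξ) (W : AdaptedBasis ξ U)

/-- The action of `ξ_s` on `U`. -/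
def gen (ξ : Fin c → A) (U : DGModule 𝒜) (s : Fin c) : U →ₗ[k] U :=
  Module.toModuleEnd k (S := A) U (ξ s)

omit [GradedAlgebra 𝒜] in
lemma gen_apply (s : Fin c) (u : U) : gen ξ U s u = ξ s • u := rfl

/-- The differential of the Koszul resolution: the tensor product differential, plus the sum over
`s` of the difference of the actions of `ξ_s` on `A` and on `U`, combined with division by the
`s`-th divided power variable. -/
def koszulD : Module.End k W.Koszul :=
  W.coef (signMap 𝒜) * W.act U.d + ∑ s, W.down s *
    (W.coef (LinearMap.mulLeft k (ξ s)) - W.coef (signMap 𝒜) * W.act (gen ξ U s))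

lemma koszulD_tmul (m : Fin c →₀ ℕ) (a : A) (u : U) :
    W.koszulD (W.tmul m a u) = W.tmul m (signMap 𝒜 a) (U.d u) +
      ∑ s, if m s = 0 then 0 else W.tmul (m - Finsupp.single s 1) (ξ s * a) u -
        W.tmul (m - Finsupp.single s 1) (signMap 𝒜 a) (ξ s • u) := by
  simp only [koszulD, LinearMap.add_apply, LinearMap.sum_apply, Module.End.mul_apply,
    LinearMap.sub_apply, act_tmul, coef_tmul, map_sub, down_tmul, LinearMap.mulLeft_apply,
    gen_apply]
  congr 1
  refine Finset.sum_congr rfl fun s _ => ?_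
  split_ifs <;> simp

section Relations

variable (hdeg : ∀ i, Odd (deg i))

include h hdeg

lemma koszulRelations : KoszulOperators.Relations (R := Module.End k W.Koszul)
    (W.coef (signMap 𝒜)) (W.act U.d) (fun s => W.coef (LinearMap.mulLeft k (ξ s)))
    (fun s => W.act (gen ξ U s)) W.down where
  sign_sq := by
    rw [coef_mul, ← coef_id]
    exact congrArg _ (LinearMap.ext fun a => IsExteriorOn.signMap_signMap a)
  d_sq := by
    rw [act_mul, ← act_zero]
    exact congrArg _ (LinearMap.ext U.d_d)
  sign_a s := by
    refine (W.coef_mul _ _).trans ((congrArg W.coef (LinearMap.ext fun a => ?_)).trans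
      ((W.coef_neg _).trans (congrArg Neg.neg (W.coef_mul _ _).symm)))
    exact h.signMap_gen_mul hdeg s a
  a_sq s := by
    rw [coef_mul, ← coef_zero]
    refine congrArg _ (LinearMap.ext fun a => ?_)
    change ξ s * (ξ s * a) = 0
    rw [← mul_assoc, h.gen_mul_self, zero_mul]
  a_a s t := by
    refine (W.coef_mul _ _).trans ((congrArg W.coef (LinearMap.ext fun a => ?_)).trans
      ((W.coef_neg _).trans (congrArg Neg.neg (W.coef_mul _ _).symm)))
    change ξ s * (ξ t * a) = -(ξ t * (ξ s * a))
    rw [← mul_assoc, h.gen_mul_gen, neg_mul, mul_assoc]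
  X_sq s := by
    rw [act_mul, ← act_zero]
    refine congrArg _ (LinearMap.ext fun u => ?_)
    change ξ s • ξ s • u = 0
    rw [smul_smul, h.gen_mul_self, zero_smul]
  X_X s t := by
    refine (W.act_mul _ _).trans ((congrArg W.act (LinearMap.ext fun u => ?_)).trans
      ((W.act_neg _).trans (congrArg Neg.neg (W.act_mul _ _).symm)))
    change ξ s • ξ t • u = -(ξ t • ξ s • u)
    rw [smul_smul, h.gen_mul_gen, neg_smul, mul_smul]
  d_X s := by
    refine (W.act_mul _ _).trans ((congrArg W.act (LinearMap.ext fun u => ?_)).trans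
      ((W.act_neg _).trans (congrArg Neg.neg (W.act_mul _ _).symm)))
    change U.d (ξ s • u) = -(ξ s • U.d u)
    rw [U.d_smul (h.mem s), Int.negOnePow_odd _ (hdeg s), Units.neg_smul, one_smul]
  sign_d := W.coef_act _ _
  sign_X s := W.coef_act _ _
  a_d s := W.coef_act _ _
  a_X s t := W.coef_act _ _
  down_sign s := W.down_coef _ _
  down_d s := W.down_act _ _
  down_a s t := W.down_coef _ _
  down_X s t := W.down_act _ _
  down_down := W.down_down

lemma koszulD_sq : W.koszulD * W.koszulD = 0 := (W.koszulRelations h hdeg).koszul_sq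

/-- The homotopy that eliminates the `j`-th variable from the Koszul resolution. -/
lemma koszulD_homotopy (j : Fin c) :
    W.koszulD * (W.up j * W.coef (h.contraction j)) +
      W.up j * W.coef (h.contraction j) * W.koszulD =
    1 - (1 - W.up j * W.down j) * (W.coef (h.contraction j) *
      (W.coef (LinearMap.mulLeft k (ξ j)) - W.coef (signMap 𝒜) * W.act (gen ξ U j))) := by
  refine KoszulOperators.Relations.koszul_homotopy (R := Module.End k W.Koszul)
    (σ := W.coef (signMap 𝒜)) (Δ := W.act U.d) (a := fun s => W.coef (LinearMap.mulLeft k (ξ s)))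
    (X := fun s => W.act (gen ξ U s)) (ω := W.down) j ?_ (fun s hs => ?_) ?_ (W.coef_act _ _)
    (fun s => W.coef_act _ _) (W.up_coef _ _) (W.up_act _ _) (fun s => W.up_coef _ _)
    (fun s => W.up_act _ _) (fun s hs => W.down_up_of_ne hs) (W.down_up_self j)
    (fun s => W.down_coef s _)
  · refine (W.coef_mul _ _).trans ((congrArg W.coef (LinearMap.ext fun a => ?_)).trans
      ((W.coef_neg _).trans (congrArg Neg.neg (W.coef_mul _ _).symm)))
    exact h.signMap_contraction hdeg j a
  · refine (W.coef_mul _ _).trans ((congrArg W.coef (LinearMap.ext fun a => ?_)).trans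
      ((W.coef_neg _).trans (congrArg Neg.neg (W.coef_mul _ _).symm)))
    change ξ s * h.contraction j a = -h.contraction j (ξ s * a)
    rw [h.contraction_gen_mul, if_neg hs, zero_sub, neg_neg]
  · refine (W.coef_mul _ _).trans ((congrArg W.coef (LinearMap.ext fun a => ?_)).trans
      ((W.coef_sub LinearMap.id _).trans (congrArg₂ HSub.hSub W.coef_id (W.coef_mul _ _).symm)))
    change ξ j * h.contraction j a = a - h.contraction j (ξ j * a)
    rw [h.contraction_gen_mul, if_pos rfl, sub_sub_cancel]

end Relations

end Graded

end AdaptedBasis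

end DGModule

namespace DGModule

namespace AdaptedBasis

section Resolution

variable {k A : Type u} [Field k] [Ring A] [Algebra k A] {𝒜 : ℤ → Submodule k A}
  [GradedAlgebra 𝒜] {c : ℕ} {deg : Fin c → ℤ} {ξ : Fin c → A} {U : DGModule 𝒜}
  (W : AdaptedBasis ξ U)

/-- The (even) degrees `deg i + 1` of the polynomial variables dual to the exterior ones. -/
def wt (deg : Fin c → ℤ) : Fin c → ℤ := fun i => deg i + 1

/-- The degree of the basis element `γ^(m) ⊗ b_j`. -/
def koszulDeg (deg : Fin c → ℤ) (t : (Fin c →₀ ℕ) × W.J) : ℤ :=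
  Finsupp.weight (wt deg) t.1 + W.degree t.2

/-- The components of the Koszul resolution. -/
def koszulGr (deg : Fin c → ℤ) (n : ℤ) : Submodule k W.Koszul where
  carrier := {p | ∀ t, p t ∈ 𝒜 (n - W.koszulDeg deg t)}
  add_mem' hp hq t := (𝒜 _).add_mem (hp t) (hq t)
  zero_mem' _ := (𝒜 _).zero_mem
  smul_mem' r _ hp t := (𝒜 _).smul_mem r (hp t)

omit [GradedAlgebra 𝒜] in
lemma single_mem_koszulGr {t : (Fin c →₀ ℕ) × W.J} {i n : ℤ} {a : A} (ha : a ∈ 𝒜 i)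
    (hn : i + W.koszulDeg deg t = n) : Finsupp.single t a ∈ W.koszulGr deg n := by
  classical
  intro s
  by_cases hs : t = s
  · subst hs
    rw [Finsupp.single_eq_same]
    rwa [← hn, add_sub_cancel_right]
  · rw [Finsupp.single_eq_of_ne (Ne.symm hs)]
    exact zero_mem _

omit [GradedAlgebra 𝒜] in
lemma tmul_mem_koszulGr {m : Fin c →₀ ℕ} {i l n : ℤ} {a : A} {u : U} (ha : a ∈ 𝒜 i)
    (hu : u ∈ U.gr l) (hn : i + Finsupp.weight (wt deg) m + l = n) :
    W.tmul m a u ∈ W.koszulGr deg n := by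
  rw [tmul_apply]
  refine Submodule.sum_mem _ fun j _ => ?_
  by_cases hj : W.degree j = l
  · refine W.single_mem_koszulGr ((𝒜 i).smul_mem _ ha) ?_
    rw [koszulDeg, hj, ← hn, add_assoc]
  · rw [W.repr_eq_zero hu hj, zero_smul, Finsupp.single_zero]
    exact zero_mem _

omit [GradedAlgebra 𝒜] in
lemma map_mem_koszulGr {T : W.Koszul →ₗ[k] W.Koszul} {e : ℤ}
    (hT : ∀ m j i, ∀ a ∈ 𝒜 i,
      T (Finsupp.single (m, j) a) ∈ W.koszulGr deg (i + W.koszulDeg deg (m, j) + e))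
    {n : ℤ} {p : W.Koszul} (hp : p ∈ W.koszulGr deg n) : T p ∈ W.koszulGr deg (n + e) := by
  rw [← Finsupp.sum_single p, Finsupp.sum, map_sum]
  refine Submodule.sum_mem _ fun t _ => ?_
  have := hT t.1 t.2 _ _ (hp t)
  rwa [sub_add_cancel] at this

lemma koszulGr_isInternal : DirectSum.IsInternal (W.koszulGr deg) := by
  classical
  rw [DirectSum.isInternal_submodule_iff_iSupIndep_and_iSup_eq_top]
  constructor
  · rw [iSupIndep_def]
    intro n
    rw [Submodule.disjoint_def]
    intro p hp hq
    ext t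
    have hi := (DirectSum.Decomposition.isInternal 𝒜).submodule_iSupIndep (n - W.koszulDeg deg t)
    refine (Submodule.disjoint_def.mp hi) (p t) (hp t) ?_
    have hle : (⨆ j, ⨆ (_ : j ≠ n), W.koszulGr deg j) ≤
        (⨆ j, ⨆ (_ : j ≠ n - W.koszulDeg deg t), 𝒜 j).comap (Finsupp.lapply (R := k) t) := by
      refine iSup₂_le fun j hj q hq => ?_
      have h1 : j - W.koszulDeg deg t ≠ n - W.koszulDeg deg t := by omega
      exact (le_iSup₂ (f := fun j (_ : j ≠ n - W.koszulDeg deg t) => 𝒜 j) _ h1) (hq t)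
    exact hle hq
  · rw [eq_top_iff]
    rintro p -
    induction p using Finsupp.induction_linear with
    | zero => exact Submodule.zero_mem _
    | add p q hp hq => exact Submodule.add_mem _ hp hq
    | single t a =>
      induction a using DirectSum.Decomposition.inductionOn 𝒜 with
      | zero => simp
      | @homogeneous j m => exact Submodule.mem_iSup_of_mem _ (W.single_mem_koszulGr m.2 rfl)
      | add x y hx hy => rw [Finsupp.single_add]; exact Submodule.add_mem _ hx hy

lemma weight_sub_single {m : Fin c →₀ ℕ} {s : Fin c} (hs : m s ≠ 0) :
    Finsupp.weight (wt deg) (m - Finsupp.single s 1) = Finsupp.weight (wt deg) m - deg s - 1 := by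
  have h1 : m = (m - Finsupp.single s 1) + Finsupp.single s 1 := by
    rw [tsub_add_cancel_of_le]
    rw [Finsupp.single_le_iff]
    omega
  conv_rhs => rw [h1]
  rw [map_add, Finsupp.weight_single, one_smul, wt]
  ring

lemma koszulD_mem (h : IsExteriorOn 𝒜 deg ξ) {n : ℤ} {p : W.Koszul} (hp : p ∈ W.koszulGr deg n) :
    W.koszulD p ∈ W.koszulGr deg (n - 1) := by
  refine W.map_mem_koszulGr (T := W.koszulD) (e := -1) (fun m j i a ha => ?_) hp
  rw [← tmul_basis, koszulD_tmul]
  refine (W.koszulGr deg _).add_mem ?_ (Submodule.sum_mem _ fun s _ => ?_)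
  · refine W.tmul_mem_koszulGr (signMap_mem ha) (U.d_mem (W.mem j)) ?_
    rw [koszulDeg]
    ring
  · split_ifs with hs
    · exact zero_mem _
    · refine (W.koszulGr deg _).sub_mem (W.tmul_mem_koszulGr (SetLike.mul_mem_graded (h.mem s) ha)
        (W.mem j) ?_) (W.tmul_mem_koszulGr (signMap_mem ha) (U.smul_mem (h.mem s) (W.mem j)) ?_)
      · rw [weight_sub_single hs, koszulDeg]
        ring
      · rw [weight_sub_single hs, koszulDeg]
        ring

omit [GradedAlgebra 𝒜] in
lemma smul_tmul (a b : A) (m : Fin c →₀ ℕ) (u : U) :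
    a • W.tmul m b u = W.tmul m (a * b) u := by
  simp only [tmul_apply, Finset.smul_sum, Finsupp.smul_single, smul_eq_mul, mul_smul_comm]

lemma koszulD_smul (h : IsExteriorOn 𝒜 deg ξ) (hdeg : ∀ i, Odd (deg i)) {i : ℤ} {a : A}
    (ha : a ∈ 𝒜 i) (p : W.Koszul) :
    W.koszulD (a • p) = i.negOnePow • (a • W.koszulD p) := by
  induction p using Finsupp.induction_linear with
  | zero => simp
  | add p q hp hq => simp only [smul_add, map_add, hp, hq]
  | single t b =>
    obtain ⟨m, j⟩ := t
    have h1 : ∀ s, ξ s * (a * b) = (i.negOnePow : ℤ) • (a * (ξ s * b)) := fun s => by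
      rw [← mul_assoc, h.gen_mul hdeg, signMap_of_mem ha, Units.smul_def, smul_mul_assoc,
        smul_mul_assoc, mul_assoc]
    have h2 : ∀ (m : Fin c →₀ ℕ) (r : ℤ) (b : A) (u : U), W.tmul m (r • b) u = r • W.tmul m b u :=
      fun m r b u => by
        simp only [tmul_apply, Finset.smul_sum, smul_comm _ r, Finsupp.smul_single]
    rw [← tmul_basis, smul_tmul, koszulD_tmul, koszulD_tmul, signMap_mul ha]
    simp only [Units.smul_def, smul_add, Finset.smul_sum, h1, h2, smul_tmul]
    congr 1
    refine Finset.sum_congr rfl fun s _ => ?_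
    split_ifs
    · simp
    · rw [smul_sub, smul_sub, smul_tmul, smul_tmul]

/-- The Koszul resolution of `U`, as a DG module. -/
def koszul (h : IsExteriorOn 𝒜 deg ξ) (hdeg : ∀ i, Odd (deg i)) : DGModule 𝒜 where
  carrier := W.Koszul
  gr := W.koszulGr deg
  isInternal := W.koszulGr_isInternal
  smul_mem {i j a p} ha hp t := by
    have := SetLike.mul_mem_graded ha (hp t)
    rwa [← add_sub_assoc] at this
  d := W.koszulD
  d_mem := W.koszulD_mem h
  d_d u := LinearMap.congr_fun (W.koszulD_sq h hdeg) u
  d_smul := W.koszulD_smul h hdeg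

/-- The basis of the Koszul resolution over `A`. -/
def koszulBasis (h : IsExteriorOn 𝒜 deg ξ) (hdeg : ∀ i, Odd (deg i)) :
    Module.Basis ((Fin c →₀ ℕ) × W.J) A (W.koszul h hdeg) := Finsupp.basisSingleOne

lemma koszulBasis_apply (h : IsExteriorOn 𝒜 deg ξ) (hdeg : ∀ i, Odd (deg i))
    (m : Fin c →₀ ℕ) (j : W.J) : W.koszulBasis h hdeg (m, j) = W.tmul m 1 (W.b j) := by
  rw [tmul_basis]
  exact congrFun Finsupp.coe_basisSingleOne (m, j)

lemma koszulBasis_mem (h : IsExteriorOn 𝒜 deg ξ) (hdeg : ∀ i, Odd (deg i))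
    (t : (Fin c →₀ ℕ) × W.J) :
    W.koszulBasis h hdeg t ∈ (W.koszul h hdeg).gr (W.koszulDeg deg t) := by
  obtain ⟨m, j⟩ := t
  rw [koszulBasis_apply, tmul_basis]
  exact W.single_mem_koszulGr (SetLike.GradedOne.one_mem (A := 𝒜)) (zero_add _)

/-- The Koszul resolution is semifree because its basis has degrees bounded below and `A` is
non-negatively graded: the degree can serve as the level. -/
lemma koszul_isSemifree (h : IsExteriorOn 𝒜 deg ξ) (hdeg : ∀ i, 0 < deg i ∧ Odd (deg i)) :
    (W.koszul h fun i => (hdeg i).2).IsSemifree := by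
  let M : ℕ := ∑ j, (W.degree j).natAbs
  have hM : ∀ t, 0 ≤ M + W.koszulDeg deg t := fun t => by
    have h1 : (W.degree t.2).natAbs ≤ M :=
      Finset.single_le_sum (f := fun j => (W.degree j).natAbs) (fun _ _ => Nat.zero_le _)
        (Finset.mem_univ t.2)
    have h2 : 0 ≤ Finsupp.weight (wt deg) t.1 := by
      rw [Finsupp.weight_eq_sum]
      refine Finset.sum_nonneg fun s _ => nsmul_nonneg ?_ _
      have := (hdeg s).1
      rw [wt]
      omega
    rw [koszulDeg]
    omega
  refine ⟨_, W.koszulBasis h fun i => (hdeg i).2, W.koszulDeg deg,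
    fun t => (M + W.koszulDeg deg t).toNat, fun t => ⟨W.koszulBasis_mem _ _ t, ?_⟩⟩
  have hd := (W.koszul h fun i => (hdeg i).2).d_mem (W.koszulBasis_mem h (fun i => (hdeg i).2) t)
  rw [← (W.koszulBasis h fun i => (hdeg i).2).linearCombination_repr
    ((W.koszul h fun i => (hdeg i).2).d (W.koszulBasis h (fun i => (hdeg i).2) t)),
    Finsupp.linearCombination_apply, Finsupp.sum]
  refine Submodule.sum_mem _ fun t' ht' => Submodule.smul_mem _ _ (Submodule.subset_span
    ⟨t', ?_, rfl⟩)
  rw [Finsupp.mem_support_iff] at ht'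
  have h1 : 0 ≤ W.koszulDeg deg t - 1 - W.koszulDeg deg t' := by
    by_contra hneg
    exact ht' (h.eq_zero_of_neg (fun i => (hdeg i).1) (by omega) (hd t'))
  have h2 := hM t
  have h3 := hM t'
  change (M + W.koszulDeg deg t').toNat < (M + W.koszulDeg deg t).toNat
  omega

/-- The augmentation of the Koszul resolution. -/
def koszulPi : W.Koszul →ₗ[A] U :=
  Finsupp.linearCombination A fun t => if t.1 = 0 then W.b t.2 else 0

omit [GradedAlgebra 𝒜] in
lemma koszulPi_tmul (m : Fin c →₀ ℕ) (a : A) (u : U) :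
    W.koszulPi (W.tmul m a u) = if m = 0 then a • u else 0 := by
  simp only [tmul_apply, map_sum, koszulPi, Finsupp.linearCombination_single]
  split_ifs with hm
  · simp only [smul_assoc]
    conv_rhs => rw [← W.b.sum_repr u, Finset.smul_sum]
    refine Finset.sum_congr rfl fun j _ => ?_
    have h : W.b.repr u j • a • W.b j = a • W.b.repr u j • W.b j := by
      rw [← algebraMap_smul A (W.b.repr u j) (a • W.b j),
        ← algebraMap_smul A (W.b.repr u j) (W.b j), smul_smul, smul_smul, Algebra.commutes]
    exact h
  · simp

/-- The augmentation of the Koszul resolution, as a morphism of DG modules. -/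
def koszulHom (h : IsExteriorOn 𝒜 deg ξ) (hdeg : ∀ i, Odd (deg i)) :
    Hom (W.koszul h hdeg) U where
  toFun := W.koszulPi
  map_mem {n p} hp := by
    have hp' : p ∈ W.koszulGr deg n := hp
    change W.koszulPi p ∈ _
    rw [← Finsupp.sum_single (show W.Koszul from p), Finsupp.sum, map_sum]
    refine Submodule.sum_mem _ fun t _ => ?_
    obtain ⟨m, j⟩ := t
    rw [← tmul_basis, koszulPi_tmul]
    split_ifs with hm
    · have h1 := U.smul_mem (hp' (m, j)) (W.mem j)
      have h2 : W.koszulDeg deg (m, j) = W.degree j := by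
        rw [koszulDeg, hm, map_zero, zero_add]
      rwa [h2, sub_add_cancel] at h1
    · exact zero_mem _
  map_d p := by
    change W.koszulPi (W.koszulD p) = U.d (W.koszulPi p)
    refine LinearMap.congr_fun (f := (W.koszulPi.restrictScalars k) ∘ₗ W.koszulD)
      (g := U.d ∘ₗ W.koszulPi.restrictScalars k) (koszul_ext fun m j a => ?_) p
    change W.koszulPi (W.koszulD (Finsupp.single (m, j) a)) =
      U.d (W.koszulPi (Finsupp.single (m, j) a))
    have hds : U.d (a • W.b j) = signMap 𝒜 a • U.d (W.b j) := by
      induction a using DirectSum.Decomposition.inductionOn 𝒜 with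
      | zero => simp
      | @homogeneous i a =>
        rw [U.d_smul a.2, signMap_of_mem a.2, Units.smul_def, Units.smul_def, smul_assoc]
      | add x y hx hy => rw [add_smul, map_add, hx, hy, map_add, add_smul]
    rw [← tmul_basis, koszulD_tmul, map_add, map_sum, koszulPi_tmul, koszulPi_tmul,
      Finset.sum_eq_zero fun s _ => ?_]
    · split_ifs
      · rw [add_zero, hds]
      · rw [map_zero, add_zero]
    · split_ifs with hs
      · rw [map_zero]
      · rw [map_sub, koszulPi_tmul, koszulPi_tmul]
        split_ifs with hm
        · rw [smul_smul, h.gen_mul hdeg, sub_self]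
        · rw [sub_self]

/-- The augmentation of the Koszul resolution is a quasi-isomorphism: the homotopies for the single
variables successively move a cycle into the subspace `1 ⊗ 1 ⊗ U`. -/
lemma koszulHom_isQuasiIso (h : IsExteriorOn 𝒜 deg ξ) (hdeg : ∀ i, Odd (deg i)) :
    (W.koszulHom h hdeg).IsQuasiIso := by
  classical
  have hι : ∀ u : U, W.koszulD (W.tmul 0 1 u) = W.tmul 0 1 (U.d u) := fun u => by
    rw [koszulD_tmul, signMap_one, Finset.sum_eq_zero (fun s _ => ?_), add_zero]
    exact if_pos rfl
  have hπι : ∀ u : U, W.koszulPi (W.tmul 0 1 u) = u := fun u => by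
    rw [koszulPi_tmul, if_pos rfl, one_smul]
  let g : Fin c → Module.End k W.Koszul := fun j => W.coef (h.contraction j)
  let P : Fin c → Module.End k W.Koszul := fun j => 1 - W.up j * W.down j
  let L : Fin c → Module.End k W.Koszul := fun j =>
    W.coef (LinearMap.mulLeft k (ξ j)) - W.coef (signMap 𝒜) * W.act (gen ξ U j)
  have hgg : ∀ i j z, g i (g j z) = -g j (g i z) := fun i j z => by
    have : g i * g j = -(g j * g i) := (W.coef_mul _ _).trans
      ((congrArg W.coef (LinearMap.ext fun a => h.contraction_contraction i j a)).trans
        ((W.coef_neg _).trans (congrArg Neg.neg (W.coef_mul _ _).symm)))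
    exact LinearMap.congr_fun this z
  have hg2 : ∀ i z, g i (g i z) = 0 := fun i z => by
    have : g i * g i = 0 := (W.coef_mul _ _).trans
      ((congrArg W.coef (LinearMap.ext fun a => h.contraction_self i a)).trans W.coef_zero)
    exact LinearMap.congr_fun this z
  have hgP : ∀ i j z, g i (P j z) = P j (g i z) := fun i j z => by
    have h1 := LinearMap.congr_fun (W.up_coef j (h.contraction i)) (W.down j z)
    have h2 := LinearMap.congr_fun (W.down_coef j (h.contraction i)) z
    change g i (z - W.up j (W.down j z)) = g i z - W.up j (W.down j (g i z))
    rw [map_sub]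
    congr 1
    exact h1.symm.trans (congrArg (W.up j) h2.symm)
  have hPs : ∀ j m i a, P j (Finsupp.single (m, i) a) =
      if m j = 0 then Finsupp.single (m, i) a else 0 := fun j m i a => by
    change Finsupp.single (m, i) a - W.up j (W.down j (Finsupp.single (m, i) a)) = _
    rw [up_down_single]
    split_ifs
    · rw [sub_zero]
    · rw [sub_self]
  have hPP : ∀ i j z, P i (P j z) = P j (P i z) := fun i j z => by
    refine LinearMap.congr_fun (f := P i * P j) (g := P j * P i) (koszul_ext fun m l a => ?_) z
    rw [Module.End.mul_apply, Module.End.mul_apply, hPs, hPs]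
    split_ifs <;> simp [*]
  have hPP' : ∀ i z, P i (P i z) = P i z := fun i z => by
    refine LinearMap.congr_fun (f := P i * P i) (g := P i) (koszul_ext fun m l a => ?_) z
    rw [Module.End.mul_apply, hPs]
    split_ifs <;> simp [*]
  have hPL : ∀ i j z, P i (L j z) = L j (P i z) := fun i j z => by
    have hc : ∀ T : A →ₗ[k] A, ∀ z, P i (W.coef T z) = W.coef T (P i z) := fun T z => by
      refine LinearMap.congr_fun (f := P i * W.coef T) (g := W.coef T * P i)
        (koszul_ext fun m l a => ?_) z
      rw [Module.End.mul_apply, Module.End.mul_apply, coef_single, hPs, hPs]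
      split_ifs
      · rw [coef_single]
      · rw [map_zero]
    have hPt : ∀ m a u, P i (W.tmul m a u) = if m i = 0 then W.tmul m a u else 0 := fun m a u => by
      simp only [tmul_apply, map_sum, hPs]
      split_ifs <;> simp
    have ha : ∀ f : U →ₗ[k] U, ∀ z, P i (W.act f z) = W.act f (P i z) := fun f z => by
      refine LinearMap.congr_fun (f := P i * W.act f) (g := W.act f * P i)
        (koszul_ext fun m l a => ?_) z
      rw [Module.End.mul_apply, Module.End.mul_apply, act_single, hPt, hPs]
      split_ifs
      · rw [act_single]
      · rw [map_zero]
    change P i (W.coef _ z - W.coef _ (W.act _ z)) = W.coef _ (P i z) - W.coef _ (W.act _ (P i z))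
    rw [map_sub, hc, hc, ha]
  have hgL : ∀ i j z, i ≠ j → g i (L j z) = -L j (g i z) := fun i j z hij => by
    have h1 : ∀ z, g i (W.coef (LinearMap.mulLeft k (ξ j)) z) =
        -W.coef (LinearMap.mulLeft k (ξ j)) (g i z) := fun z => by
      have : g i * W.coef (LinearMap.mulLeft k (ξ j)) =
          -(W.coef (LinearMap.mulLeft k (ξ j)) * g i) := by
        refine (W.coef_mul _ _).trans ((congrArg W.coef (LinearMap.ext fun a => ?_)).trans
          ((W.coef_neg _).trans (congrArg Neg.neg (W.coef_mul _ _).symm)))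
        change h.contraction i (ξ j * a) = -(ξ j * h.contraction i a)
        rw [h.contraction_gen_mul, if_neg (Ne.symm hij), zero_sub]
      exact LinearMap.congr_fun this z
    have h2 : ∀ z, g i (W.coef (signMap 𝒜) z) = -W.coef (signMap 𝒜) (g i z) := fun z => by
      have : g i * W.coef (signMap 𝒜) = -(W.coef (signMap 𝒜) * g i) := by
        refine (W.coef_mul _ _).trans ((congrArg W.coef (LinearMap.ext fun a => ?_)).trans
          ((W.coef_neg _).trans (congrArg Neg.neg (W.coef_mul _ _).symm)))
        change h.contraction i (signMap 𝒜 a) = -(signMap 𝒜 (h.contraction i a))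
        rw [h.signMap_contraction hdeg, neg_neg]
      exact LinearMap.congr_fun this z
    have h3 : ∀ z, g i (W.act (gen ξ U j) z) = W.act (gen ξ U j) (g i z) := fun z =>
      LinearMap.congr_fun (W.coef_act (h.contraction i) (gen ξ U j)) z
    change g i (W.coef _ z - W.coef _ (W.act _ z)) =
      -(W.coef _ (g i z) - W.coef _ (W.act _ (g i z)))
    rw [map_sub, h1, h2, h3]
    abel
  have hred : ∀ s : Finset (Fin c), ∀ z, W.koszulD z = 0 → ∃ z' y, z = z' + W.koszulD y ∧
      W.koszulD z' = 0 ∧ ∀ i ∈ s, g i z' = 0 ∧ P i z' = z' := by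
    intro s
    induction s using Finset.induction_on with
    | empty => exact fun z hz => ⟨z, 0, by rw [map_zero, add_zero], hz, by simp⟩
    | insert j s hj ih =>
      intro z hz
      obtain ⟨z', y, rfl, hz', hs⟩ := ih z hz
      have hh := LinearMap.congr_fun (W.koszulD_homotopy h hdeg j) z'
      replace hh : W.koszulD (W.up j (W.coef (h.contraction j) z')) +
        W.up j (W.coef (h.contraction j) (W.koszulD z')) = z' - P j (g j (L j z')) := hh
      rw [hz', map_zero, map_zero, add_zero] at hh
      refine ⟨P j (g j (L j z')), y + W.up j (W.coef (h.contraction j) z'), ?_, ?_, ?_⟩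
      · rw [map_add, hh]
        abel
      · have h2 := LinearMap.congr_fun (W.koszulD_sq h hdeg) (W.up j (W.coef (h.contraction j) z'))
        replace h2 : W.koszulD (W.koszulD (W.up j (W.coef (h.contraction j) z'))) = 0 := h2
        rw [hh, map_sub, hz', zero_sub, neg_eq_zero] at h2
        exact h2
      · intro i hi
        by_cases hij : i = j
        · subst hij
          exact ⟨by rw [hgP, hg2, map_zero], hPP' _ _⟩
        · obtain ⟨h3, h4⟩ := hs i ((Finset.mem_insert.mp hi).resolve_left hij)
          refine ⟨?_, ?_⟩
          · rw [hgP, hgg, hgL i j _ hij, h3, map_zero, neg_zero, map_zero, neg_zero, map_zero]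
          · rw [hPP, ← hgP, hPL, h4]
  have hfix : ∀ z, (∀ i, g i z = 0 ∧ P i z = z) → ∃ u, z = W.tmul 0 1 u := by
    intro z hz
    have h0 : ∀ m j, m ≠ 0 → z (m, j) = 0 := by
      intro m j hm
      obtain ⟨i, hi⟩ : ∃ i, m i ≠ 0 := by
        by_contra hcon
        push Not at hcon
        exact hm (Finsupp.ext hcon)
      have h1 : Finsupp.lapply (R := k) (m, j) ∘ₗ P i = 0 := koszul_ext fun m' j' a => by
        rw [LinearMap.comp_apply, hPs]
        split_ifs with hm'
        · rw [Finsupp.lapply_apply, LinearMap.zero_apply, Finsupp.single_eq_of_ne]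
          rintro hh
          rw [(Prod.mk.inj hh).1] at hi
          exact hi hm'
        · rw [map_zero, LinearMap.zero_apply]
      rw [← (hz i).2]
      exact LinearMap.congr_fun h1 z
    have h1 : ∀ j, ∃ r, z (0, j) = algebraMap k A r := fun j =>
      h.eq_algebraMap_of_contraction_eq_zero fun i => by
        have h2 := DFunLike.congr_fun (hz i).1 (0, j)
        exact h2
    choose r hr using h1
    refine ⟨∑ j, r j • W.b j, ?_⟩
    rw [map_sum]
    simp only [map_smul, tmul_basis]
    refine Finsupp.ext ?_
    rintro ⟨m, j⟩
    by_cases hm : m = 0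
    · subst hm
      rw [hr, Finsupp.finsetSum_apply, Finset.sum_eq_single j]
      · rw [Finsupp.smul_apply, Finsupp.single_eq_same, Algebra.algebraMap_eq_smul_one]
      · intro i _ hij
        rw [Finsupp.smul_apply, Finsupp.single_eq_of_ne, smul_zero]
        exact fun hh => hij (Prod.mk.inj hh).2.symm
      · exact fun hh => absurd (Finset.mem_univ j) hh
    · rw [h0 m j hm, Finsupp.finsetSum_apply, Finset.sum_eq_zero]
      intro i _
      rw [Finsupp.smul_apply, Finsupp.single_eq_of_ne, smul_zero]
      exact fun hh => hm (Prod.mk.inj hh).1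
  have hinj : ∀ (z : W.Koszul) (v : U), W.koszulD z = 0 → U.d v = W.koszulPi z →
      ∃ y : W.Koszul, W.koszulD y = z := by
    intro z v hz hv
    obtain ⟨z', y, hzy, -, hs⟩ := hred Finset.univ z hz
    obtain ⟨u, rfl⟩ := hfix z' fun i => hs i (Finset.mem_univ i)
    have hπ : W.koszulPi (W.koszulD y) = U.d (W.koszulPi y) := (W.koszulHom h hdeg).map_d y
    refine ⟨W.tmul 0 1 (v - W.koszulPi y) + y, ?_⟩
    rw [map_add, hι, map_sub, hv, ← hπ, ← map_sub]
    have : W.koszulPi (z - W.koszulD y) = u := by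
      rw [hzy, add_sub_cancel_right, hπι]
    rw [this, hzy]
  refine Hom.isQuasiIso_of _ ?_ ?_
  · rintro z hz ⟨v, hv⟩
    exact hinj z v hz hv
  · intro v hv
    refine ⟨W.tmul 0 1 v, ?_, 0, ?_⟩
    · change W.koszulD _ = 0
      rw [hι, hv, map_zero]
    · rw [map_zero]
      exact (sub_eq_zero.mpr (hπι v)).symm

/-- The Koszul resolution. -/
def koszulResolution (h : IsExteriorOn 𝒜 deg ξ) (hdeg : ∀ i, 0 < deg i ∧ Odd (deg i)) :
    SemifreeResolution U :=
  ⟨W.koszul h fun i => (hdeg i).2, W.koszul_isSemifree h hdeg, W.koszulHom h fun i => (hdeg i).2,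
    W.koszulHom_isQuasiIso h fun i => (hdeg i).2⟩

end Resolution

end AdaptedBasis

end DGModule

/-! ### Growth of graded modules up to shifts -/

/-- The sequence `f` is bounded by a finite sum of shifts of the sequence `g`. -/
def ShiftDominated (f g : ℤ → Cardinal.{u}) : Prop :=
  ∃ L : List ℤ, ∀ n, f n ≤ (L.map fun s => g (n + s)).sum

namespace ShiftDominated

variable {f f' g g' : ℤ → Cardinal.{u}}

lemma of_zero (h : ∀ n, f n = 0) : ShiftDominated f g := ⟨[], fun n => by simp [h]⟩

lemma of_shift (s : ℤ) (h : ∀ n, f n ≤ g (n + s)) : ShiftDominated f g :=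
  ⟨[s], fun n => by simpa using h n⟩

lemma of_le (h : ∀ n, f n ≤ f' n) (h' : ShiftDominated f' g) : ShiftDominated f g := by
  obtain ⟨L, hL⟩ := h'
  exact ⟨L, fun n => (h n).trans (hL n)⟩

lemma add (h : ShiftDominated f g) (h' : ShiftDominated f' g) :
    ShiftDominated (fun n => f n + f' n) g := by
  obtain ⟨L, hL⟩ := h
  obtain ⟨L', hL'⟩ := h'
  exact ⟨L ++ L', fun n => by
    rw [List.map_append, List.sum_append]
    exact add_le_add (hL n) (hL' n)⟩

lemma sum {ι : Type*} (s : Finset ι) {F : ι → ℤ → Cardinal.{u}}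
    (h : ∀ i ∈ s, ShiftDominated (F i) g) : ShiftDominated (fun n => ∑ i ∈ s, F i n) g := by
  classical
  induction s using Finset.induction_on with
  | empty => exact of_zero fun n => by simp
  | insert i s hi ih =>
    simp only [Finset.sum_insert hi]
    exact (h i (Finset.mem_insert_self i s)).add
      (ih fun j hj => h j (Finset.mem_insert_of_mem hj))

lemma shift (s : ℤ) (h : ShiftDominated f g) : ShiftDominated (fun n => f (n + s)) g := by
  obtain ⟨L, hL⟩ := h
  refine ⟨L.map (s + ·), fun n => (hL (n + s)).trans (le_of_eq ?_)⟩
  rw [List.map_map]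
  congr 2
  funext t
  simp [add_assoc]

lemma trans (h : ShiftDominated f g) (h' : ShiftDominated g g') : ShiftDominated f g' := by
  obtain ⟨L, hL⟩ := h
  refine of_le hL ?_
  clear hL
  induction L with
  | nil => exact of_zero fun n => by simp
  | cons s L ih =>
    simp only [List.map_cons, List.sum_cons]
    exact (h'.shift s).add ih

end ShiftDominated

section LinearAlgebra

variable {k : Type*} {M N N' : Type u} [Field k] [AddCommGroup M] [Module k M] [AddCommGroup N]
  [Module k N] [AddCommGroup N'] [Module k N']

/-- The image of a subspace `P` under `f` is not larger than the image of `P` under `g` together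
with the image under `f` of the kernel of `g` on `P`. -/
lemma rank_map_le_rank_map_add (f : M →ₗ[k] N) (g : M →ₗ[k] N') (P : Submodule k M) :
    Module.rank k (P.map f) ≤
      Module.rank k (P.map g) + Module.rank k ((P ⊓ LinearMap.ker g).map f) := by
  obtain ⟨C₀, hC₀⟩ := (P ⊓ LinearMap.ker g).exists_isCompl
  have hP : P ≤ (C₀ ⊓ P) ⊔ (P ⊓ LinearMap.ker g) := by
    rw [sup_comm, ← sup_inf_assoc_of_le C₀ (inf_le_left : P ⊓ LinearMap.ker g ≤ P),
      hC₀.sup_eq_top, top_inf_eq]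
  have h1 : P.map f ≤ (C₀ ⊓ P).map f ⊔ (P ⊓ LinearMap.ker g).map f := by
    rw [← Submodule.map_sup]
    exact Submodule.map_mono hP
  have h2 : Module.rank k ((C₀ ⊓ P).map f) ≤ Module.rank k (P.map g) := by
    refine (rank_map_le f (C₀ ⊓ P)).trans ?_
    refine LinearMap.rank_le_of_injective
      ((g.restrict (p := C₀ ⊓ P) (q := P.map g) fun x hx => ⟨x, hx.2, rfl⟩)) ?_
    rw [← LinearMap.ker_eq_bot, LinearMap.ker_eq_bot']
    rintro ⟨x, hx⟩ hgx
    have h0 : g x = 0 := congrArg Subtype.val hgx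
    exact Subtype.ext (Submodule.disjoint_def.mp hC₀.disjoint x ⟨hx.2, h0⟩ hx.1)
  calc Module.rank k (P.map f)
      ≤ Module.rank k ((C₀ ⊓ P).map f ⊔ (P ⊓ LinearMap.ker g).map f :) := Submodule.rank_mono h1
    _ ≤ _ := Submodule.rank_add_le_rank_add_rank _ _
    _ ≤ _ := add_le_add_left h2 _

lemma rank_finset_sup_le {ι : Type*} (s : Finset ι) (P : ι → Submodule k M) :
    Module.rank k (s.sup P :) ≤ ∑ i ∈ s, Module.rank k (P i) := by
  classical
  induction s using Finset.induction_on with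
  | empty => simp
  | insert i s hi ih =>
    rw [Finset.sup_insert, Finset.sum_insert hi]
    exact (Submodule.rank_add_le_rank_add_rank _ _).trans (add_le_add_right ih _)

/-- A subspace `P` on which finitely many linear maps are jointly injective is not larger than the
images of `P` together. -/
lemma rank_le_sum_rank_map {ι : Type*} (t : Finset ι) (F : ι → M →ₗ[k] N) :
    ∀ P : Submodule k M, (∀ x ∈ P, (∀ i ∈ t, F i x = 0) → x = 0) →
      Module.rank k P ≤ ∑ i ∈ t, Module.rank k (P.map (F i)) := by
  classical
  induction t using Finset.induction_on with
  | empty =>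
    intro P hP
    have : P = ⊥ := (Submodule.eq_bot_iff P).mpr fun x hx => hP x hx (by simp)
    rw [this, rank_bot]
    exact zero_le
  | insert i t hi ih =>
    intro P hP
    have h1 := rank_map_le_rank_map_add LinearMap.id (F i) P
    rw [Submodule.map_id, Submodule.map_id] at h1
    rw [Finset.sum_insert hi]
    refine h1.trans (add_le_add_right ((ih (P ⊓ LinearMap.ker (F i)) fun x hx hx' => hP x hx.1 fun j hj => ?_).trans
      (Finset.sum_le_sum fun j _ => Submodule.rank_mono (Submodule.map_mono inf_le_left))) _)
    obtain rfl | hj := Finset.mem_insert.mp hj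
    · exact hx.2
    · exact hx' j hj

end LinearAlgebra

namespace DGModule

section Growth

variable {k S : Type u} [Field k] [CommRing S] [Algebra k S] {𝒮 : ℤ → Submodule k S}
  [GradedAlgebra 𝒮]

lemma proj_smul_of_mem {X : DGModule 𝒮} {e : ℤ} {x : X} (hx : x ∈ X.gr e) (n : ℤ) (s : S) :
    X.proj n (s • x) = (DirectSum.decompose 𝒮 s (n - e) : S) • x := by
  induction s using DirectSum.Decomposition.inductionOn 𝒮 with
  | zero => simp
  | @homogeneous i m =>
    by_cases h : i = n - e
    · subst h
      rw [DirectSum.decompose_of_mem_same 𝒮 m.2]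
      have := X.smul_mem m.2 hx
      rw [sub_add_cancel] at this
      exact proj_of_mem this
    · rw [DirectSum.decompose_of_mem_ne 𝒮 m.2 h, zero_smul]
      exact proj_of_mem_ne (X.smul_mem m.2 hx) (by omega)
  | add a b ha hb =>
    rw [add_smul, map_add, ha, hb, DirectSum.decompose_add, DirectSum.add_apply,
      Submodule.coe_add, add_smul]

/-- Over a noetherian ring, a submodule closed under taking components is generated by finitely
many homogeneous elements, and generated by them in each degree. -/
lemma exists_homogeneous_generators [IsNoetherianRing S] (X : DGModule 𝒮) [Module.Finite S X]
    (N : Submodule S X) (hN : ∀ n, ∀ x ∈ N, X.proj n x ∈ N) :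
    ∃ (t : Finset X) (e : X → ℤ), (∀ z ∈ t, z ∈ N ∧ z ∈ X.gr (e z)) ∧
      N = Submodule.span S (t : Set X) ∧
      ∀ n, ∀ x ∈ N, x ∈ X.gr n → ∃ s : X → S, (∀ z, s z ∈ 𝒮 (n - e z)) ∧
        x = ∑ z ∈ t, s z • z := by
  classical
  let G : Set X := {z | z ∈ N ∧ ∃ e, z ∈ X.gr e}
  have hG : Submodule.span S G = N := by
    refine le_antisymm (Submodule.span_le.mpr fun z hz => hz.1) fun x hx => ?_
    obtain ⟨s, hs, -⟩ := exists_finset_sum_proj x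
    rw [hs]
    exact Submodule.sum_mem _ fun n _ => Submodule.subset_span ⟨hN n x hx, n, X.proj_mem n x⟩
  have hfg : (Submodule.span S G).FG := IsNoetherian.noetherian _
  obtain ⟨t, htG, ht⟩ := Submodule.fg_span_iff_fg_span_finset_subset G |>.mp hfg
  have hex : ∀ z : X, ∃ e : ℤ, z ∈ t → z ∈ X.gr e := fun z => by
    by_cases hz : z ∈ t
    · obtain ⟨e, he⟩ := (htG hz).2
      exact ⟨e, fun _ => he⟩
    · exact ⟨0, fun h => absurd h hz⟩
  choose e he using hex
  refine ⟨t, e, fun z hz => ⟨(htG hz).1, he z hz⟩, (ht ▸ hG).symm, fun n x hx hxn => ?_⟩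
  rw [← hG, ht, Submodule.mem_span_finset] at hx
  obtain ⟨c, -, hc⟩ := hx
  refine ⟨fun z => DirectSum.decompose 𝒮 (c z) (n - e z), fun z => Subtype.coe_prop _, ?_⟩
  rw [← proj_of_mem hxn, ← hc, map_sum]
  exact Finset.sum_congr rfl fun z hz => proj_smul_of_mem (he z hz) n (c z)

variable (𝒮) in
/-- The graded algebra `S` as a DG module with zero differential. -/
def self : DGModule 𝒮 where
  carrier := S
  gr := 𝒮
  isInternal := DirectSum.Decomposition.isInternal 𝒮
  smul_mem ha hu := SetLike.mul_mem_graded ha hu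
  d := 0
  d_mem _ := zero_mem _
  d_d _ := rfl
  d_smul _ _ := by simp

/-- The size in degree `n` of the quotient of the graded algebra by the ideal `I`. -/
def quotRank (𝒮 : ℤ → Submodule k S) (I : Ideal S) (n : ℤ) : Cardinal.{u} :=
  Module.rank k ((𝒮 n).map ((Submodule.mkQ I).restrictScalars k))

/-- If a power of the homogeneous ideal `I` annihilates `y`, then the cyclic module on `y` does not
grow faster than `S/I`: it is filtered by the powers of `I`. -/
lemma shiftDominated_cyclic [IsNoetherianRing S] {I : Ideal S}
    (hI : ∀ n, ∀ s ∈ I, (self 𝒮).proj n s ∈ I) {Q : Type u} [AddCommGroup Q] [Module k Q]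
    [Module S Q] [IsScalarTower k S Q] (l : ℕ) :
    ∀ y : Q, (∀ s ∈ I ^ l, s • y = 0) → ShiftDominated
      (fun n => Module.rank k ((𝒮 n).map ((LinearMap.toSpanSingleton S Q y).restrictScalars k)))
      (quotRank 𝒮 I) := by
  have : Module.Finite S (self 𝒮) := inferInstanceAs (Module.Finite S S)
  obtain ⟨t, e, ht, htI⟩ : ∃ (t : Finset S) (e : S → ℤ), (∀ z ∈ t, z ∈ I) ∧
      ∀ n, ∀ x ∈ I, x ∈ 𝒮 n → ∃ s : S → S, (∀ z, s z ∈ 𝒮 (n - e z)) ∧ x = ∑ z ∈ t, s z * z := by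
    obtain ⟨t, e, ht, -, htI⟩ := exists_homogeneous_generators (self 𝒮) I hI
    exact ⟨t, e, fun z hz => (ht z hz).1, htI⟩
  induction l with
  | zero =>
    intro y hy
    have hy0 : y = 0 := by
      have := hy 1 (by simp)
      rwa [one_smul] at this
    refine ShiftDominated.of_zero fun n => ?_
    rw [hy0]
    have : (𝒮 n).map ((LinearMap.toSpanSingleton S Q (0 : Q)).restrictScalars k) = ⊥ := by
      rw [eq_bot_iff]
      rintro _ ⟨x, -, rfl⟩
      simp
    rw [this, rank_bot]
  | succ l ih =>
    intro y hy
    have hty : ∀ z ∈ t, ∀ s ∈ I ^ l, s • (z • y) = 0 := fun z hz s hs => by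
      rw [smul_smul]
      refine hy _ ?_
      rw [pow_succ]
      exact Ideal.mul_mem_mul hs (ht z hz)
    refine ShiftDominated.of_le (fun n => rank_map_le_rank_map_add _
      ((Submodule.mkQ I).restrictScalars k) (𝒮 n)) (ShiftDominated.add
        (ShiftDominated.of_shift 0 fun n => by rw [add_zero]; rfl) ?_)
    refine ShiftDominated.of_le (f' := fun n => ∑ z ∈ t, Module.rank k ((𝒮 (n - e z)).map
      ((LinearMap.toSpanSingleton S Q (z • y)).restrictScalars k))) (fun n => ?_)
      (ShiftDominated.sum t fun z hz => (ih _ (hty z hz)).shift (-e z))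
    refine le_trans (Submodule.rank_mono ?_) (rank_finset_sup_le t fun z => (𝒮 (n - e z)).map
      ((LinearMap.toSpanSingleton S Q (z • y)).restrictScalars k))
    rintro _ ⟨x, ⟨hx, hxI⟩, rfl⟩
    have hxI' : x ∈ I := (Submodule.Quotient.mk_eq_zero I).mp hxI
    obtain ⟨s, hs, hxs⟩ := htI n x hxI' hx
    have h1 : x • y = ∑ z ∈ t, s z • (z • y) := by
      rw [hxs, Finset.sum_smul]
      exact Finset.sum_congr rfl fun z _ => mul_smul _ _ _
    change x • y ∈ _
    rw [h1]
    refine Submodule.sum_mem _ fun z hz => ?_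
    exact (Finset.le_sup (f := fun z => (𝒮 (n - e z)).map
      ((LinearMap.toSpanSingleton S Q (z • y)).restrictScalars k)) hz) ⟨s z, hs z, rfl⟩

variable {X : DGModule 𝒮} (D : X →ₗ[S] X)

/-- The annihilator of the homology of the `S`-linear differential `D`. -/
def homologyAnn {X : Type*} [AddCommGroup X] [Module S X] (D : X →ₗ[S] X) : Ideal S where
  carrier := {s | ∀ z, D z = 0 → ∃ y, D y = s • z}
  add_mem' := by
    intro a b ha hb z hz
    obtain ⟨y, hy⟩ := ha z hz
    obtain ⟨y', hy'⟩ := hb z hz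
    exact ⟨y + y', by rw [map_add, hy, hy', add_smul]⟩
  zero_mem' := fun z _ => ⟨0, by rw [map_zero, zero_smul]⟩
  smul_mem' := by
    intro a b hb z hz
    obtain ⟨y, hy⟩ := hb z hz
    exact ⟨a • y, by rw [map_smul, hy, smul_eq_mul, mul_smul]⟩

variable {D} (hD : ∀ x, D x = X.d x)

include hD

omit [GradedAlgebra 𝒮] in
lemma proj_mem_ker (n : ℤ) {x : X} (hx : x ∈ LinearMap.ker D) :
    X.proj n x ∈ LinearMap.ker D := by
  rw [LinearMap.mem_ker, hD] at hx ⊢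
  have := proj_d (n - 1) x
  rw [sub_add_cancel, hx, map_zero] at this
  exact this.symm

omit [GradedAlgebra 𝒮] in
lemma proj_mem_range (n : ℤ) {x : X} (hx : x ∈ LinearMap.range D) :
    X.proj n x ∈ LinearMap.range D := by
  obtain ⟨y, rfl⟩ := hx
  exact ⟨X.proj (n + 1) y, by rw [hD, hD, proj_d]⟩

lemma proj_mem_homologyAnn (n : ℤ) {s : S} (hs : s ∈ homologyAnn D) :
    (self 𝒮).proj n s ∈ homologyAnn D := by
  have hn : (self 𝒮).proj n s = (DirectSum.decompose 𝒮 s n : S) := by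
    have hone : (1 : S) ∈ 𝒮 0 := SetLike.GradedOne.one_mem
    have := proj_smul_of_mem (X := self 𝒮) (x := (1 : S)) (e := 0) hone n s
    rw [sub_zero] at this
    have h1 : ∀ a : S, a • (show self 𝒮 from (1 : S)) = a := fun a => mul_one a
    exact ((congrArg _ (h1 s)).symm.trans this).trans (h1 _)
  rw [hn]
  intro z hz
  obtain ⟨t, ht, -⟩ := exists_finset_sum_proj z
  have h1 : ∀ m, ∃ y, D y = (DirectSum.decompose 𝒮 s n : S) • X.proj m z := fun m => by
    obtain ⟨y, hy⟩ := hs _ (proj_mem_ker hD m hz)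
    have h2 := proj_smul_of_mem (X.proj_mem m z) (n + m) s
    rw [add_sub_cancel_right, ← hy] at h2
    rw [← h2]
    exact proj_mem_range hD (n + m) ⟨y, rfl⟩
  choose y hy using h1
  refine ⟨∑ m ∈ t, y m, ?_⟩
  rw [map_sum]
  conv_rhs => rw [ht, Finset.smul_sum]
  exact Finset.sum_congr rfl fun m _ => hy m

omit [GradedAlgebra 𝒮] in
/-- The homology in degree `n`, as a subspace of the cokernel of the differential. -/
lemma rank_homology (n : ℤ) : Module.rank k (X.homology n) =
    Module.rank k ((X.cycles n).map ((LinearMap.range D).mkQ.restrictScalars k)) := by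
  refine LinearEquiv.rank_eq ?_
  let f : X.cycles n →ₗ[k] X ⧸ LinearMap.range D :=
    ((LinearMap.range D).mkQ.restrictScalars k) ∘ₗ (X.cycles n).subtype
  have hf : LinearMap.ker f = (X.boundaries n).submoduleOf (X.cycles n) := by
    ext ⟨z, hz⟩
    rw [LinearMap.mem_ker]
    change Submodule.Quotient.mk z = 0 ↔ z ∈ X.boundaries n
    rw [Submodule.Quotient.mk_eq_zero]
    constructor
    · rintro ⟨y, hy⟩
      refine ⟨X.proj (n + 1) y, X.proj_mem _ _, ?_⟩
      rw [← proj_d, ← hD, hy]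
      exact proj_of_mem hz.1
    · rintro ⟨y, -, hy⟩
      exact ⟨y, (hD y).trans hy⟩
  have hr : LinearMap.range f =
      (X.cycles n).map ((LinearMap.range D).mkQ.restrictScalars k) := by
    rw [LinearMap.range_comp, Submodule.range_subtype]
  exact (Submodule.quotEquivOfEq _ _ hf.symm).trans
    (f.quotKerEquivRange.trans (LinearEquiv.ofEq _ _ hr))

/-- The quotient of `S` by the annihilator of the homology embeds into a finite sum of shifts of
the homology. -/
lemma shiftDominated_quotRank [IsNoetherianRing S] [Module.Finite S X] :
    ShiftDominated (quotRank 𝒮 (homologyAnn D)) (fun n => Module.rank k (X.homology n)) := by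
  obtain ⟨t, e, ht, hspan, -⟩ := exists_homogeneous_generators X (LinearMap.ker D)
    fun n x hx => proj_mem_ker hD n hx
  let Q := X ⧸ LinearMap.range D
  have hle : ∀ z ∈ t, homologyAnn D ≤ LinearMap.ker
      (LinearMap.toSpanSingleton S Q (Submodule.Quotient.mk z)) := fun z hz s hs =>
    (Submodule.Quotient.mk_eq_zero (LinearMap.range D)).mpr (hs z (ht z hz).1)
  let F : t → (S ⧸ homologyAnn D) →ₗ[S] Q := fun z => Submodule.liftQ _ _ (hle z z.2)
  have hF : ∀ x, (∀ z, F z x = 0) → x = 0 := by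
    intro x hx
    obtain ⟨s, rfl⟩ := Submodule.Quotient.mk_surjective _ x
    refine (Submodule.Quotient.mk_eq_zero _).mpr fun z hz => ?_
    have hz' : z ∈ Submodule.span S (t : Set X) := hspan ▸ (show z ∈ LinearMap.ker D from hz)
    have hle : Submodule.span S (t : Set X) ≤
        (LinearMap.range D).comap (LinearMap.lsmul S X s) := by
      rw [Submodule.span_le]
      exact fun z hz => (Submodule.Quotient.mk_eq_zero (LinearMap.range D)).mp (hx ⟨z, hz⟩)
    exact hle hz'
  refine ShiftDominated.of_le (f' := fun n => ∑ z : t, Module.rank k (X.homology (n + e z)))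
    (fun n => ?_) (ShiftDominated.sum _ fun z _ => ShiftDominated.of_shift (e z) fun n => le_rfl)
  refine (rank_le_sum_rank_map Finset.univ (fun z => (F z).restrictScalars k) _
    fun x _ hx => hF x fun z => hx z (Finset.mem_univ z)).trans
      (Finset.sum_le_sum fun z _ => ?_)
  rw [rank_homology hD]
  refine Submodule.rank_mono ?_
  rintro _ ⟨_, ⟨s, hs, rfl⟩, rfl⟩
  refine ⟨s • (z : X), ⟨X.smul_mem hs (ht z z.2).2, ?_⟩, rfl⟩
  have hz : D (z : X) = 0 := (ht z z.2).1
  change X.d (s • (z : X)) = 0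
  rw [← hD, map_smul, hz, smul_zero]

/-- If a power of the annihilator of the homology of `X` annihilates the homology of `Y`, then the
homology of `Y` does not grow faster than that of `X`. -/
theorem shiftDominated_homology [IsNoetherianRing S] [Module.Finite S X] {Y : DGModule 𝒮}
    [Module.Finite S Y] {D' : Y →ₗ[S] Y} (hD' : ∀ y, D' y = Y.d y) {l : ℕ}
    (hl : homologyAnn D ^ l ≤ homologyAnn D') :
    ShiftDominated (fun n => Module.rank k (Y.homology n))
      (fun n => Module.rank k (X.homology n)) := by
  refine ShiftDominated.trans (g := quotRank 𝒮 (homologyAnn D)) ?_ (shiftDominated_quotRank hD)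
  obtain ⟨t, e, ht, -, hgen⟩ := exists_homogeneous_generators Y (LinearMap.ker D')
    fun n x hx => proj_mem_ker hD' n hx
  let Q := Y ⧸ LinearMap.range D'
  have hz : ∀ z ∈ t, ∀ s ∈ homologyAnn D ^ l,
      s • (Submodule.Quotient.mk z : Q) = 0 := fun z hz s hs =>
    (Submodule.Quotient.mk_eq_zero (LinearMap.range D')).mpr (hl hs z (ht z hz).1)
  let P : ℤ → Y → Submodule k Q := fun n z => (𝒮 (n - e z)).map
    ((LinearMap.toSpanSingleton S Q (Submodule.Quotient.mk z)).restrictScalars k)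
  refine ShiftDominated.of_le (f' := fun n => ∑ z ∈ t, Module.rank k (P n z))
    (fun n => ?_) (ShiftDominated.sum t fun z hzt => (shiftDominated_cyclic
      (fun n s hs => proj_mem_homologyAnn hD n hs) l _ (hz z hzt)).shift (-e z))
  rw [rank_homology hD']
  refine (Submodule.rank_mono ?_).trans (rank_finset_sup_le t (P n))
  rintro _ ⟨x, ⟨hx, hdx⟩, rfl⟩
  obtain ⟨s, hs, rfl⟩ := hgen n x ((hD' x).trans hdx) hx
  rw [map_sum]
  exact Submodule.sum_mem _ fun z hzt => (Finset.le_sup (f := P n) hzt) ⟨s z, hs z, rfl⟩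

end Growth

end DGModule

/-! ### Complexes of matrices -/

namespace DGModule

section Homotopy

variable {S X : Type*} [CommRing S] [AddCommGroup X] [Module S X]

/-- On a free module with a differential that lowers the level of the basis elements,
multiplication by an element of the `r`-th power of the annihilator of the homology is null-homotopic
on the basis elements of level less than `r`. -/
lemma exists_homotopy_of_mem_pow {ι : Type*} (e : Module.Basis ι S X) (lvl : ι → ℕ)
    (D : X →ₗ[S] X) (hDD : ∀ x, D (D x) = 0)
    (hlvl : ∀ i, D (e i) ∈ Submodule.span S (e '' {j | lvl j < lvl i})) (r : ℕ) :
    ∀ s ∈ homologyAnn D ^ r, ∃ h : X →ₗ[S] X, ∀ i, lvl i < r →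
      D (h (e i)) + h (D (e i)) = s • e i := by
  classical
  induction r with
  | zero => exact fun s _ => ⟨0, fun i hi => absurd hi (Nat.not_lt_zero _)⟩
  | succ r ih =>
    intro s hs
    rw [pow_succ] at hs
    refine Submodule.mul_induction_on hs (fun s₂ hs₂ s₁ hs₁ => ?_) ?_
    · obtain ⟨h, hh⟩ := ih s₂ hs₂
      have hspan : ∀ i, lvl i ≤ r → ∀ x ∈ Submodule.span S (e '' {j | lvl j < lvl i}),
          D (h x) + h (D x) = s₂ • x := by
        intro i hi x hx
        have hle : Submodule.span S (e '' {j | lvl j < lvl i}) ≤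
            LinearMap.eqLocus (D ∘ₗ h + h ∘ₗ D) (LinearMap.lsmul S X s₂) := by
          rw [Submodule.span_le]
          rintro _ ⟨j, hj, rfl⟩
          exact hh j (lt_of_lt_of_le hj hi)
        exact hle hx
      have hy : ∀ i, ∃ y, lvl i = r → D y = s₁ • (s₂ • e i - h (D (e i))) := fun i => by
        by_cases hi : lvl i = r
        · obtain ⟨y, hy⟩ := hs₁ (s₂ • e i - h (D (e i))) (by
            have := hspan i hi.le _ (hlvl i)
            rw [hDD, map_zero, add_zero] at this
            rw [map_sub, map_smul, this, sub_self])
          exact ⟨y, fun _ => hy⟩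
        · exact ⟨0, fun h => absurd h hi⟩
      choose y hy using hy
      let h' : X →ₗ[S] X := e.constr S fun i => if lvl i = r then y i else s₁ • h (e i)
      have h'e : ∀ i, h' (e i) = if lvl i = r then y i else s₁ • h (e i) :=
        fun i => e.constr_basis S _ i
      have h's : ∀ i, lvl i ≤ r → h' (D (e i)) = s₁ • h (D (e i)) := fun i hi => by
        have hle : Submodule.span S (e '' {j | lvl j < lvl i}) ≤
            LinearMap.eqLocus h' (s₁ • h) := by
          rw [Submodule.span_le]
          rintro _ ⟨j, hj, rfl⟩
          have : lvl j < lvl i := hj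
          change h' (e j) = s₁ • h (e j)
          rw [h'e, if_neg (by omega)]
        exact hle (hlvl i)
      refine ⟨h', fun i hi => ?_⟩
      rw [h's i (by omega), h'e, mul_comm, mul_smul]
      split_ifs with hir
      · rw [hy i hir, smul_sub, sub_add_cancel]
      · rw [map_smul, ← smul_add, hh i (by omega)]
    · rintro a b ⟨h, hh⟩ ⟨h', hh'⟩
      refine ⟨h + h', fun i hi => ?_⟩
      rw [add_smul, ← hh i hi, ← hh' i hi, LinearMap.add_apply, LinearMap.add_apply, map_add]
      abel

end Homotopy

/-- The data of a finite free DG module over the commutative graded algebra `S` with a homogeneous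
basis: the matrix `δ` of its differential, and the degrees and levels of the basis elements. The
differential strictly lowers the level. -/
structure FreeModel {k S : Type u} [Field k] [CommRing S] [Algebra k S]
    (𝒮 : ℤ → Submodule k S) where
  J : Type u
  [fintype : Fintype J]
  [decEq : DecidableEq J]
  degree : J → ℤ
  level : J → ℕ
  δ : Matrix J J S
  mem : ∀ i j, δ i j ∈ 𝒮 (degree j - degree i - 1)
  odd : ∀ i j, δ i j ≠ 0 → Odd (degree i - degree j)
  sq : δ * δ = 0
  level_lt : ∀ i j, δ i j ≠ 0 → level i < level j

namespace FreeModel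

attribute [instance] fintype decEq

variable {k S : Type u} [Field k] [CommRing S] [Algebra k S] {𝒮 : ℤ → Submodule k S}
  (P Q R : FreeModel 𝒮)

/-- The matrix of the map `x ↦ (-1)^{|x|} x`. -/
def ε : Matrix P.J P.J S := Matrix.diagonal fun j => ((P.degree j).negOnePow : S)

variable {P Q R}

lemma ε_ε : P.ε * P.ε = 1 := by
  rw [ε, Matrix.diagonal_mul_diagonal, ← Matrix.diagonal_one]
  congr 1
  funext j
  rw [← Int.cast_mul, Int.units_coe_mul_self, Int.cast_one]

lemma ε_ε_mul {n : Type*} (x : Matrix P.J n S) : P.ε * (P.ε * x) = x := by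
  rw [← Matrix.mul_assoc, ε_ε, Matrix.one_mul]

lemma δ_δ_mul {n : Type*} (x : Matrix P.J n S) : P.δ * (P.δ * x) = 0 := by
  rw [← Matrix.mul_assoc, P.sq, Matrix.zero_mul]

lemma δ_ε : P.δ * P.ε = -(P.ε * P.δ) := by
  ext i j
  rw [ε, Matrix.mul_diagonal, Matrix.neg_apply, Matrix.diagonal_mul]
  by_cases h : P.δ i j = 0
  · simp [h]
  · have h1 : (P.degree i).negOnePow = -(P.degree j).negOnePow := by
      rw [← sub_add_cancel (P.degree i) (P.degree j), Int.negOnePow_add,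
        Int.negOnePow_odd _ (P.odd i j h)]
      simp
    rw [h1]
    push_cast
    ring

lemma δ_ε_mul {n : Type*} (x : Matrix P.J n S) : P.δ * (P.ε * x) = -(P.ε * (P.δ * x)) := by
  rw [← Matrix.mul_assoc, δ_ε, Matrix.neg_mul, Matrix.mul_assoc]

variable (P Q) in
/-- The differential `φ ↦ δ φ - ε φ ε δ` of the complex of homomorphisms from `P` to `Q`. It is
linear over `S`; on homomorphisms of degree `n` it is `δ φ - (-1)^n φ δ`. -/
def D : Matrix Q.J P.J S →ₗ[S] Matrix Q.J P.J S where
  toFun φ := Q.δ * φ - Q.ε * (φ * (P.ε * P.δ))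
  map_add' φ ψ := by
    simp only [Matrix.mul_add, Matrix.add_mul]
    abel
  map_smul' s φ := by
    simp only [Matrix.mul_smul, Matrix.smul_mul, smul_sub, RingHom.id_apply]

lemma D_apply (φ : Matrix Q.J P.J S) : D P Q φ = Q.δ * φ - Q.ε * (φ * (P.ε * P.δ)) := rfl

lemma D_D (φ : Matrix Q.J P.J S) : D P Q (D P Q φ) = 0 := by
  simp only [D_apply, Matrix.mul_sub, Matrix.sub_mul, Matrix.mul_assoc, δ_δ_mul, δ_ε_mul,
    P.sq, Matrix.mul_neg, Matrix.mul_zero]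
  abel

lemma D_mul (φ : Matrix Q.J P.J S) (x : Matrix P.J R.J S) :
    D R Q (φ * x) = D P Q φ * x + Q.ε * (φ * (P.ε * D R P x)) := by
  simp only [D_apply, Matrix.mul_sub, Matrix.sub_mul, Matrix.mul_assoc, ε_ε_mul]
  abel

lemma D_conj (φ : Matrix Q.J P.J S) :
    D P Q (Q.ε * (φ * P.ε)) = -(Q.ε * (D P Q φ * P.ε)) := by
  simp only [D_apply, Matrix.mul_sub, Matrix.sub_mul, Matrix.mul_assoc, ε_ε_mul, δ_ε_mul, δ_ε,
    Matrix.mul_neg]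
  abel

lemma D_one : D P P 1 = 0 := by
  rw [D_apply, Matrix.mul_one, Matrix.one_mul, ε_ε_mul, sub_self]

variable (P Q) in
/-- The annihilator of the homology of the complex of homomorphisms from `P` to `Q`. -/
def ann : Ideal S := homologyAnn (D P Q)

lemma exists_of_mem_ann {s : S} (hs : s ∈ ann P P) : ∃ h, D P P h = s • 1 := hs 1 D_one

/-- If `s = D h` in the endomorphisms of `P`, then `s` annihilates the homology of all complexes of
homomorphisms from `P`. -/
lemma mem_ann_left {s : S} {h : Matrix P.J P.J S} (hs : D P P h = s • 1) : s ∈ ann P Q := by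
  intro φ hφ
  refine ⟨(Q.ε * (φ * P.ε)) * h, ?_⟩
  rw [D_mul, D_conj, hφ, hs]
  simp only [Matrix.zero_mul, Matrix.mul_zero, neg_zero, zero_add, Matrix.mul_assoc, ε_ε_mul,
    Matrix.mul_smul, Matrix.mul_one, ε_ε]

lemma ann_self_le_left : ann P P ≤ ann P Q := fun _ hs =>
  let ⟨_, hh⟩ := exists_of_mem_ann hs
  mem_ann_left hh

lemma mem_span_stdBasis {m n : Type*} [Fintype m] [Fintype n] [DecidableEq m] [DecidableEq n]
    (M : Matrix m n S) {s : Set (m × n)} (h : ∀ i j, M i j ≠ 0 → (i, j) ∈ s) :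
    M ∈ Submodule.span S (Matrix.stdBasis S m n '' s) := by
  rw [Matrix.matrix_eq_sum_single M]
  refine Submodule.sum_mem _ fun i _ => Submodule.sum_mem _ fun j _ => ?_
  by_cases hij : M i j = 0
  · rw [hij, Matrix.single_zero]
    exact zero_mem _
  · have h1 : Matrix.single i j (M i j) = M i j • Matrix.stdBasis S m n (i, j) := by
      rw [Matrix.stdBasis_eq_single, Matrix.smul_single, smul_eq_mul, mul_one]
    rw [h1]
    exact Submodule.smul_mem _ _ (Submodule.subset_span ⟨(i, j), h i j hij, rfl⟩)

variable (P Q) in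
/-- Some power of the annihilator of the homology acts on the complex of homomorphisms by
null-homotopic maps. -/
lemma exists_homotopy : ∃ l : ℕ, ∀ s ∈ ann P Q ^ l,
    ∃ h : Matrix Q.J P.J S →ₗ[S] Matrix Q.J P.J S,
      ∀ φ, D P Q (h φ) + h (D P Q φ) = s • φ := by
  let L : ℕ := Finset.univ.sup P.level
  let L' : ℕ := Finset.univ.sup Q.level
  have hL : ∀ j, P.level j ≤ L := fun j => Finset.le_sup (f := P.level) (Finset.mem_univ j)
  have hL' : ∀ j, Q.level j ≤ L' := fun j => Finset.le_sup (f := Q.level) (Finset.mem_univ j)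
  refine ⟨L' + L + 1, fun s hs => ?_⟩
  obtain ⟨h, hh⟩ := exists_homotopy_of_mem_pow (Matrix.stdBasis S Q.J P.J)
    (fun t => Q.level t.1 + (L - P.level t.2)) (D P Q) D_D (fun t => by
      obtain ⟨i, j⟩ := t
      refine mem_span_stdBasis _ fun a b hab => ?_
      change Q.level a + (L - P.level b) < Q.level i + (L - P.level j)
      rw [Matrix.stdBasis_eq_single, D_apply, Matrix.sub_apply, ε, ε, Matrix.diagonal_mul] at hab
      have h1 := hL b
      have h2 := hL j
      by_cases hb : b = j
      · subst hb
        by_cases ha : a = i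
        · subst ha
          have h3 : Q.δ a a = 0 := by
            by_contra h
            exact lt_irrefl _ (Q.level_lt _ _ h)
          have h4 : P.δ b b = 0 := by
            by_contra h
            exact lt_irrefl _ (P.level_lt _ _ h)
          rw [Matrix.mul_single_apply_same, Matrix.single_mul_apply_same, Matrix.diagonal_mul, h3,
            h4] at hab
          simp at hab
        · rw [Matrix.mul_single_apply_same, Matrix.single_mul_apply_of_ne _ _ _ _ _ ha, mul_one,
            mul_zero, sub_zero] at hab
          have := Q.level_lt _ _ hab
          omega
      · by_cases ha : a = i
        · subst ha
          rw [Matrix.mul_single_apply_of_ne _ _ _ _ _ hb, Matrix.single_mul_apply_same,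
            Matrix.diagonal_mul] at hab
          have : P.δ j b ≠ 0 := fun h => hab (by rw [h]; simp)
          have := P.level_lt _ _ this
          omega
        · rw [Matrix.mul_single_apply_of_ne _ _ _ _ _ hb,
            Matrix.single_mul_apply_of_ne _ _ _ _ _ ha, mul_zero, sub_zero] at hab
          exact absurd rfl hab) _ s hs
  refine ⟨h, fun φ => ?_⟩
  have : D P Q ∘ₗ h + h ∘ₗ D P Q = LinearMap.lsmul S _ s := by
    refine (Matrix.stdBasis S Q.J P.J).ext fun t => hh t ?_
    have := hL' t.1
    change Q.level t.1 + (L - P.level t.2) < L' + L + 1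
    omega
  exact LinearMap.congr_fun this φ

lemma exists_trace_mul {m n : Type*} [Fintype m] [Fintype n] [DecidableEq m] [DecidableEq n]
    (f : Matrix m n S →ₗ[S] S) : ∃ x : Matrix n m S, ∀ φ, f φ = (x * φ).trace := by
  refine ⟨Matrix.of fun j i => f (Matrix.single i j 1), fun φ => ?_⟩
  have h1 : ∀ i j, f (Matrix.single i j (φ i j)) = f (Matrix.single i j 1) * φ i j := fun i j => by
    rw [mul_comm, ← smul_eq_mul, ← map_smul, Matrix.smul_single, smul_eq_mul, mul_one]
  conv_lhs => rw [Matrix.matrix_eq_sum_single φ]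
  simp only [map_sum, h1]
  rw [Finset.sum_comm]
  rfl

lemma trace_mul_D (ψ : Matrix P.J Q.J S) (φ : Matrix Q.J P.J S) :
    (P.ε * ψ * D P Q φ).trace = (D Q P ψ * Q.ε * φ).trace := by
  have h1 : (P.ε * (ψ * (Q.ε * (φ * (P.ε * P.δ))))).trace =
      -(P.δ * (ψ * (Q.ε * φ))).trace := by
    rw [← Matrix.trace_neg]
    have := Matrix.trace_mul_comm (P.ε * (ψ * (Q.ε * φ))) (P.ε * P.δ)
    simp only [Matrix.mul_assoc] at this
    rw [this, δ_ε_mul, Matrix.mul_neg, ε_ε_mul]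
  simp only [D_apply, Matrix.mul_sub, Matrix.sub_mul, Matrix.mul_assoc, Matrix.trace_sub, h1,
    δ_ε_mul, Matrix.mul_neg, Matrix.trace_neg, ε_ε_mul]
  ring

/-- The trace pairing identifies the complex of homomorphisms from `Q` to `P` with the dual of the
complex of homomorphisms from `P` to `Q`; so a homotopy on one of them gives a homotopy on the
other. -/
lemma exists_ann_pow_le : ∃ l : ℕ, ann P Q ^ l ≤ ann Q P := by
  obtain ⟨l, hl⟩ := exists_homotopy P Q
  refine ⟨l, fun s hs ψ hψ => ?_⟩
  obtain ⟨h, hh⟩ := hl s hs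
  obtain ⟨x, hx⟩ := exists_trace_mul
    (Matrix.traceLinearMap P.J S S ∘ₗ mulLeftLinearMap P.J S (P.ε * ψ) ∘ₗ h)
  replace hx : ∀ φ, (P.ε * ψ * h φ).trace = (x * φ).trace := hx
  have h1 : s • (P.ε * ψ) = D Q P (P.ε * x) * Q.ε := by
    rw [Matrix.ext_iff_trace_mul_right]
    intro φ
    have h2 : P.ε * (P.ε * x) * D P Q φ = x * D P Q φ := by rw [ε_ε_mul]
    rw [← trace_mul_D, h2, ← hx, Matrix.smul_mul, ← Matrix.mul_smul, ← hh φ, Matrix.mul_add,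
      Matrix.trace_add, trace_mul_D, hψ, Matrix.zero_mul, Matrix.zero_mul, Matrix.trace_zero,
      zero_add]
  refine ⟨-(x * Q.ε), ?_⟩
  have h3 := D_conj (P.ε * x : Matrix P.J Q.J S)
  rw [← h1, Matrix.mul_smul, ε_ε_mul, Matrix.mul_assoc, ε_ε_mul] at h3
  rw [map_neg, h3, neg_neg]

variable (𝒮) in
/-- The model of the residue field: one basis element, with zero differential. -/
def unit : FreeModel 𝒮 where
  J := PUnit
  decEq := Classical.decEq _
  degree _ := 0
  level _ := 0
  δ := 0
  mem _ _ := zero_mem _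
  odd _ _ h := absurd rfl h
  sq := Matrix.zero_mul _
  level_lt _ _ h := absurd rfl h

lemma D_unit (φ : Matrix (unit 𝒮).J (unit 𝒮).J S) : D (unit 𝒮) (unit 𝒮) φ = 0 := by
  rw [D_apply, show (unit 𝒮).δ = 0 from rfl, Matrix.zero_mul, Matrix.mul_zero, Matrix.mul_zero,
    Matrix.mul_zero, sub_zero]

/-- The homomorphisms from `unit` to `P` are `P` itself. A null-homotopy of multiplication by `s`
on `P` is an endomorphism of `P`, and its part of odd degree has the boundary `s`. -/
lemma exists_ann_unit_pow_le : ∃ l : ℕ, ann (unit 𝒮) P ^ l ≤ ann P P := by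
  obtain ⟨l, hl⟩ := exists_homotopy (unit 𝒮) P
  refine ⟨l, fun s hs => ?_⟩
  obtain ⟨h, hh⟩ : ∃ h : Matrix P.J PUnit S →ₗ[S] Matrix P.J PUnit S,
      ∀ φ, P.δ * h φ + h (P.δ * φ) = s • φ := by
    obtain ⟨h, hh⟩ := hl s hs
    have hD : ∀ φ, D (unit 𝒮) P φ = P.δ * φ := fun φ => by
      rw [D_apply, show (unit 𝒮).δ = 0 from rfl, Matrix.mul_zero, Matrix.mul_zero,
        Matrix.mul_zero, sub_zero]
    simp only [hD] at hh
    exact ⟨h, hh⟩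
  let H : Matrix P.J P.J S := Matrix.of fun i j => h (Matrix.single j PUnit.unit 1) i PUnit.unit
  have hH : ∀ φ : Matrix P.J PUnit S, H * φ = h φ := fun φ => by
    ext i j
    have h1 : φ = ∑ l, φ l PUnit.unit • Matrix.single l PUnit.unit (1 : S) := by
      conv_lhs => rw [Matrix.matrix_eq_sum_single φ]
      refine Finset.sum_congr rfl fun l _ => ?_
      rw [Finset.univ_unique, Finset.sum_singleton, Matrix.smul_single, smul_eq_mul, mul_one]
    conv_rhs => rw [h1]
    rw [map_sum, Matrix.sum_apply, Matrix.mul_apply]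
    refine Finset.sum_congr rfl fun l _ => ?_
    rw [map_smul, Matrix.smul_apply, smul_eq_mul, mul_comm]
    rfl
  have hs1 : P.δ * H + H * P.δ = s • 1 := by
    ext i j
    have h1 : (P.δ * H + H * P.δ) * Matrix.single j PUnit.unit (1 : S) =
        (s • (1 : Matrix P.J P.J S)) * Matrix.single j PUnit.unit (1 : S) := by
      rw [Matrix.smul_mul, Matrix.one_mul, Matrix.add_mul, Matrix.mul_assoc, Matrix.mul_assoc,
        hH, hH]
      exact hh _
    have h2 := congrFun (congrFun h1 i) PUnit.unit
    rwa [Matrix.mul_single_apply_same, Matrix.mul_single_apply_same, mul_one, mul_one] at h2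
  classical
  let H' : Matrix P.J P.J S :=
    Matrix.of fun i j => if Odd (P.degree i - P.degree j) then H i j else 0
  have hδ : P.δ * H' + H' * P.δ = s • 1 := by
    ext i j
    have h1 := congrFun (congrFun hs1 i) j
    rw [Matrix.add_apply, Matrix.mul_apply, Matrix.mul_apply] at h1 ⊢
    by_cases hij : Odd (P.degree i - P.degree j)
    · have hne : i ≠ j := by
        rintro rfl
        simp at hij
      rw [Matrix.smul_apply, Matrix.one_apply_ne hne, smul_zero, Finset.sum_eq_zero, zero_add,
        Finset.sum_eq_zero]
      · intro l _
        by_cases hl : P.δ l j = 0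
        · rw [hl, mul_zero]
        · have := P.odd _ _ hl
          have h3 : ¬ Odd (P.degree i - P.degree l) := by
            rw [Int.not_odd_iff_even]
            have := hij.sub_odd this
            rwa [sub_sub_sub_cancel_right] at this
          rw [show H' i l = 0 from if_neg h3, zero_mul]
      · intro l _
        by_cases hl : P.δ i l = 0
        · rw [hl, zero_mul]
        · have := P.odd _ _ hl
          have h3 : ¬ Odd (P.degree l - P.degree j) := by
            rw [Int.not_odd_iff_even]
            have := hij.sub_odd this
            rwa [sub_sub_sub_cancel_left] at this
          rw [show H' l j = 0 from if_neg h3, mul_zero]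
    · rw [← h1]
      rw [Int.not_odd_iff_even] at hij
      congr 1
      · refine Finset.sum_congr rfl fun l _ => ?_
        by_cases hl : P.δ i l = 0
        · rw [hl, zero_mul, zero_mul]
        · have := P.odd _ _ hl
          have h3 : Odd (P.degree l - P.degree j) := by
            have := hij.sub_odd this
            rwa [sub_sub_sub_cancel_left] at this
          rw [show H' l j = H l j from if_pos h3]
      · refine Finset.sum_congr rfl fun l _ => ?_
        by_cases hl : P.δ l j = 0
        · rw [hl, mul_zero, mul_zero]
        · have := P.odd _ _ hl
          have h3 : Odd (P.degree i - P.degree l) := by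
            have := hij.sub_odd this
            rwa [sub_sub_sub_cancel_right] at this
          rw [show H' i l = H i l from if_pos h3]
  have hε : P.ε * (H' * P.ε) = -H' := by
    ext i j
    rw [ε, Matrix.diagonal_mul, Matrix.mul_diagonal, Matrix.neg_apply]
    by_cases hij : Odd (P.degree i - P.degree j)
    · have h1 : (P.degree i).negOnePow = -(P.degree j).negOnePow := by
        rw [← sub_add_cancel (P.degree i) (P.degree j), Int.negOnePow_add,
          Int.negOnePow_odd _ hij]
        simp
      have h2 : ((P.degree j).negOnePow : S) * ((P.degree j).negOnePow : S) = 1 := by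
        rw [← Int.cast_mul, Int.units_coe_mul_self, Int.cast_one]
      rw [h1]
      push_cast
      linear_combination (-H' i j) * h2
    · have : H' i j = 0 := if_neg hij
      rw [this, zero_mul, mul_zero, neg_zero]
  have hDH : D P P H' = s • 1 := by
    have h1 : P.ε * (H' * (P.ε * P.δ)) = -(H' * P.δ) := by
      rw [← Matrix.mul_assoc H', ← Matrix.mul_assoc, hε, Matrix.neg_mul]
    rw [D_apply, h1, sub_neg_eq_add, hδ]
  exact mem_ann_left hDH

variable [GradedAlgebra 𝒮] (heven : ∀ n, Odd n → ∀ s ∈ 𝒮 n, s = 0)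

/-- The matrices of homomorphisms of degree `n`. -/
def homGr (P Q : FreeModel 𝒮) (n : ℤ) : Submodule k (Matrix Q.J P.J S) where
  carrier := {φ | ∀ i j, φ i j ∈ 𝒮 (n + P.degree j - Q.degree i)}
  add_mem' h h' i j := (𝒮 _).add_mem (h i j) (h' i j)
  zero_mem' _ _ := (𝒮 _).zero_mem
  smul_mem' r _ h i j := (𝒮 _).smul_mem r (h i j)

lemma homGr_isInternal : DirectSum.IsInternal (homGr P Q) := by
  classical
  let p : ℤ → Matrix Q.J P.J S →ₗ[k] Matrix Q.J P.J S := fun n =>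
    { toFun := fun φ => Matrix.of fun i j =>
        GradedAlgebra.proj 𝒮 (n + P.degree j - Q.degree i) (φ i j)
      map_add' := fun φ ψ => by
        ext i j
        exact (GradedAlgebra.proj 𝒮 _).map_add _ _
      map_smul' := fun r φ => by
        ext i j
        exact (GradedAlgebra.proj 𝒮 _).map_smul _ _ }
  refine isInternal_of_proj _ p (fun n φ hφ => ?_) (fun m n φ hφ hmn => ?_) fun φ => ?_
  · ext i j
    exact DirectSum.decompose_of_mem_same 𝒮 (hφ i j)
  · ext i j
    exact DirectSum.decompose_of_mem_ne 𝒮 (hφ i j) (by omega)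
  · rw [Matrix.matrix_eq_sum_single φ]
    refine Submodule.sum_mem _ fun i _ => Submodule.sum_mem _ fun j _ => ?_
    induction φ i j using DirectSum.Decomposition.inductionOn 𝒮 with
    | zero =>
      rw [Matrix.single_zero]
      exact zero_mem _
    | @homogeneous n x =>
      refine Submodule.mem_iSup_of_mem (n - P.degree j + Q.degree i) fun a b => ?_
      rw [Matrix.single_apply]
      split_ifs with hab
      · obtain ⟨rfl, rfl⟩ := hab
        have : n - P.degree j + Q.degree i + P.degree j - Q.degree i = n := by ring
        rw [this]
        exact x.2
      · exact zero_mem _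
    | add x y hx hy =>
      rw [Matrix.single_add]
      exact add_mem hx hy

include heven

omit [GradedAlgebra 𝒮] in
/-- On homomorphisms of degree `n` the operation `φ ↦ ε φ ε` is multiplication by `(-1)^n`. -/
lemma ε_mul_mul_ε {n : ℤ} {φ : Matrix Q.J P.J S} (hφ : φ ∈ homGr P Q n) :
    Q.ε * (φ * P.ε) = n.negOnePow • φ := by
  ext i j
  rw [ε, ε, Matrix.diagonal_mul, Matrix.mul_diagonal, Matrix.smul_apply]
  by_cases h : Odd (n + P.degree j - Q.degree i)
  · rw [heven _ h _ (hφ i j), smul_zero, zero_mul, mul_zero]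
  · rw [Int.not_odd_iff_even] at h
    have h1 : n.negOnePow = (Q.degree i).negOnePow * (P.degree j).negOnePow := by
      rw [← Int.negOnePow_add, Int.negOnePow_eq_iff]
      have := h.sub (even_two_mul (P.degree j))
      rwa [show n + P.degree j - Q.degree i - 2 * P.degree j =
        n - (Q.degree i + P.degree j) by ring] at this
    rw [h1, Units.smul_def, zsmul_eq_mul]
    push_cast
    ring

omit [GradedAlgebra 𝒮] in
lemma D_of_mem {n : ℤ} {φ : Matrix Q.J P.J S} (hφ : φ ∈ homGr P Q n) :
    D P Q φ = Q.δ * φ - n.negOnePow • (φ * P.δ) := by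
  rw [D_apply, ← Matrix.mul_assoc φ, ← Matrix.mul_assoc Q.ε, ε_mul_mul_ε heven hφ, Units.smul_def,
    Units.smul_def, Matrix.smul_mul]

lemma D_mem {n : ℤ} {φ : Matrix Q.J P.J S} (hφ : φ ∈ homGr P Q n) :
    D P Q φ ∈ homGr P Q (n - 1) := by
  intro i j
  rw [D_of_mem heven hφ, Matrix.sub_apply, Units.smul_def, Matrix.smul_apply, Matrix.mul_apply,
    Matrix.mul_apply]
  refine (𝒮 _).sub_mem (Submodule.sum_mem _ fun l _ => ?_)
    (zsmul_mem (Submodule.sum_mem _ fun l _ => ?_) _)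
  · have := SetLike.mul_mem_graded (Q.mem i l) (hφ l j)
    rwa [show Q.degree l - Q.degree i - 1 + (n + P.degree j - Q.degree l) =
      n - 1 + P.degree j - Q.degree i by ring] at this
  · have := SetLike.mul_mem_graded (hφ i l) (P.mem l j)
    rwa [show n + P.degree l - Q.degree i + (P.degree j - P.degree l - 1) =
      n - 1 + P.degree j - Q.degree i by ring] at this

variable (P Q) in
/-- The complex of homomorphisms from `P` to `Q`, as a DG module over `S`. -/
def hom : DGModule 𝒮 where
  carrier := Matrix Q.J P.J S
  gr := homGr P Q
  isInternal := homGr_isInternal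
  smul_mem := by
    intro m n a φ ha hφ i j
    have := SetLike.mul_mem_graded ha (hφ i j)
    rwa [← add_sub_assoc, ← add_assoc] at this
  d := (D P Q).restrictScalars k
  d_mem := D_mem heven
  d_d := D_D
  d_smul := by
    intro i a ha φ
    change D P Q (a • φ) = i.negOnePow • (a • D P Q φ)
    rw [map_smul]
    by_cases hi : Odd i
    · rw [heven i hi a ha, zero_smul, smul_zero]
    · rw [Int.negOnePow_even i (Int.not_odd_iff_even.mp hi), one_smul]

/-- If a power of the annihilator of the homology of one complex of homomorphisms annihilates the
homology of another one, then the homology of the latter does not grow faster. -/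
lemma shiftDominated_hom [IsNoetherianRing S] {P' Q' : FreeModel 𝒮} {l : ℕ}
    (hl : ann P Q ^ l ≤ ann P' Q') :
    ShiftDominated (fun n => Module.rank k ((hom P' Q' heven).homology n))
      (fun n => Module.rank k ((hom P Q heven).homology n)) := by
  have h1 : ∀ P Q : FreeModel 𝒮, Module.Finite S (hom P Q heven) := fun P Q =>
    inferInstanceAs (Module.Finite S (Matrix Q.J P.J S))
  have := h1 P Q
  have := h1 P' Q'
  exact shiftDominated_homology (X := hom P Q heven) (Y := hom P' Q' heven) (D := D P Q)
    (D' := D P' Q') (fun _ => rfl) (fun _ => rfl) hl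

end FreeModel

end DGModule

/-! ### Complexity of sequences -/

section Complexity

open Filter

lemma zpow_le_of_le_two_mul {m n : ℝ} (d : ℕ) (hn : 0 < n) (h1 : n ≤ 2 * m) (h2 : m ≤ 2 * n) :
    m ^ ((d : ℤ) - 1) ≤ 2 ^ (d + 1) * n ^ ((d : ℤ) - 1) := by
  have hm : 0 < m := by linarith
  rcases d with _ | d
  · have h3 : m⁻¹ ≤ 2 * n⁻¹ := by
      rw [inv_le_iff_one_le_mul₀ hm, mul_right_comm, ← div_eq_mul_inv, le_div_iff₀ hn]
      linarith
    simpa using h3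
  · have h3 : m ^ d ≤ (2 * n) ^ d := by gcongr
    have h4 : (2 : ℝ) ^ d ≤ 2 ^ (d + 1 + 1) := by
      gcongr
      · norm_num
      · omega
    have h5 : ((d + 1 : ℕ) : ℤ) - 1 = d := by
      push_cast
      ring
    rw [h5, zpow_natCast, zpow_natCast]
    rw [mul_pow] at h3
    exact h3.trans (by gcongr)

/-- A sequence that is bounded by a finite sum of shifts of another one does not have larger
complexity. -/
lemma ShiftDominated.seqComplexity_le {f g : ℤ → Cardinal.{u}} (h : ShiftDominated f g) :
    seqComplexity (fun n => Cardinal.toENat (f (-n))) ≤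
      seqComplexity (fun n => Cardinal.toENat (g (-n))) := by
  obtain ⟨L, hL⟩ := h
  refine sInf_le_sInf ?_
  rintro _ ⟨d, rfl, a, ha⟩
  refine ⟨d, rfl, ?_⟩
  suffices h : ∃ a : ℝ, 0 ≤ a ∧ ∀ᶠ n : ℤ in atTop,
      ((Cardinal.toENat (L.map fun s => g (-n + s)).sum : ℕ∞) : ENNReal) ≤
        ENNReal.ofReal (a * (n : ℝ) ^ ((d : ℤ) - 1)) by
    obtain ⟨a, -, h⟩ := h
    refine ⟨a, h.mono fun n hn => le_trans ?_ hn⟩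
    exact ENat.toENNReal_le.mpr (OrderHomClass.mono Cardinal.toENat (hL (-n)))
  clear hL
  induction L with
  | nil => exact ⟨0, le_rfl, Eventually.of_forall fun n => by simp⟩
  | cons s L ih =>
    obtain ⟨a', ha'0, ha'⟩ := ih
    refine ⟨|a| * 2 ^ (d + 1) + a', by positivity, ?_⟩
    have h1 : ∀ᶠ n : ℤ in atTop, ((Cardinal.toENat (g (-(n + -s))) : ℕ∞) : ENNReal) ≤
        ENNReal.ofReal (a * ((n + -s : ℤ) : ℝ) ^ ((d : ℤ) - 1)) :=
      (tendsto_atTop_add_const_right atTop (-s) tendsto_id).eventually ha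
    filter_upwards [ha', h1, eventually_gt_atTop (2 * |s|)] with n hn1 hn2 hn3
    have hs1 := neg_abs_le s
    have hs2 := le_abs_self s
    have hs3 := abs_nonneg s
    have hn0 : (0 : ℝ) < n := by
      have : 0 < n := by omega
      exact_mod_cast this
    have h3 : ((n + -s : ℤ) : ℝ) ^ ((d : ℤ) - 1) ≤ 2 ^ (d + 1) * (n : ℝ) ^ ((d : ℤ) - 1) := by
      refine zpow_le_of_le_two_mul d hn0 ?_ ?_
      · have : n ≤ 2 * (n + -s) := by omega
        exact_mod_cast this
      · have : n + -s ≤ 2 * n := by omega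
        exact_mod_cast this
    have h4 : (0 : ℝ) ≤ ((n + -s : ℤ) : ℝ) ^ ((d : ℤ) - 1) := by
      have : 0 ≤ n + -s := by omega
      exact zpow_nonneg (by exact_mod_cast this) _
    have h5 : (0 : ℝ) < (n : ℝ) ^ ((d : ℤ) - 1) := zpow_pos hn0 _
    rw [List.map_cons, List.sum_cons, map_add, ENat.toENNReal_add, add_mul,
      ENNReal.ofReal_add (by positivity) (by positivity)]
    refine add_le_add ?_ hn1
    rw [neg_add, neg_neg] at hn2
    refine hn2.trans (ENNReal.ofReal_le_ofReal ?_)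
    rw [mul_assoc]
    exact mul_le_mul (le_abs_self a) h3 h4 (abs_nonneg a)

/-- The exponents of the monomials of weight `n`. -/
def exponents {c : ℕ} (w : Fin c → ℕ) (n : ℕ) : Set (Fin c → ℕ) := {a | ∑ i, a i * w i = n}

lemma mk_exponents_le {d : ℕ} (w : Fin (d + 1) → ℕ) (hw : ∀ i, 0 < w i) (n : ℕ) :
    Cardinal.mk (exponents w n) ≤ ((n + 1) ^ d : ℕ) := by
  have hle : ∀ a ∈ exponents w n, ∀ i, a i < n + 1 := fun a ha i => by
    have h1 : a i * w i ≤ n := by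
      rw [← show ∑ i, a i * w i = n from ha]
      exact Finset.single_le_sum (f := fun i => a i * w i) (fun _ _ => Nat.zero_le _)
        (Finset.mem_univ i)
    have h2 := Nat.le_mul_of_pos_right (a i) (hw i)
    omega
  let F : exponents w n → (Fin d → Fin (n + 1)) := fun a i => ⟨a.1 i.succ, hle a.1 a.2 _⟩
  have hF : Function.Injective F := by
    rintro ⟨a, ha⟩ ⟨b, hb⟩ hab
    have h1 : ∀ i : Fin d, a i.succ = b i.succ := fun i => congrArg Fin.val (congrFun hab i)
    have h2 : a 0 = b 0 := by
      have ha' : ∑ i, a i * w i = n := ha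
      have hb' : ∑ i, b i * w i = n := hb
      rw [Fin.sum_univ_succ] at ha' hb'
      simp only [h1] at ha'
      exact Nat.eq_of_mul_eq_mul_right (hw 0) (by omega)
    exact Subtype.ext (funext fun i => Fin.cases h2 h1 i)
  refine (Cardinal.mk_le_of_injective hF).trans (le_of_eq ?_)
  simp

/-- In the degrees that are divisible by a suitable number, all but one of the exponents can be
chosen freely among the first `r` multiples of fixed numbers. -/
lemma exists_le_mk_exponents {d : ℕ} (w : Fin (d + 1) → ℕ) (hw : ∀ i, 0 < w i) :
    ∃ l : ℕ, 0 < l ∧ ∀ r : ℕ, ((r ^ d : ℕ) : Cardinal) ≤ Cardinal.mk (exponents w (l * r)) := by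
  let W : ℕ := ∏ i, w i
  have hW : 0 < W := Finset.prod_pos fun i _ => hw i
  have hq : ∀ i, W / w i * w i = W := fun i =>
    Nat.div_mul_cancel (Finset.dvd_prod_of_mem w (Finset.mem_univ i))
  have hq0 : ∀ i, 0 < W / w i := fun i => Nat.pos_of_mul_pos_right ((hq i).symm ▸ hW)
  refine ⟨W * (d + 1), by positivity, fun r => ?_⟩
  let G : (Fin d → Fin r) → Fin (d + 1) → ℕ := fun f =>
    Fin.cons (((d + 1) * r - ∑ i, (f i : ℕ)) * (W / w 0)) fun i => f i * (W / w i.succ)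
  have hG : ∀ f, G f ∈ exponents w (W * (d + 1) * r) := fun f => by
    change ∑ i, G f i * w i = _
    have h1 : ∑ i, (f i : ℕ) ≤ (d + 1) * r := by
      calc ∑ i, (f i : ℕ) ≤ ∑ _i : Fin d, r := Finset.sum_le_sum fun i _ => (f i).2.le
        _ = d * r := by simp
        _ ≤ _ := Nat.mul_le_mul_right r (Nat.le_succ d)
    rw [Fin.sum_univ_succ]
    simp only [G, Fin.cons_zero, Fin.cons_succ, mul_assoc, hq]
    rw [← Finset.sum_mul, ← add_mul, Nat.sub_add_cancel h1]
    ring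
  have hinj : Function.Injective fun f => (⟨G f, hG f⟩ : exponents w (W * (d + 1) * r)) := by
    intro f f' hff
    refine funext fun i => Fin.ext ?_
    have h1 : G f i.succ = G f' i.succ := congrFun (congrArg Subtype.val hff) i.succ
    simp only [G, Fin.cons_succ] at h1
    exact Nat.eq_of_mul_eq_mul_right (hq0 i.succ) h1
  refine le_trans (le_of_eq ?_) (Cardinal.mk_le_of_injective hinj)
  simp

/-- The number of monomials of weight `n` in `c` variables has complexity `c`. -/
lemma seqComplexity_eq_of_exponents {c : ℕ} (w : Fin c → ℕ) (hw : ∀ i, 0 < w i) (b : ℤ → ℕ∞)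
    (hb : ∀ n : ℕ, b n = Cardinal.toENat (Cardinal.mk (exponents w n))) :
    seqComplexity b = c := by
  refine le_antisymm (sInf_le ⟨c, rfl, ?_⟩) (le_sInf ?_)
  · rcases c with _ | d
    · refine ⟨0, (eventually_gt_atTop 0).mono fun n hn => ?_⟩
      lift n to ℕ using hn.le
      have : exponents w n = ∅ := by
        refine Set.eq_empty_of_forall_notMem fun a ha => ?_
        have : ∑ i, a i * w i = n := ha
        rw [Finset.univ_eq_empty, Finset.sum_empty] at this
        omega
      rw [hb, this]
      simp
    · refine ⟨2 ^ d, (eventually_gt_atTop 0).mono fun n hn => ?_⟩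
      lift n to ℕ using hn.le
      have h1 : b n ≤ ((n + 1) ^ d : ℕ) := by
        rw [hb]
        exact (OrderHomClass.mono Cardinal.toENat (mk_exponents_le w hw n)).trans (by simp)
      refine (ENat.toENNReal_le.mpr h1).trans ?_
      rw [ENat.toENNReal_coe, ← ENNReal.ofReal_natCast]
      refine ENNReal.ofReal_le_ofReal ?_
      have h2 : ((d + 1 : ℕ) : ℤ) - 1 = d := by
        push_cast
        ring
      rw [h2, zpow_natCast, ← mul_pow, Int.cast_natCast, Nat.cast_pow]
      have h3 : (1 : ℝ) ≤ n := by
        have : 1 ≤ n := by omega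
        exact_mod_cast this
      gcongr
      push_cast
      linarith
  · rintro _ ⟨d', rfl, a, ha⟩
    by_contra hlt
    have hlt' : d' < c := by
      have := not_le.mp hlt
      exact_mod_cast this
    obtain ⟨d, rfl⟩ : ∃ d, c = d + 1 := ⟨c - 1, by omega⟩
    obtain ⟨l, hl, hlr⟩ := exists_le_mk_exponents w hw
    obtain ⟨N, hN⟩ := eventually_atTop.mp ha
    obtain ⟨r, hr⟩ := exists_nat_gt (max (max 1 (N : ℝ)) (|a| * (l : ℝ) ^ d))
    rw [max_lt_iff, max_lt_iff] at hr
    obtain ⟨⟨hr1, hrN⟩, hra⟩ := hr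
    have hl1 : (1 : ℝ) ≤ l := by exact_mod_cast hl
    have hr0 : (0 : ℝ) < r := by linarith
    have hlr0 : (1 : ℝ) ≤ l * r := by nlinarith
    have hNr : N ≤ ((l * r : ℕ) : ℤ) := by
      have : (N : ℝ) ≤ l * r := by nlinarith
      exact_mod_cast this
    have h1 := hN _ hNr
    rw [hb] at h1
    have h2 : ((r ^ d : ℕ) : ℕ∞) ≤ Cardinal.toENat (Cardinal.mk (exponents w (l * r))) :=
      le_trans (by simp) (OrderHomClass.mono Cardinal.toENat (hlr r))
    have h3 := (ENat.toENNReal_le.mpr h2).trans h1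
    rw [ENat.toENNReal_coe, ← ENNReal.ofReal_natCast] at h3
    have h4 : ((r ^ d : ℕ) : ℝ) ≤ |a| * ((l * r : ℝ)) ^ ((d : ℤ) - 1) := by
      have h5 : a * (((l * r : ℕ) : ℤ) : ℝ) ^ ((d' : ℤ) - 1) ≤
          |a| * ((l * r : ℝ)) ^ ((d : ℤ) - 1) := by
        push_cast
        refine mul_le_mul (le_abs_self a) (zpow_le_zpow_right₀ hlr0 (by omega)) (by positivity)
          (abs_nonneg a)
      have h6 := h3.trans (ENNReal.ofReal_le_ofReal h5)
      exact (ENNReal.ofReal_le_ofReal_iff (by positivity)).mp h6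
    have hlr' : (l * r : ℝ) ≠ 0 := by positivity
    rw [zpow_sub_one₀ hlr', zpow_natCast, mul_pow, Nat.cast_pow, ← mul_assoc,
      ← div_eq_mul_inv, le_div_iff₀ (by positivity)] at h4
    have h7 : (l * r : ℝ) * r ^ d ≤ (|a| * l ^ d) * r ^ d := by nlinarith
    have h8 := le_of_mul_le_mul_right h7 (by positivity)
    nlinarith

end Complexity

/-! ### The complex of matrices computes Ext -/

namespace DGModule

section Poly

variable {k : Type u} [Field k] {c : ℕ}

/-- The polynomial ring on variables `X_i` of homological degree `-(deg i + 1)`. -/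
def polyGr (k : Type u) [Field k] (deg : Fin c → ℤ) :
    ℤ → Submodule k (MvPolynomial (Fin c) k) :=
  MvPolynomial.weightedHomogeneousSubmodule k fun i => -AdaptedBasis.wt deg i

instance (deg : Fin c → ℤ) : GradedAlgebra (polyGr k deg) :=
  MvPolynomial.weightedGradedAlgebra k fun i => -AdaptedBasis.wt deg i

variable {deg : Fin c → ℤ}

lemma weight_neg_wt (m : Fin c →₀ ℕ) : Finsupp.weight (fun i => -AdaptedBasis.wt deg i) m =
    -Finsupp.weight (AdaptedBasis.wt deg) m := by
  simp [Finsupp.weight_eq_sum]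

lemma mem_polyGr {n : ℤ} {p : MvPolynomial (Fin c) k} : p ∈ polyGr k deg n ↔
    ∀ m, p.coeff m ≠ 0 → Finsupp.weight (AdaptedBasis.wt deg) m = -n := by
  refine forall_congr' fun m => forall_congr' fun _ => ?_
  rw [weight_neg_wt, neg_eq_iff_eq_neg]

lemma monomial_mem_polyGr {n : ℤ} {m : Fin c →₀ ℕ} (r : k)
    (h : Finsupp.weight (AdaptedBasis.wt deg) m = -n) :
    MvPolynomial.monomial m r ∈ polyGr k deg n :=
  MvPolynomial.isWeightedHomogeneous_monomial _ _ _ (by rw [weight_neg_wt, h, neg_neg])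

lemma polyGr_eq_zero_of_odd (hdeg : ∀ i, Odd (deg i)) (n : ℤ) (hn : Odd n)
    (p : MvPolynomial (Fin c) k) (hp : p ∈ polyGr k deg n) : p = 0 := by
  ext m
  by_contra hm
  have h1 := mem_polyGr.mp hp m hm
  have h2 : Even (Finsupp.weight (AdaptedBasis.wt deg) m) := by
    rw [Finsupp.weight_eq_sum]
    refine Finset.even_sum _ fun i _ => ?_
    rw [nsmul_eq_mul]
    exact (hdeg i).add_one.mul_left _
  rw [h1, even_neg] at h2
  exact (Int.not_even_iff_odd.mpr hn) h2

lemma le_weight (hdeg : ∀ i, 0 < deg i) (m : Fin c →₀ ℕ) (i : Fin c) :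
    (m i : ℤ) ≤ Finsupp.weight (AdaptedBasis.wt deg) m := by
  have hw : ∀ j, (m j : ℤ) ≤ m j • AdaptedBasis.wt deg j := fun j => by
    rw [nsmul_eq_mul, AdaptedBasis.wt]
    have := hdeg j
    nlinarith [Int.natCast_nonneg (m j)]
  rw [Finsupp.weight_eq_sum]
  exact (hw i).trans (Finset.single_le_sum (f := fun j => m j • AdaptedBasis.wt deg j)
    (fun j _ => (Int.natCast_nonneg _).trans (hw j)) (Finset.mem_univ i))

lemma finite_weight_eq (hdeg : ∀ i, 0 < deg i) (n : ℤ) :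
    {m : Fin c →₀ ℕ | Finsupp.weight (AdaptedBasis.wt deg) m = n}.Finite := by
  refine (Set.finite_Iic (Finsupp.equivFunOnFinite.symm fun _ : Fin c => n.toNat)).subset ?_
  intro m hm i
  have h1 : Finsupp.weight (AdaptedBasis.wt deg) m = n := hm
  have := le_weight hdeg m i
  change m i ≤ n.toNat
  omega

end Poly

namespace AdaptedBasis

variable {k A : Type u} [Field k] [Ring A] [Algebra k A] {𝒜 : ℤ → Submodule k A}
  [GradedAlgebra 𝒜] {c : ℕ} {deg : Fin c → ℤ} {ξ : Fin c → A} {U V : DGModule 𝒜}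
  (W : AdaptedBasis ξ U) (W' : AdaptedBasis ξ V)

instance : DecidableEq W.J := Classical.decEq _

/-- The matrix of an endomorphism, with entries considered as constant polynomials. -/
def constMatrix : Module.End k U →+* Matrix W.J W.J (MvPolynomial (Fin c) k) :=
  (MvPolynomial.C.mapMatrix).comp (LinearMap.toMatrixAlgEquiv W.b : Module.End k U →+* _)

omit [GradedAlgebra 𝒜] in
lemma constMatrix_apply (f : Module.End k U) (i j : W.J) :
    W.constMatrix f i j = MvPolynomial.C (W.b.repr (f (W.b j)) i) := by
  change MvPolynomial.C (LinearMap.toMatrixAlgEquiv W.b f i j) = _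
  rw [LinearMap.toMatrixAlgEquiv_apply]

/-- The matrix of the differential `d - ∑ X_s ξ_s` of the DG module over the polynomial ring that
corresponds to `U`. -/
def bggMatrix : Matrix W.J W.J (MvPolynomial (Fin c) k) :=
  W.constMatrix U.d - ∑ s, MvPolynomial.X (R := k) s • W.constMatrix (gen ξ U s)

omit [GradedAlgebra 𝒜] in
lemma bggMatrix_apply (i j : W.J) : W.bggMatrix i j = MvPolynomial.C (W.b.repr (U.d (W.b j)) i) -
    ∑ s, MvPolynomial.X s * MvPolynomial.C (W.b.repr (ξ s • W.b j) i) := by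
  rw [bggMatrix, Matrix.sub_apply, Matrix.sum_apply, constMatrix_apply]
  simp only [Matrix.smul_apply, constMatrix_apply, smul_eq_mul, gen_apply]

omit [GradedAlgebra 𝒜] in
lemma bggMatrix_mem (h : IsExteriorOn 𝒜 deg ξ) (i j : W.J) :
    W.bggMatrix i j ∈ polyGr k deg (W.degree j - W.degree i - 1) := by
  rw [bggMatrix_apply]
  refine (polyGr k deg _).sub_mem ?_ (Submodule.sum_mem _ fun s _ => ?_)
  · by_cases hi : W.degree i = W.degree j - 1
    · rw [hi, sub_sub_cancel, sub_self]
      exact MvPolynomial.isWeightedHomogeneous_C _ _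
    · rw [W.repr_eq_zero (U.d_mem (W.mem j)) hi, map_zero]
      exact zero_mem _
  · by_cases hi : W.degree i = deg s + W.degree j
    · have h1 := (MvPolynomial.isWeightedHomogeneous_X k (fun i => -wt deg i) s).mul
        (MvPolynomial.isWeightedHomogeneous_C _ (W.b.repr (ξ s • W.b j) i))
      have h2 : W.degree j - W.degree i - 1 = -wt deg s + 0 := by
        rw [hi, wt]
        ring
      rw [h2]
      exact h1
    · rw [W.repr_eq_zero (U.smul_mem (h.mem s) (W.mem j)) hi, map_zero, mul_zero]
      exact zero_mem _

omit [GradedAlgebra 𝒜] in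
lemma bggMatrix_sq (h : IsExteriorOn 𝒜 deg ξ) (hdeg : ∀ i, Odd (deg i)) :
    W.bggMatrix * W.bggMatrix = 0 := by
  have hd : ∀ s, U.d * gen ξ U s = -(gen ξ U s * U.d) := fun s => by
    refine LinearMap.ext fun u => ?_
    change U.d (ξ s • u) = -(ξ s • U.d u)
    rw [U.d_smul (h.mem s), Int.negOnePow_odd _ (hdeg s)]
    simp
  have hg : ∀ s t, gen ξ U s * gen ξ U t = -(gen ξ U t * gen ξ U s) := fun s t => by
    refine LinearMap.ext fun u => ?_
    change ξ s • ξ t • u = -(ξ t • ξ s • u)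
    rw [smul_smul, smul_smul, h.gen_mul_gen, neg_smul]
  have key := KoszulOperators.sq_eq_zero (e := W.constMatrix U.d)
    (L := fun s => W.constMatrix (gen ξ U s))
    (ω := fun s => Matrix.scalar W.J (-MvPolynomial.X (R := k) s)) ?_ ?_ ?_ ?_ ?_ ?_ ?_
  · have h1 : W.bggMatrix = W.constMatrix U.d +
        ∑ s, Matrix.scalar W.J (-MvPolynomial.X (R := k) s) * W.constMatrix (gen ξ U s) := by
      rw [bggMatrix, sub_eq_add_neg, ← Finset.sum_neg_distrib]
      congr 1
      refine Finset.sum_congr rfl fun s _ => ?_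
      rw [map_neg, neg_mul, Matrix.scalar_apply, ← Matrix.smul_eq_diagonal_mul]
    rw [h1]
    exact key
  · rw [← map_mul, show U.d * U.d = 0 from LinearMap.ext U.d_d, map_zero]
  · intro s
    rw [← map_mul, ← map_mul, hd, map_neg]
  · intro s
    rw [← map_mul, show gen ξ U s * gen ξ U s = 0 from LinearMap.ext fun u => by
      change ξ s • ξ s • u = 0
      rw [smul_smul, h.gen_mul_self, zero_smul], map_zero]
  · intro s t
    rw [← map_mul, ← map_mul, hg, map_neg]
  · exact fun s => Matrix.scalar_commute _ (fun _ => Commute.all _ _) _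
  · exact fun s t => Matrix.scalar_commute _ (fun _ => Commute.all _ _) _
  · exact fun s t => Matrix.scalar_commute _ (fun _ => Commute.all _ _) _

/-- The DG module `k[X] ⊗ U` over the polynomial ring that corresponds to `U`. -/
def model (h : IsExteriorOn 𝒜 deg ξ) (hdeg : ∀ i, Odd (deg i)) : FreeModel (polyGr k deg) where
  J := W.J
  degree := W.degree
  level := W.level
  δ := W.bggMatrix
  mem := W.bggMatrix_mem h
  odd i j hij := by
    by_contra hodd
    refine hij (polyGr_eq_zero_of_odd hdeg _ ?_ _ (W.bggMatrix_mem h i j))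
    rw [Int.not_odd_iff_even, ← even_neg, neg_sub] at hodd
    exact hodd.sub_odd odd_one
  sq := W.bggMatrix_sq h hdeg
  level_lt i j hij := by
    by_contra hlt
    refine hij ?_
    have h1 : W.b.repr (U.d (W.b j)) i = 0 := by
      by_contra h0
      exact hlt (W.level_d _ _ h0)
    have h2 : ∀ s, W.b.repr (ξ s • W.b j) i = 0 := fun s => by
      by_contra h0
      exact hlt (W.level_smul _ _ _ h0)
    rw [bggMatrix_apply, h1]
    simp [h2]

/-- The linear map from `U` to `V` given by the coefficients of the monomial `X^m` in a matrix of
polynomials. -/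
def coeffHom (m : Fin c →₀ ℕ) :
    Matrix W'.J W.J (MvPolynomial (Fin c) k) →ₗ[k] (U →ₗ[k] V) :=
  (Matrix.toLin W.b W'.b).toLinearMap ∘ₗ (MvPolynomial.lcoeff k m).mapMatrix

section CoeffHom

variable {W W'}
omit [GradedAlgebra 𝒜]

lemma coeffHom_basis (m : Fin c →₀ ℕ) (φ : Matrix W'.J W.J (MvPolynomial (Fin c) k)) (j : W.J) :
    W.coeffHom W' m φ (W.b j) = ∑ i, (φ i j).coeff m • W'.b i :=
  Matrix.toLin_self W.b W'.b _ j

lemma coeffHom_constMatrix_mul (m : Fin c →₀ ℕ) (f : Module.End k V)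
    (φ : Matrix W'.J W.J (MvPolynomial (Fin c) k)) :
    W.coeffHom W' m (W'.constMatrix f * φ) = f ∘ₗ W.coeffHom W' m φ := by
  refine W.b.ext fun j => ?_
  rw [LinearMap.comp_apply, coeffHom_basis, coeffHom_basis, map_sum]
  have h1 : ∀ l, f ((φ l j).coeff m • W'.b l) =
      ∑ i, ((φ l j).coeff m * W'.b.repr (f (W'.b l)) i) • W'.b i := fun l => by
    conv_lhs => rw [map_smul, ← W'.b.sum_repr (f (W'.b l)), Finset.smul_sum]
    exact Finset.sum_congr rfl fun i _ => smul_smul _ _ _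
  rw [Finset.sum_congr rfl fun l _ => h1 l, Finset.sum_comm]
  refine Finset.sum_congr rfl fun i _ => ?_
  rw [Matrix.mul_apply, MvPolynomial.coeff_sum, Finset.sum_smul]
  refine Finset.sum_congr rfl fun l _ => ?_
  rw [constMatrix_apply, MvPolynomial.coeff_C_mul, mul_comm]

lemma coeffHom_mul_constMatrix (m : Fin c →₀ ℕ) (f : Module.End k U)
    (φ : Matrix W'.J W.J (MvPolynomial (Fin c) k)) :
    W.coeffHom W' m (φ * W.constMatrix f) = W.coeffHom W' m φ ∘ₗ f := by
  refine W.b.ext fun j => ?_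
  rw [LinearMap.comp_apply, coeffHom_basis]
  conv_rhs => rw [← W.b.sum_repr (f (W.b j)), map_sum]
  simp only [map_smul, coeffHom_basis, Finset.smul_sum]
  rw [Finset.sum_comm]
  refine Finset.sum_congr rfl fun i _ => ?_
  rw [Matrix.mul_apply, MvPolynomial.coeff_sum, Finset.sum_smul]
  refine Finset.sum_congr rfl fun l _ => ?_
  rw [constMatrix_apply, mul_comm (φ i l), MvPolynomial.coeff_C_mul, smul_smul]

lemma coeffHom_X_smul (m : Fin c →₀ ℕ) (s : Fin c)
    (φ : Matrix W'.J W.J (MvPolynomial (Fin c) k)) :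
    W.coeffHom W' m (MvPolynomial.X (R := k) s • φ) =
      if m s = 0 then 0 else W.coeffHom W' (m - Finsupp.single s 1) φ := by
  refine W.b.ext fun j => ?_
  rw [coeffHom_basis]
  simp only [Matrix.smul_apply, smul_eq_mul, MvPolynomial.coeff_X_mul', Finsupp.mem_support_iff]
  by_cases hs : m s = 0
  · simp [hs]
  · rw [if_neg hs, coeffHom_basis]
    simp [hs]

lemma coeffHom_bggMatrix_mul (m : Fin c →₀ ℕ) (φ : Matrix W'.J W.J (MvPolynomial (Fin c) k))
    (u : U) : W.coeffHom W' m (W'.bggMatrix * φ) u = V.d (W.coeffHom W' m φ u) -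
      ∑ s, if m s = 0 then 0 else ξ s • W.coeffHom W' (m - Finsupp.single s 1) φ u := by
  rw [bggMatrix, Matrix.sub_mul, Matrix.sum_mul, map_sub, map_sum, LinearMap.sub_apply,
    coeffHom_constMatrix_mul, LinearMap.comp_apply, LinearMap.sum_apply]
  congr 1
  refine Finset.sum_congr rfl fun s _ => ?_
  rw [Matrix.smul_mul, coeffHom_X_smul]
  split_ifs
  · rfl
  · rw [coeffHom_constMatrix_mul]
    rfl

lemma coeffHom_mul_bggMatrix (m : Fin c →₀ ℕ) (φ : Matrix W'.J W.J (MvPolynomial (Fin c) k))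
    (u : U) : W.coeffHom W' m (φ * W.bggMatrix) u = W.coeffHom W' m φ (U.d u) -
      ∑ s, if m s = 0 then 0 else W.coeffHom W' (m - Finsupp.single s 1) φ (ξ s • u) := by
  rw [bggMatrix, Matrix.mul_sub, Matrix.mul_sum, map_sub, map_sum, LinearMap.sub_apply,
    coeffHom_mul_constMatrix, LinearMap.comp_apply, LinearMap.sum_apply]
  congr 1
  refine Finset.sum_congr rfl fun s _ => ?_
  rw [Matrix.mul_smul, coeffHom_X_smul]
  split_ifs
  · rfl
  · rw [coeffHom_mul_constMatrix]
    rfl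

end CoeffHom

/-- The homomorphism of degree `n` from the Koszul resolution of `U` to `V` given by a matrix of
polynomials: it sends `a ⊗ γ^(m) ⊗ u` to `(-1)^{n|a|} a φ_m(u)`, where `φ_m` is the coefficient of
`X^m`. -/
def realize (n : ℤ) : Matrix W'.J W.J (MvPolynomial (Fin c) k) →ₗ[k] (W.Koszul →ₗ[k] V) where
  toFun φ := Finsupp.lsum k fun t =>
    ((LinearMap.toSpanSingleton A V (W.coeffHom W' t.1 φ (W.b t.2))).restrictScalars k) ∘ₗ
      twist 𝒜 n
  map_add' φ ψ := koszul_ext fun m j a => by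
    simp [smul_add]
  map_smul' r φ := koszul_ext fun m j a => by
    simp [smul_algebra_smul_comm]

variable {W W'}

lemma realize_tmul (n : ℤ) (φ : Matrix W'.J W.J (MvPolynomial (Fin c) k)) (m : Fin c →₀ ℕ)
    (a : A) (u : U) :
    W.realize W' n φ (W.tmul m a u) = twist 𝒜 n a • W.coeffHom W' m φ u := by
  refine LinearMap.congr_fun (f := W.realize W' n φ ∘ₗ W.tmul m a)
    (g := Module.toModuleEnd k (S := A) V (twist 𝒜 n a) ∘ₗ W.coeffHom W' m φ)
    (W.b.ext fun j => ?_) u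
  rw [LinearMap.comp_apply, tmul_basis, LinearMap.comp_apply]
  change Finsupp.lsum k _ _ = _
  rw [Finsupp.lsum_single]
  rfl

lemma realize_injective (n : ℤ) : Function.Injective (W.realize W' n) := by
  rw [← LinearMap.ker_eq_bot, LinearMap.ker_eq_bot']
  intro φ hφ
  ext i j m
  have h1 := realize_tmul n φ m 1 (W.b j)
  rw [hφ, LinearMap.zero_apply, twist_one, one_smul, coeffHom_basis] at h1
  have h2 := congrArg (fun v => W'.b.repr v i) h1
  simpa [Finsupp.single_apply] using h2.symm

variable (h : IsExteriorOn 𝒜 deg ξ) (hdeg : ∀ i, 0 < deg i ∧ Odd (deg i))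

lemma realize_mem {n : ℤ} {φ : Matrix W'.J W.J (MvPolynomial (Fin c) k)}
    (hφ : φ ∈ FreeModel.homGr (W.model h fun i => (hdeg i).2)
      (W'.model h fun i => (hdeg i).2) (-n)) :
    W.realize W' n φ ∈ homDeg (W.koszul h fun i => (hdeg i).2) V n := by
  have hodd := fun i => (hdeg i).2
  obtain ⟨f, hf, hfy⟩ := exists_homDeg n (W.koszulBasis h hodd) (W.koszulDeg deg)
    (W.koszulBasis_mem h hodd) (fun t => W.coeffHom W' t.1 φ (W.b t.2)) (fun t => by
      rw [coeffHom_basis]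
      refine Submodule.sum_mem _ fun i _ => ?_
      by_cases hi : (φ i t.2).coeff t.1 = 0
      · rw [hi, zero_smul]
        exact zero_mem _
      · have h1 := mem_polyGr.mp (hφ i t.2) t.1 hi
        change Finsupp.weight (wt deg) t.1 = -(-n + W.degree t.2 - W'.degree i) at h1
        have h2 : W.koszulDeg deg t - n = W'.degree i := by
          rw [koszulDeg, h1]
          ring
        rw [h2]
        exact Submodule.smul_mem _ _ (W'.mem i))
  have : W.realize W' n φ = f := koszul_ext fun m j a => by
    have h1 := homDeg_smul hf a (W.koszulBasis h hodd (m, j))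
    rw [hfy] at h1
    have h2 : f (a • W.koszulBasis h hodd (m, j)) = f (W.tmul m a (W.b j)) := by
      rw [koszulBasis_apply]
      exact congrArg f ((W.smul_tmul a 1 m (W.b j)).trans (by rw [mul_one]))
    rw [← tmul_basis, realize_tmul, ← h1]
    exact h2
  rw [this]
  exact hf

lemma exists_realize {n : ℤ} {f : W.Koszul →ₗ[k] V}
    (hf : f ∈ homDeg (W.koszul h fun i => (hdeg i).2) V n) :
    ∃ φ ∈ FreeModel.homGr (W.model h fun i => (hdeg i).2) (W'.model h fun i => (hdeg i).2) (-n),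
      W.realize W' n φ = f := by
  have hodd := fun i => (hdeg i).2
  have hfin := finite_weight_eq fun i => (hdeg i).1
  let φ : Matrix W'.J W.J (MvPolynomial (Fin c) k) := Matrix.of fun i j =>
    ∑ m ∈ (hfin (n + W'.degree i - W.degree j)).toFinset,
      MvPolynomial.monomial m (W'.b.repr (f (W.tmul m 1 (W.b j))) i)
  have hφ : φ ∈ FreeModel.homGr (W.model h hodd) (W'.model h hodd) (-n) := fun i j => by
    refine Submodule.sum_mem _ fun m hm => monomial_mem_polyGr _ ?_
    have h1 : Finsupp.weight (wt deg) m = n + W'.degree i - W.degree j := by simpa using hm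
    change _ = -(-n + W.degree j - W'.degree i)
    rw [h1]
    ring
  refine ⟨φ, hφ, homDeg_ext (realize_mem h hdeg hφ) hf (W.koszulBasis h hodd) fun t => ?_⟩
  obtain ⟨m, j⟩ := t
  rw [koszulBasis_apply]
  refine (realize_tmul n φ m 1 (W.b j)).trans ?_
  rw [twist_one, one_smul, coeffHom_basis]
  refine (Finset.sum_congr rfl fun i _ => ?_).trans (W'.b.sum_repr (f (W.tmul m 1 (W.b j))))
  congr 1
  change MvPolynomial.coeff m (∑ m ∈ (hfin (n + W'.degree i - W.degree j)).toFinset,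
      MvPolynomial.monomial m (W'.b.repr (f (W.tmul m 1 (W.b j))) i)) = _
  rw [MvPolynomial.coeff_sum]
  simp only [MvPolynomial.coeff_monomial, Finset.sum_ite_eq', Set.Finite.mem_toFinset,
    Set.mem_ofPred_eq]
  split_ifs with hm
  · rfl
  · have h1 := hf.1 _ _ (W.koszulBasis_mem h hodd (m, j))
    rw [koszulBasis_apply] at h1
    refine (W'.repr_eq_zero h1 ?_).symm
    intro hi
    rw [hi, koszulDeg] at hm
    refine hm ?_
    change _ = n + (Finsupp.weight (wt deg) m + W.degree j - n) - W.degree j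
    ring

lemma homD_realize {n : ℤ} {φ : Matrix W'.J W.J (MvPolynomial (Fin c) k)}
    (hφ : φ ∈ FreeModel.homGr (W.model h fun i => (hdeg i).2)
      (W'.model h fun i => (hdeg i).2) (-n)) :
    homD (W.koszul h fun i => (hdeg i).2) V n (W.realize W' n φ) =
      W.realize W' (n + 1) (FreeModel.D (W.model h fun i => (hdeg i).2)
        (W'.model h fun i => (hdeg i).2) φ) := by
  have hodd := fun i => (hdeg i).2
  have heven := polyGr_eq_zero_of_odd (k := k) hodd
  have hD := FreeModel.D_mem heven hφ
  rw [show -n - 1 = -(n + 1) by ring] at hD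
  refine homDeg_ext (homD_mem (realize_mem h hdeg hφ)) (realize_mem h hdeg hD)
    (W.koszulBasis h hodd) fun t => ?_
  obtain ⟨m, j⟩ := t
  rw [koszulBasis_apply]
  have hr : W.realize W' (n + 1) (FreeModel.D (W.model h hodd) (W'.model h hodd) φ)
      (W.tmul m 1 (W.b j)) = W.coeffHom W' m (W'.bggMatrix * φ) (W.b j) -
        n.negOnePow • W.coeffHom W' m (φ * W.bggMatrix) (W.b j) := by
    have hDφ : (FreeModel.D (W.model h hodd) (W'.model h hodd) φ :
        Matrix W'.J W.J (MvPolynomial (Fin c) k)) =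
          W'.bggMatrix * φ - n.negOnePow • (φ * W.bggMatrix) :=
      (FreeModel.D_of_mem heven hφ).trans (by rw [Int.negOnePow_neg]; rfl)
    refine (congrArg (fun χ => W.realize W' (n + 1) χ (W.tmul m 1 (W.b j))) hDφ).trans ?_
    rw [realize_tmul, twist_one, one_smul, map_sub, LinearMap.sub_apply, Units.smul_def, map_zsmul]
    rfl
  have hl : W.realize W' n φ (W.koszulD (W.tmul m 1 (W.b j))) =
      W.coeffHom W' m φ (U.d (W.b j)) + ∑ s, if m s = 0 then 0 else
        n.negOnePow • (ξ s • W.coeffHom W' (m - Finsupp.single s 1) φ (W.b j)) -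
          W.coeffHom W' (m - Finsupp.single s 1) φ (ξ s • W.b j) := by
    rw [koszulD_tmul, map_add, map_sum, signMap_one, realize_tmul, twist_one, one_smul]
    congr 1
    refine Finset.sum_congr rfl fun s _ => ?_
    split_ifs
    · exact map_zero _
    · have h1 : n * deg s = n + n * (deg s - 1) := by ring
      have h2 : Even (deg s - 1) := (hodd s).sub_odd odd_one
      rw [map_sub, realize_tmul, realize_tmul, mul_one, twist_one, one_smul,
        twist_of_mem (h.mem s), h1, Int.negOnePow_add, Int.negOnePow_even _ (h2.mul_left n),
        mul_one, Units.smul_def, smul_assoc]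
      rfl
  have hl0 : W.realize W' n φ (W.tmul m 1 (W.b j)) = W.coeffHom W' m φ (W.b j) := by
    rw [realize_tmul, twist_one, one_smul]
  refine Eq.trans ?_ hr.symm
  refine (congrArg₂ (fun x y => V.d x - n.negOnePow • y) hl0 hl).trans ?_
  rw [coeffHom_bggMatrix_mul, coeffHom_mul_bggMatrix]
  have hσ : ∀ v : V, n.negOnePow • n.negOnePow • v = v := fun v => by
    rw [smul_smul, Int.units_mul_self, one_smul]
  have hsum : (∑ s, if m s = 0 then 0 else
        n.negOnePow • (ξ s • W.coeffHom W' (m - Finsupp.single s 1) φ (W.b j)) -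
          W.coeffHom W' (m - Finsupp.single s 1) φ (ξ s • W.b j)) =
      n.negOnePow • (∑ s, if m s = 0 then 0 else
        ξ s • W.coeffHom W' (m - Finsupp.single s 1) φ (W.b j)) -
      ∑ s, if m s = 0 then 0 else
          W.coeffHom W' (m - Finsupp.single s 1) φ (ξ s • W.b j) := by
    rw [Finset.smul_sum, ← Finset.sum_sub_distrib]
    refine Finset.sum_congr rfl fun s _ => ?_
    split_ifs
    · simp
    · rfl
  rw [hsum, smul_add, smul_sub, hσ, smul_sub]
  abel

/-- The complex of matrices computes Ext. -/
lemma rank_ext (n : ℤ) : Module.rank k (Ext U V n) =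
    Module.rank k ((FreeModel.hom (W.model h fun i => (hdeg i).2)
      (W'.model h fun i => (hdeg i).2)
      (polyGr_eq_zero_of_odd fun i => (hdeg i).2)).homology (-n)) := by
  have hodd := fun i => (hdeg i).2
  obtain ⟨e⟩ := SemifreeResolution.nonempty_equiv (resolution U) (W.koszulResolution h hdeg) V n
  let P := W.model h hodd
  let Q := W'.model h hodd
  refine e.rank_eq.trans (Classical.choice (nonempty_quotient_equiv (Z := (FreeModel.homGr P Q (-n) ⊓
      LinearMap.ker ((FreeModel.D P Q).restrictScalars k)))
    (B := (FreeModel.homGr P Q (-n + 1)).map ((FreeModel.D P Q).restrictScalars k))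
    (Z' := homCocycles (W.koszul h hodd) V n) (B' := homCoboundaries (W.koszul h hodd) V n)
    (W.realize W' n) ?_ ?_ ?_)).rank_eq.symm
  · rintro φ ⟨hφ, hD⟩
    refine ⟨realize_mem h hdeg hφ, ?_⟩
    have hD' : FreeModel.D P Q φ = 0 := hD
    exact (homD_realize h hdeg hφ).trans
      ((congrArg (W.realize W' (n + 1)) hD').trans (map_zero _))
  · rintro φ ⟨hφ, -⟩
    have hn : -n + 1 = -(n - 1) := by ring
    constructor
    · rintro ⟨f, hf, hfφ⟩
      obtain ⟨ψ, hψ, rfl⟩ := exists_realize (W' := W') h hdeg hf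
      rw [homD_realize h hdeg hψ, sub_add_cancel] at hfφ
      exact ⟨ψ, by rw [hn]; exact hψ, realize_injective n hfφ⟩
    · rintro ⟨ψ, hψ, rfl⟩
      rw [hn] at hψ
      refine ⟨W.realize W' (n - 1) ψ, realize_mem h hdeg hψ, ?_⟩
      rw [homD_realize h hdeg hψ, sub_add_cancel]
      rfl
  · rintro f ⟨hf, hfD⟩
    obtain ⟨φ, hφ, rfl⟩ := exists_realize (W' := W') h hdeg hf
    refine ⟨φ, ⟨hφ, ?_⟩, ?_⟩
    · exact realize_injective (n + 1)
        (((homD_realize h hdeg hφ).symm.trans hfD).trans (map_zero _).symm)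
    · convert zero_mem (homCoboundaries (W.koszul h hodd) V n)
      exact sub_self _

end AdaptedBasis

end DGModule

/-! ### The residue field and the chain of inequalities -/

namespace DGModule

namespace AdaptedBasis

variable {k A : Type u} [Field k] [Ring A] [Algebra k A] {𝒜 : ℤ → Submodule k A}
  [GradedAlgebra 𝒜] {c : ℕ} {deg : Fin c → ℤ} {ξ : Fin c → A} {U V U' V' : DGModule 𝒜}
  (h : IsExteriorOn 𝒜 deg ξ) (hdeg : ∀ i, 0 < deg i ∧ Odd (deg i))

include hdeg in
/-- If a power of the annihilator of the homology of one complex of matrices annihilates the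
homology of another one, then the complexities are related. -/
lemma cxPair_le (W : AdaptedBasis ξ U) (W' : AdaptedBasis ξ V) (X : AdaptedBasis ξ U')
    (X' : AdaptedBasis ξ V') {l : ℕ}
    (hl : FreeModel.ann (W.model h fun i => (hdeg i).2) (W'.model h fun i => (hdeg i).2) ^ l ≤
      FreeModel.ann (X.model h fun i => (hdeg i).2) (X'.model h fun i => (hdeg i).2)) :
    cxPair U' V' ≤ cxPair U V := by
  have := (FreeModel.shiftDominated_hom
    (polyGr_eq_zero_of_odd (k := k) fun i => (hdeg i).2) hl).seqComplexity_le
  simp only [← rank_ext h hdeg] at this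
  exact this

/-- The basis of the residue field. -/
def residue : AdaptedBasis ξ h.residue where
  J := PUnit
  b := (Module.Basis.singleton PUnit k : Module.Basis PUnit k k)
  degree _ := 0
  level _ := 0
  mem _ := by
    change _ ∈ (if (0 : ℤ) = 0 then (⊤ : Submodule k k) else ⊥)
    rw [if_pos rfl]
    trivial
  level_d i j hij := by
    refine absurd ?_ hij
    exact Module.Basis.singleton_repr PUnit k (0 : k) i
  level_smul s i j hij := by
    refine absurd ?_ hij
    have h1 : h.augmentation (ξ s) = 0 := by
      have := h.augmentation_gen (Pi.single s 1)
      rwa [Fintype.linearCombination_apply_single, one_smul] at this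
    refine (Module.Basis.singleton_repr PUnit k
      (h.augmentation (ξ s) * Module.Basis.singleton PUnit k j : k) i).trans ?_
    rw [h1, zero_mul]

lemma model_residue (hdeg : ∀ i, Odd (deg i)) :
    (residue h).model h hdeg = FreeModel.unit (polyGr k deg) := by
  have h0 : (residue h).bggMatrix = 0 := by
    ext1 i j
    by_contra hij
    exact absurd (((residue h).model h hdeg).level_lt i j hij) (lt_irrefl 0)
  unfold model FreeModel.unit
  congr 1

/-- The endomorphism complex of the residue field is the polynomial ring. -/
lemma rank_homology_unit (hdeg : ∀ i, 0 < deg i ∧ Odd (deg i)) (n : ℕ) :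
    Module.rank k ((FreeModel.hom (FreeModel.unit (polyGr k deg)) (FreeModel.unit (polyGr k deg))
      (polyGr_eq_zero_of_odd fun i => (hdeg i).2)).homology (-n)) =
    Cardinal.lift.{u} (Cardinal.mk (exponents (fun i => (wt deg i).toNat) n)) := by
  set X := FreeModel.hom (FreeModel.unit (polyGr k deg)) (FreeModel.unit (polyGr k deg))
      (polyGr_eq_zero_of_odd fun i => (hdeg i).2) with hX
  have hd : ∀ φ : X, X.d φ = 0 := FreeModel.D_unit
  let T : X →ₗ[k] MvPolynomial (Fin c) k :=
    Matrix.entryLinearMap k (MvPolynomial (Fin c) k) PUnit.unit PUnit.unit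
  have hT : ∀ n (φ : X), φ ∈ X.gr n ↔ T φ ∈ polyGr k deg n := fun n φ => by
    constructor
    · intro hφ
      have := hφ PUnit.unit PUnit.unit
      change T φ ∈ polyGr k deg (n + 0 - 0) at this
      rwa [add_zero, sub_zero] at this
    · intro hφ i j
      change T φ ∈ polyGr k deg (n + 0 - 0)
      rwa [add_zero, sub_zero]
  obtain ⟨e⟩ := nonempty_quotient_equiv (Z := X.cycles (-n)) (B := X.boundaries (-n))
    (Z' := polyGr k deg (-n)) (B' := ⊥) T (fun φ hφ => (hT _ φ).mp hφ.1)
    (fun φ _ => by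
      constructor
      · intro h0
        have : φ = 0 := by
          funext i j
          exact h0
        rw [this]
        exact zero_mem _
      · rintro ⟨ψ, -, rfl⟩
        rw [hd, map_zero]
        exact zero_mem _)
    (fun p hp => by
      refine ⟨Matrix.of fun _ _ => p, ⟨(hT _ _).mpr hp, hd _⟩, ?_⟩
      exact sub_self p)
  have e2 : (polyGr k deg (-n) ⧸ (⊥ : Submodule k _).submoduleOf (polyGr k deg (-n))) ≃ₗ[k]
      polyGr k deg (-n) := Submodule.quotEquivOfEqBot _ (by simp [Submodule.submoduleOf])
  have h1 : polyGr k deg (-n) = AddMonoidAlgebra.supported k k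
      {m : Fin c →₀ ℕ | Finsupp.weight (wt deg) m = n} := by
    refine (MvPolynomial.weightedHomogeneousSubmodule_eq_finsupp_supported k _ _).trans ?_
    congr 1
    ext m
    change Finsupp.weight _ m = -(n : ℤ) ↔ _
    rw [weight_neg_wt, neg_inj]
    rfl
  rw [e.rank_eq, e2.rank_eq, h1, (AddMonoidAlgebra.supportedEquivFinsupp _).rank_eq, rank_finsupp_self]
  congr 1
  refine Cardinal.mk_congr (Finsupp.equivFunOnFinite.subtypeEquiv fun m => ?_)
  change Finsupp.weight (wt deg) m = n ↔ ∑ i, m i * (wt deg i).toNat = n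
  rw [Finsupp.weight_eq_sum, ← Nat.cast_inj (R := ℤ)]
  push_cast
  refine Eq.congr (Finset.sum_congr rfl fun i _ => ?_) rfl
  have := (hdeg i).1
  rw [nsmul_eq_mul, Int.toNat_of_nonneg]
  rw [wt]
  omega

include hdeg in
lemma cxPair_residue : cxPair h.residue h.residue = c := by
  refine seqComplexity_eq_of_exponents (fun i => (wt deg i).toNat) (fun i => ?_) _ fun n => ?_
  · have := (hdeg i).1
    rw [wt]
    omega
  · rw [rank_ext (W := residue h) (W' := residue h) h hdeg]
    have key := rank_homology_unit (k := k) hdeg n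
    rw [← model_residue h fun i => (hdeg i).2] at key
    rw [key, Cardinal.toENat_lift]

end AdaptedBasis

end DGModule

end

theorem theorem5p3 {k Λ : Type u} [Field k] [Ring Λ] [Algebra k Λ]
    (𝒜 : ℤ → Submodule k Λ) [GradedAlgebra 𝒜]
    {c : ℕ} (deg : Fin c → ℤ) (hdeg : ∀ i, 0 < deg i ∧ Odd (deg i))
    (ξ : Fin c → Λ) (hΛ : IsExteriorOn 𝒜 deg ξ)
    (U V : DGModule 𝒜) (hU : U.HasFiniteHomology) (hV : V.HasFiniteHomology) :
    cxPair V U = cxPair U V ∧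
    cxPair U V ≤ cxPair U U ∧
    cxPair U U = hΛ.injcx U ∧
    hΛ.injcx U = hΛ.cx U ∧
    hΛ.cx U ≤ hΛ.cx hΛ.residue ∧
    hΛ.cx hΛ.residue = (c : ℕ∞) := by
  unfold IsExteriorOn.injcx IsExteriorOn.cx
  obtain ⟨G, hG, hUl, hUr⟩ := DGModule.exists_finite_model hΛ hdeg U hU
  obtain ⟨G', hG', hVl, hVr⟩ := DGModule.exists_finite_model hΛ hdeg V hV
  obtain ⟨W⟩ := DGModule.nonempty_adaptedBasis hΛ (fun i => (hdeg i).1) G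
  obtain ⟨W'⟩ := DGModule.nonempty_adaptedBasis hΛ (fun i => (hdeg i).1) G'
  let R := DGModule.AdaptedBasis.residue hΛ
  rw [hUl, hUr, hUl, hVl, hVr, hUr, hUr, hUl]
  have symm : ∀ {X Y : DGModule 𝒜} (P : X.AdaptedBasis ξ) (Q : Y.AdaptedBasis ξ),
      cxPair X Y ≤ cxPair Y X := fun P Q => by
    obtain ⟨l, hl⟩ := DGModule.FreeModel.exists_ann_pow_le
      (P := Q.model hΛ fun i => (hdeg i).2) (Q := P.model hΛ fun i => (hdeg i).2)
    exact DGModule.AdaptedBasis.cxPair_le hΛ hdeg Q P P Q hl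
  have left : ∀ {X Y : DGModule 𝒜} (P : X.AdaptedBasis ξ) (Q : Y.AdaptedBasis ξ),
      cxPair X Y ≤ cxPair X X := fun P Q =>
    DGModule.AdaptedBasis.cxPair_le hΛ hdeg P P P Q (l := 1)
      (by rw [pow_one]; exact DGModule.FreeModel.ann_self_le_left)
  have right : ∀ {X Y : DGModule 𝒜} (P : X.AdaptedBasis ξ) (Q : Y.AdaptedBasis ξ),
      cxPair Y X ≤ cxPair X X := fun P Q => (symm Q P).trans (left P Q)
  refine ⟨le_antisymm (symm W' W) (symm W W'), left W W', le_antisymm ?_ (right W R),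
    le_antisymm (symm R W) (symm W R), right R W, DGModule.AdaptedBasis.cxPair_residue hΛ hdeg⟩
  obtain ⟨l, hl⟩ := DGModule.FreeModel.exists_ann_unit_pow_le (P := W.model hΛ fun i => (hdeg i).2)
  rw [← DGModule.AdaptedBasis.model_residue hΛ fun i => (hdeg i).2] at hl
  exact DGModule.AdaptedBasis.cxPair_le hΛ hdeg R W W W hl
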